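/- **Setting.** Let $d\in\{1,2,3\}$, let $\mathcal R\subset\mathbb R^d$ be a lattice with unit cell $\Gamma$ and reciprocal lattice $\mathcal R^*=\{K: K\cdot R\in 2\pi\mathbb Z\ \forall R\in\mathcal R\}$, and let $\mathcal B$ be the Brillouin zone (a unit cell of $\mathcal R^*$, with the topology of the torus $\mathbb R^d/\mathcal R^*$; functions on $\mathcal B$ are identified with $\mathcal R^*$-periodic functions on $\mathbb R^d$). Write $\fint_{\mathcal B}=|\mathcal B|^{-1}\int_{\mathcal B}$. Let $V\in L^\infty(\mathbb R^d)$ be real-valued and $\mathcal R$-periodic, with $V\in H^s_{\rm per}$ for some $s\ge 0$. For $k\in\mathbb R^d$ let $\varepsilon_{1k}\le\varepsilon_{2k}\le\cdots$ be the eigenvalues, counted with multiplicity, of $H_k=\frac12(-i\nabla+k)^2+V$ on $L^2_{\rm per}$ with domain $H^2_{\rm per}$, and for each $k$ let $(u_{nk})_{n\ge1}$ be a corresponding orthonormal basis of eigenvectors. Put $$\mathcal N(\varepsilon)=\sum_n \fint_{\mathcal B}\mathbf 1(\varepsilon_{nk}\le\varepsilon)\,dk .$$ Let $N$ be a real number (the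 number of electron pairs per cell) such that $\mathcal N(\varepsilon)=N$ has exactly one solution $\varepsilon=\varepsilon_F$ (metallic case). Let $$E=\sum_n \fint_{\mathcal B}\varepsilon_{nk}\mathbf 1(\varepsilon_{nk}\le\varepsilon_F)\,dk,\qquad \rho=\fint_{\mathcal B}\sum_n|u_{nk}|^2\,\mathbf 1(\varepsilon_{nk}\le\varepsilon_F)\,dk .$$ Assume 1. (no band crossings at $\varepsilon_F$) for $n\ne m$ there is no $k$ with $\varepsilon_{nk}=\varepsilon_{mk}=\varepsilon_F$; 2. (no van Hove singularities at $\varepsilon_F$) $\nabla_k\varepsilon_{nk}\neq0$ whenever $\varepsilon_{nk}=\varepsilon_F$. **Interpolation operators.** A family $(\Pi^L)_{L\ge1}$ of bounded linear operators on $C^0(\mathcal B,\mathbb R)$ that reproduce constants is said to be *of order $p+1$* ($p\in\mathbb N$, $p\geq 0$) if $\Pi^Lf\to f$ uniformly for every $f\in C^0(\mathcal B,\mathbb R)$ and if for every $\eta>0$ there are $C_\eta$ and $L_0(\eta)$ such that, for all $L\ge L_0(\eta)$, all $0\le p'\le p$, all open $\Omega$, and all $f\in C^0(\mathcal B,\mathbb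 R)$ of class $C^{p'+1}$ on the $\eta$-neighbourhood $\Omega_\eta$ of $\Omega$, $$\sup_{\Omega}|f-\Pi^Lf|\le \frac{C_\eta}{L^{p'+1}}\sup_{\Omega_\eta}|f^{(p'+1)}| .$$ Let $(\Pi^{L,p})$ and $(\Pi^{L,q})$ be such families, of orders $p+1$ and $q+1$. Put $\varepsilon^{L,p}_{nk}=\Pi^{L,p}[\varepsilon_{n\cdot}](k)$, $\varepsilon^{L,q}_{nk}=\Pi^{L,q}[\varepsilon_{n\cdot}](k)$ and $\mathcal N^{L,q}(\varepsilon)=\sum_n\fint_{\mathcal B}\mathbf 1(\varepsilon^{L,q}_{nk}\le\varepsilon)\,dk$. For any $\varepsilon_F^{L,q}$ with $\mathcal N^{L,q}(\varepsilon_F^{L,q})=N$, put $$E^{L,p,q}=\sum_n\fint_{\mathcal B}\varepsilon^{L,p}_{nk}\,\mathbf 1(\varepsilon^{L,q}_{nk}\le\varepsilon_F^{L,q})\,dk,\qquad \rho^{L,p,q}=\sum_n\fint_{\mathcal B}\Pi^{L,p}\big[|u_{n\cdot}|^2\big](k)\,\mathbf 1(\varepsilon^{L,q}_{nk}\le\varepsilon_F^{L,q})\,dk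 .$$ Since $k\mapsto|u_{nk}|^2$ may be discontinuous (at band crossings), wherever $\rho^{L,p,q}$ is concerned $\Pi^{L,p}$ is assumed to be given by values on a finite mesh of the torus $\mathcal B$: $\Pi^{L,p}f=\sum_j f(k_j)\varphi_j$, with distinct nodes $k_j=k_j^L$ and continuous $\varphi_j=\varphi_j^L$, and this formula defines it on $|u_{n\cdot}|^2$. **Theorem.** There is a constant $C\ge 0$ such that for all integers $L\ge1$ and every choice of $\varepsilon_F^{L,q}$ with $\mathcal N^{L,q}(\varepsilon_F^{L,q})=N$, $$\|\rho-\rho^{L,p,q}\|_{H^{s+2}_{\rm per}}\le C\left(\frac1{L^{p+1}}+\frac1{L^{q+1}}\right),\qquad |E-E^{L,p,q}|\le C\left(\frac1{L^{p+1}}+\frac1{L^{2q+2}}\right).$$ For the energy estimate, $\Pi^{L,p}$ need not be given by mesh values. -/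

import Mathlib

open MeasureTheory Filter Topology Set

open scoped ENNReal

noncomputable section

namespace BlochBands

variable {d : ℕ}

/-- The physical space `ℝ^d` with its Euclidean structure (also used for quasi-momenta). -/
abbrev E (d : ℕ) : Type := EuclideanSpace ℝ (Fin d)

/-! ### The crystalline lattice and its reciprocal lattice

The lattice is `ℤ b₁ + ⋯ + ℤ b_d` for a basis `b` of `ℝ^d`. -/

/-- The unit cell of the lattice spanned by `b`. -/
def unitCell (b : Module.Basis (Fin d) ℝ (E d)) : Set (E d) := ZSpan.fundamentalDomain b

/-- Lebesgue measure on the unit cell. -/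
def cellMeasure (b : Module.Basis (Fin d) ℝ (E d)) : Measure (E d) :=
  volume.restrict (unitCell b)

/-- The reciprocal basis, characterised by `⟪bᵢ*, bⱼ⟫ = 2π δᵢⱼ`
(see `inner_recipBasis`). -/
def recipBasis (b : Module.Basis (Fin d) ℝ (E d)) : Module.Basis (Fin d) ℝ (E d) :=
  (b.dualBasis.map (LinearMap.toContinuousLinearMap ≪≫ₗ
    (InnerProductSpace.toDual ℝ (E d)).symm.toLinearEquiv)).isUnitSMul
      (w := fun _ => 2 * Real.pi) (fun _ => (by positivity : 2 * Real.pi ≠ 0).isUnit)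

theorem inner_recipBasis (b : Module.Basis (Fin d) ℝ (E d)) (i j : Fin d) :
    inner ℝ (recipBasis b i) (b j) = if i = j then 2 * Real.pi else 0 := by
  have h : inner ℝ ((InnerProductSpace.toDual ℝ (E d)).symm
      (LinearMap.toContinuousLinearMap (b.dualBasis i))) (b j) = if i = j then 1 else 0 := by
    rw [InnerProductSpace.toDual_symm_apply]
    simp [Finsupp.single_apply, eq_comm]
  simp only [recipBasis, Module.Basis.isUnitSMul_apply, inner_smul_left]
  simp only [Module.Basis.map_apply, LinearEquiv.trans_apply]
  erw [h]
  simp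

/-- The reciprocal lattice. -/
def recipLattice (b : Module.Basis (Fin d) ℝ (E d)) : Submodule ℤ (E d) :=
  Submodule.span ℤ (range (recipBasis b))

/-- The Brillouin zone, as the fundamental unit cell of the reciprocal lattice. -/
def brillouinZone (b : Module.Basis (Fin d) ℝ (E d)) : Set (E d) :=
  ZSpan.fundamentalDomain (recipBasis b)

/-- Functions of `r` that are periodic with respect to the crystalline lattice. -/
def LatticePeriodic (b : Module.Basis (Fin d) ℝ (E d)) (V : E d → ℝ) : Prop :=
  ∀ R ∈ Submodule.span ℤ (range b), ∀ r, V (r + R) = V r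

/-- Functions of `k` that are periodic with respect to the reciprocal lattice, i.e. functions
on the torus "Brillouin zone". -/
def RecipPeriodic (b : Module.Basis (Fin d) ℝ (E d)) (f : E d → ℝ) : Prop :=
  ∀ K ∈ recipLattice b, ∀ k, f (k + K) = f k

/-! ### Periodic Lebesgue and Sobolev spaces -/

/-- `L²_per`, as `L²` of the unit cell. -/
abbrev L2per (b : Module.Basis (Fin d) ℝ (E d)) : Type := Lp ℂ 2 (cellMeasure b)

/-- `L¹_per` (real-valued), as `L¹` of the unit cell. -/
abbrev L1per (b : Module.Basis (Fin d) ℝ (E d)) : Type := Lp ℝ 1 (cellMeasure b)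

/-- The Fourier coefficient `⟨e_K, f⟩` of `f` on the unit cell `Γ`, where
`e_K(r) = |Γ|^{-1/2} exp(i K·r)` is the `L²_per`-normalised plane wave. -/
def fourierCoeffPer (b : Module.Basis (Fin d) ℝ (E d)) (f : E d → ℂ) (K : E d) : ℂ :=
  ∫ r, (((volume.real (unitCell b)) ^ (-(1 / 2) : ℝ) : ℝ) : ℂ) *
    Complex.exp (-(Complex.I * ((inner ℝ K r : ℝ) : ℂ))) * f r ∂(cellMeasure b)

/-- The norm of `H^σ_per`, i.e. `(∑_K (1 + |K|²)^σ |⟨e_K, f⟩|²)^{1/2} ∈ [0, ∞]`; an integrable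
periodic function belongs to `H^σ_per`, `σ ≥ 0`, exactly when it is finite. -/
def sobolevENorm (b : Module.Basis (Fin d) ℝ (E d)) (σ : ℝ) (f : E d → ℂ) : ℝ≥0∞ :=
  (∑' K : recipLattice b,
    ENNReal.ofReal ((1 + ‖(K : E d)‖ ^ 2) ^ σ * ‖fourierCoeffPer b f K‖ ^ 2)) ^ (1 / 2 : ℝ)

/-! ### Bloch fibers of `-½ Δ + V`, energy bands -/

/-- `H_k u = w`, where `H_k = ½ (-i∇ + k)² + V` has domain `H²_per`; the differential part is
the Fourier multiplier `½ |k + K|²`. -/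
def IsBlochImage (b : Module.Basis (Fin d) ℝ (E d)) (V : E d → ℝ) (k : E d)
    (u w : L2per b) : Prop :=
  sobolevENorm b 2 u < ⊤ ∧
  ∀ K ∈ recipLattice b,
    fourierCoeffPer b w K =
      (((1 / 2) * ‖k + K‖ ^ 2 : ℝ) : ℂ) * fourierCoeffPer b u K +
        fourierCoeffPer b (fun r => (V r : ℂ) * u r) K

/-- `ε_{n+1,k}`: the eigenvalues of `H_k` in increasing order, counted with multiplicity. It is
the least `l` such that `H_k` has `n + 1` orthonormal eigenvectors with eigenvalues at most `l`.
(The bands are numbered from `0`.) -/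
def bandEnergy (b : Module.Basis (Fin d) ℝ (E d)) (V : E d → ℝ) (n : ℕ) (k : E d) : ℝ :=
  sInf {l : ℝ | ∃ v : Fin (n + 1) → L2per b, Orthonormal ℂ v ∧
    ∀ i, ∃ m : ℝ, m ≤ l ∧ IsBlochImage b V k (v i) ((m : ℂ) • v i)}

/-- For every `k`, the family `(u n k)_n` is an orthonormal basis of `L²_per` consisting of
eigenvectors, `H_k u_{n k} = ε_{n k} u_{n k}`. No regularity in `k` is asked for. -/
structure IsEigenbasis (b : Module.Basis (Fin d) ℝ (E d)) (V : E d → ℝ)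
    (u : ℕ → E d → L2per b) : Prop where
  orthonormal : ∀ k, Orthonormal ℂ (fun n => u n k)
  complete : ∀ k, (Submodule.span ℂ (range fun n => u n k)).topologicalClosure = ⊤
  eigen : ∀ n k, IsBlochImage b V k (u n k) ((bandEnergy b V n k : ℂ) • u n k)

/-- The `n`-th sheet of the level set of the bands at the level `ε`. -/
def sheet (b : Module.Basis (Fin d) ℝ (E d)) (V : E d → ℝ) (n : ℕ) (ε : ℝ) : Set (E d) :=
  {k | bandEnergy b V n k = ε}

/-- No band crossings at the level `ε`. -/
def NoBandCrossing (b : Module.Basis (Fin d) ℝ (E d)) (V : E d → ℝ) (ε : ℝ) : Prop :=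
  ∀ n m : ℕ, n ≠ m → sheet b V n ε ∩ sheet b V m ε = ∅

/-- No van Hove singularities at the level `ε`. -/
def NoVanHove (b : Module.Basis (Fin d) ℝ (E d)) (V : E d → ℝ) (ε : ℝ) : Prop :=
  ∀ n : ℕ, ∀ k ∈ sheet b V n ε, gradient (bandEnergy b V n) k ≠ 0

/-! ### Integrated quantities

They are defined for an arbitrary family `e` of (exact or approximate) bands. -/

/-- `∑_n ⨍_BZ 1(e_{n k} ≤ ε) dk`. -/
def integratedDOS (b : Module.Basis (Fin d) ℝ (E d)) (e : ℕ → E d → ℝ) (ε : ℝ) : ℝ :=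
  ∑' n, ⨍ k in brillouinZone b, {k | e n k ≤ ε}.indicator (fun _ => (1 : ℝ)) k

/-- `∑_n ⨍_BZ g_{n k} 1(e_{n k} ≤ ε) dk`. -/
def integratedEnergy (b : Module.Basis (Fin d) ℝ (E d)) (g e : ℕ → E d → ℝ) (ε : ℝ) : ℝ :=
  ∑' n, ⨍ k in brillouinZone b, {k | e n k ≤ ε}.indicator (g n) k

/-- `ε_F` is the Fermi level of a metal with `N` electron pairs per unit cell: it is the only
solution of `𝒩(ε) = N`, for the exact integrated density of states `𝒩`. -/
def IsFermiLevel (b : Module.Basis (Fin d) ℝ (E d)) (V : E d → ℝ) (N εF : ℝ) : Prop :=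
  ∀ ε : ℝ, integratedDOS b (bandEnergy b V) ε = N ↔ ε = εF

theorem integrable_absSq (b : Module.Basis (Fin d) ℝ (E d)) (u : L2per b) :
    Integrable (fun r => ‖u r‖ ^ 2) (cellMeasure b) :=
  (Lp.memLp u).integrable_norm_pow (p := 2) (by norm_num)

/-- The function `|u|²` as an element of `L¹_per`. -/
def absSq (b : Module.Basis (Fin d) ℝ (E d)) (u : L2per b) : L1per b :=
  (integrable_absSq b u).toL1 _

/-- The electronic density `ρ_ε = ⨍_BZ ∑_n 1(ε_{n k} ≤ ε) |u_{n k}|² dk`, the density of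
the spectral projector `1(H ≤ ε)`. The sum over `n` is inside, as in the trace per unit cell, so
that the integrand does not depend on the choice of the eigenbasis. -/
def density (b : Module.Basis (Fin d) ℝ (E d)) (V : E d → ℝ) (u : ℕ → E d → L2per b)
    (ε : ℝ) : L1per b :=
  ⨍ k in brillouinZone b, ∑' n, {k | bandEnergy b V n k ≤ ε}.indicator (fun k => absSq b (u n k)) k

/-! ### Interpolation operators -/

/-- A bounded linear operator on the space of continuous functions on the Brillouin zone,
reproducing constants. It is recorded as a linear map on all functions, but only its values at
continuous periodic functions are constrained, and it is only applied to such functions. -/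
structure BZOperator (b : Module.Basis (Fin d) ℝ (E d)) where
  toLin : (E d → ℝ) →ₗ[ℝ] (E d → ℝ)
  continuous_map : ∀ f, Continuous f → RecipPeriodic b f → Continuous (toLin f)
  periodic_map : ∀ f, Continuous f → RecipPeriodic b f → RecipPeriodic b (toLin f)
  bounded : ∃ B : ℝ, ∀ f, Continuous f → RecipPeriodic b f →
    ∀ M : ℝ, (∀ k, |f k| ≤ M) → ∀ k, |toLin f k| ≤ B * M
  map_const : ∀ c : ℝ, toLin (fun _ => c) = fun _ => c

/-- The family `(P L)_{L ≥ 1}` converges strongly to the identity and is of order `p + 1`: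
for all `η > 0` there are `C` and `L₀` such that for all `L ≥ L₀`, all `p' ≤ p`, all open `Ω`
and all continuous periodic `f` of class `C^{p'+1}` on the `η`-neighbourhood `Ω_η` of `Ω`,
`sup_Ω |f - P L f| ≤ C L^{-(p'+1)} sup_{Ω_η} |f^{(p'+1)}|`. -/
structure IsInterpolationOfOrder (b : Module.Basis (Fin d) ℝ (E d)) (P : ℕ → BZOperator b)
    (p : ℕ) : Prop where
  strong : ∀ f : E d → ℝ, Continuous f → RecipPeriodic b f →
    TendstoUniformly (fun L => (P L).toLin f) f atTop
  order : ∀ η : ℝ, 0 < η → ∃ C : ℝ, ∃ L₀ : ℕ, ∀ L : ℕ, 1 ≤ L → L₀ ≤ L →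
    ∀ p' : ℕ, p' ≤ p → ∀ Ω : Set (E d), IsOpen Ω →
    ∀ f : E d → ℝ, Continuous f → RecipPeriodic b f →
    ContDiffOn ℝ ((p' + 1 : ℕ) : WithTop ℕ∞) f (Metric.thickening η Ω) →
    ∀ M : ℝ, (∀ k ∈ Metric.thickening η Ω, ‖iteratedFDeriv ℝ (p' + 1) f k‖ ≤ M) →
    ∀ k ∈ Ω, |f k - (P L).toLin f k| ≤ C / (L : ℝ) ^ (p' + 1) * M

/-- A nodal rule `f ↦ ∑_j φ_j f(k_j)`, with finitely many nodes, pairwise distinct on the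
torus, and continuous periodic weight functions `φ_j`. -/
structure NodalRule (b : Module.Basis (Fin d) ℝ (E d)) where
  m : ℕ
  node : Fin m → E d
  weight : Fin m → E d → ℝ
  node_distinct : ∀ i j, node i - node j ∈ recipLattice b → i = j
  weight_continuous : ∀ j, Continuous (weight j)
  weight_periodic : ∀ j, RecipPeriodic b (weight j)

/-- A nodal rule applied to an arbitrary, possibly discontinuous and vector-valued, function. -/
def NodalRule.apply {b : Module.Basis (Fin d) ℝ (E d)} {F : Type*} [AddCommGroup F] [Module ℝ F]
    (R : NodalRule b) (f : E d → F) (k : E d) : F :=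
  ∑ j, R.weight j k • f (R.node j)

/-- The nodal rule `R` represents the operator `P` on continuous periodic functions. -/
def NodalRule.Represents {b : Module.Basis (Fin d) ℝ (E d)} (R : NodalRule b)
    (P : BZOperator b) : Prop :=
  ∀ f : E d → ℝ, Continuous f → RecipPeriodic b f → P.toLin f = R.apply f

/-- The interpolated bands `ε_{n k}^L = Π^L[ε_{n ·}](k)`. -/
def interpBand {b : Module.Basis (Fin d) ℝ (E d)} (V : E d → ℝ) (P : BZOperator b)
    (n : ℕ) : E d → ℝ :=
  P.toLin (bandEnergy b V n)

/-- The interpolated density `∑_n ⨍_BZ Π^{L,p}[|u_n|²](k) 1(ε_{n k}^{L,q} ≤ ε) dk`, where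
`Π^{L,p}` is the nodal rule `R` and `Q` is the operator `Π^{L,q}`. -/
def interpDensity {b : Module.Basis (Fin d) ℝ (E d)} (V : E d → ℝ) (u : ℕ → E d → L2per b)
    (R : NodalRule b) (Q : BZOperator b) (ε : ℝ) : L1per b :=
  ∑' n, ⨍ k in brillouinZone b,
    {k | interpBand V Q n k ≤ ε}.indicator (R.apply fun k' => absSq b (u n k')) k

end BlochBands

end

open BlochBands

noncomputable section

namespace BlochBands

open scoped ComplexConjugate BoundedContinuousFunction

section

variable {d : ℕ}

/-! ### Plane waves -/

/-! A single band, or a single `|u_n|²`, is not smooth at a band crossing, and the eigenbasis is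
arbitrary. The sum of the `M` lowest eigenvalues and the sum of the `M` lowest densities, however,
depend only on the span of the corresponding eigenvectors. Near a point `k₀` where these bands lie
strictly below the next one, this span moves smoothly with `k`, and so do both sums
(`exists_smooth_sums`). Interpolation is linear, so it approximates the sums with error
`O(L^{-p-1})` there. In the absence of crossings at `ε_F`, the number of bands `< ε_F` and the
number of bands `≤ ε_F` at `k₀` differ by at most one, and there is a gap above either count. Near
`k₀`, for large `L`, the exact and the interpolated numbers of occupied bands are both among these
two counts (`IsLocalCount.compare`).

The interpolated bands are `h`-close to the exact ones, `h = O(L^{-q-1})`, where the latter approach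
`ε_F`, and stay on the correct side of `ε_F` elsewhere. Monotonicity of the integrated density of
states and uniqueness of the solution `ε_F` then place the interpolated Fermi level within `h` of
`ε_F` (`abs_level_sub_le`). Hence the two occupations differ only on the shell where some band is
within `2h` of `ε_F`, and there by one band. As the gradient does not vanish on the Fermi surface,
the shell has volume `O(h)` (`exists_volume_shell_le`). This gives `O(L^{-p-1} + h)` for the
density. For the energy, `ε_F N` can be subtracted from both the exact and the approximate value;
the misplaced band then contributes `ε_{nk} - ε_F = O(h)` on a set of volume `O(h)`, whence `h²`.

The norm of `H^{s+2}` is reached by working with Fourier coefficients, where multiplication by `(1 +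
|K|²)^{-σ/2}` identifies `ℓ²` with `H^σ`. For `d ≤ 3`, multiplication by `V` costs `7/4 < 2`
derivatives, so eigenvectors lie in `H^{s+2}`, the low eigenspaces have smooth frames with values in
`H^{s+2}` (`exists_frame`, by the implicit function theorem), and `|u|²` is in `H^{s+2}` because
this space is an algebra. The density estimate is thus an estimate for functions of `k` with values
in one Hilbert space. Discontinuities of `|u_n|²` elsewhere do no harm: a nodal rule of order at
least one has, for large `L`, weights that vanish away from their nodes
(`NodalRule.weight_eq_zero`).

Two uniformities remain. Only finitely many bands matter for all `L` at once: by min-max the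
oscillation of a high band is small relative to its height, and the operators are uniformly bounded
(`IsBandFamily.exists_lt_interp`). For the finitely many small `L`, the error is bounded
independently of the chosen Fermi level, which is absorbed in the constant
(`exists_forall_le_of_large`). -/

theorem unitCell_isBounded (b : Module.Basis (Fin d) ℝ (E d)) :
    Bornology.IsBounded (unitCell b) :=
  ZSpan.fundamentalDomain_isBounded b

theorem unitCell_volume_ne_top (b : Module.Basis (Fin d) ℝ (E d)) :
    volume (unitCell b) ≠ ⊤ :=
  (unitCell_isBounded b).measure_lt_top.ne

theorem unitCell_measureReal_pos (b : Module.Basis (Fin d) ℝ (E d)) :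
    0 < volume.real (unitCell b) :=
  ENNReal.toReal_pos (ZSpan.measure_fundamentalDomain_ne_zero b) (unitCell_volume_ne_top b)

instance cellMeasure_isFiniteMeasure (b : Module.Basis (Fin d) ℝ (E d)) :
    IsFiniteMeasure (cellMeasure b) :=
  ⟨by simpa [cellMeasure] using (unitCell_volume_ne_top b).lt_top⟩

/-- The constant `|Γ|^{-1/2}`. -/
def cellNorm (b : Module.Basis (Fin d) ℝ (E d)) : ℝ :=
  (volume.real (unitCell b)) ^ (-(1 / 2) : ℝ)

theorem cellNorm_pos (b : Module.Basis (Fin d) ℝ (E d)) : 0 < cellNorm b :=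
  Real.rpow_pos_of_pos (unitCell_measureReal_pos b) _

theorem cellNorm_sq (b : Module.Basis (Fin d) ℝ (E d)) :
    cellNorm b * cellNorm b * volume.real (unitCell b) = 1 := by
  have h := unitCell_measureReal_pos b
  rw [cellNorm, ← Real.rpow_add h]
  norm_num
  rw [Real.rpow_neg_one, inv_mul_cancel₀ h.ne']

/-- The normalised plane wave `e_K(r) = |Γ|^{-1/2} exp(i K·r)`. -/
def planeWave (b : Module.Basis (Fin d) ℝ (E d)) (K : E d) : E d →ᵇ ℂ :=
  BoundedContinuousFunction.ofNormedAddCommGroup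
    (fun r => (cellNorm b : ℂ) * Complex.exp (Complex.I * ((inner ℝ K r : ℝ) : ℂ)))
    (by fun_prop) (cellNorm b) (fun r => by
      rw [norm_mul, mul_comm Complex.I, Complex.norm_exp_ofReal_mul_I]
      simp [abs_of_pos (cellNorm_pos b)])

theorem planeWave_apply (b : Module.Basis (Fin d) ℝ (E d)) (K r : E d) :
    planeWave b K r = (cellNorm b : ℂ) * Complex.exp (Complex.I * ((inner ℝ K r : ℝ) : ℂ)) := rfl

theorem norm_planeWave_apply (b : Module.Basis (Fin d) ℝ (E d)) (K r : E d) :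
    ‖planeWave b K r‖ = cellNorm b := by
  rw [planeWave_apply, norm_mul, mul_comm Complex.I, Complex.norm_exp_ofReal_mul_I]
  simp [abs_of_pos (cellNorm_pos b)]

theorem conj_planeWave (b : Module.Basis (Fin d) ℝ (E d)) (K r : E d) :
    conj (planeWave b K r) =
      (cellNorm b : ℂ) * Complex.exp (-(Complex.I * ((inner ℝ K r : ℝ) : ℂ))) := by
  rw [planeWave_apply, map_mul, ← Complex.exp_conj]
  simp

theorem conj_planeWave_eq_neg (b : Module.Basis (Fin d) ℝ (E d)) (K r : E d) :
    conj (planeWave b K r) = planeWave b (-K) r := by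
  rw [conj_planeWave, planeWave_apply]; simp

theorem planeWave_add (b : Module.Basis (Fin d) ℝ (E d)) (K K' r : E d) :
    planeWave b K r * planeWave b K' r = (cellNorm b : ℂ) * planeWave b (K + K') r := by
  simp only [planeWave_apply, inner_add_left, Complex.ofReal_add, mul_add, Complex.exp_add]
  ring

theorem fourierCoeffPer_eq (b : Module.Basis (Fin d) ℝ (E d)) (f : E d → ℂ) (K : E d) :
    fourierCoeffPer b f K = ∫ r, conj (planeWave b K r) * f r ∂(cellMeasure b) := by
  simp only [conj_planeWave]; rfl

/-- The plane wave as an element of `L²_per`. -/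
def planeWaveLp (b : Module.Basis (Fin d) ℝ (E d)) (K : E d) : L2per b :=
  BoundedContinuousFunction.toLp 2 (cellMeasure b) ℂ (planeWave b K)

theorem planeWaveLp_coe (b : Module.Basis (Fin d) ℝ (E d)) (K : E d) :
    planeWaveLp b K =ᵐ[cellMeasure b] planeWave b K :=
  BoundedContinuousFunction.coeFn_toLp 2 (cellMeasure b) ℂ (planeWave b K)

theorem inner_planeWaveLp (b : Module.Basis (Fin d) ℝ (E d)) (K : E d) (f : L2per b) :
    inner ℂ (planeWaveLp b K) f = fourierCoeffPer b f K := by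
  rw [L2.inner_def, fourierCoeffPer_eq]
  refine integral_congr_ae ?_
  filter_upwards [planeWaveLp_coe b K] with r hr
  rw [hr, RCLike.inner_apply, mul_comm]

/-! ### Transport from the unit torus -/

section Torus

/-- The normalised Haar measure on the unit circle, as in `UnitAddTorus.mFourierBasis`. -/
local instance unitCircleMeasureSpace : MeasureSpace UnitAddCircle := ⟨AddCircle.haarAddCircle⟩

local instance unitCircleProbability : IsProbabilityMeasure (volume : Measure UnitAddCircle) :=
  inferInstanceAs (IsProbabilityMeasure AddCircle.haarAddCircle)

/-- A measurable section of the projection onto the unit torus, followed by the linear map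
sending the unit cube to the unit cell. -/
def torusToCell (b : Module.Basis (Fin d) ℝ (E d)) (x : UnitAddTorus (Fin d)) : E d :=
  b.equivFunL.symm (UnitAddTorus.measurableEquivPiIoc (fun _ => (0 : ℝ)) x).1

theorem measurable_torusToCell (b : Module.Basis (Fin d) ℝ (E d)) :
    Measurable (torusToCell b) :=
  b.equivFunL.symm.continuous.measurable.comp
    (measurable_subtype_coe.comp (UnitAddTorus.measurableEquivPiIoc (fun _ => (0 : ℝ))).measurable)

/-- By uniqueness of Haar measure, Lebesgue measure on `ℝ^d` is a multiple of the image of Lebesgue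
measure in the coordinates of `b`; the constant need not be computed here. -/
theorem map_torusToCell (b : Module.Basis (Fin d) ℝ (E d)) :
    ∃ c : ℝ≥0∞, cellMeasure b = c • (volume : Measure (UnitAddTorus (Fin d))).map (torusToCell b) := by
  set ψ : (Fin d → ℝ) ≃L[ℝ] E d := b.equivFunL.symm
  have hψ : Measurable ψ := ψ.continuous.measurable
  let cube : Set (Fin d → ℝ) := {x | ∀ i, x i ∈ Ioc (0 : ℝ) (0 + 1)}
  have hcube : MeasurableSet cube := MeasurableSet.univ_pi' (fun i => measurableSet_Ioc)
  have h1 : (volume : Measure (UnitAddTorus (Fin d))).map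
      (fun x => (UnitAddTorus.measurableEquivPiIoc (fun _ => (0 : ℝ)) x).1) =
      volume.restrict cube := by
    have := (UnitAddTorus.measurePreserving_equivPiIoc (fun _ : Fin d => (0 : ℝ))).map_eq
    have h := Measure.map_map (μ := (volume : Measure (UnitAddTorus (Fin d))))
      (measurable_subtype_coe (p := fun x : Fin d → ℝ => ∀ i, x i ∈ Ioc (0 : ℝ) (0 + 1)))
      (UnitAddTorus.measurableEquivPiIoc (fun _ : Fin d => (0 : ℝ))).measurable
    rw [this] at h
    exact h.symm.trans (map_comap_subtype_coe hcube _)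
  have h2 : (volume : Measure (UnitAddTorus (Fin d))).map (torusToCell b) =
      (volume.restrict cube).map ψ := by
    rw [← h1]
    exact (Measure.map_map hψ (measurable_subtype_coe.comp
      (UnitAddTorus.measurableEquivPiIoc (fun _ : Fin d => (0 : ℝ))).measurable)).symm
  have hc := Measure.isAddLeftInvariant_eq_smul (volume : Measure (E d))
    ((volume : Measure (Fin d → ℝ)).map ψ)
  set c := Measure.addHaarScalarFactor (volume : Measure (E d))
    ((volume : Measure (Fin d → ℝ)).map ψ)
  refine ⟨c, ?_⟩
  -- The section of the torus takes its values in `(0, 1]^d`, whereas the unit cell corresponds to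
  -- `[0, 1)^d`; they differ by a null set.
  have hset : cube =ᵐ[volume] ψ ⁻¹' (unitCell b) := by
    have e1 : cube = Set.pi univ fun i => Ioc ((0 : Fin d → ℝ) i) ((1 : Fin d → ℝ) i) := by
      ext x; simp [cube]
    have e2 : ψ ⁻¹' (unitCell b) =
        Set.pi univ fun i => Ico ((0 : Fin d → ℝ) i) ((1 : Fin d → ℝ) i) := by
      ext x
      have : ∀ i, b.repr (ψ x) i = x i := fun i => by
        exact congrFun (b.equivFun.apply_symm_apply x) i
      simp only [mem_preimage, unitCell, ZSpan.mem_fundamentalDomain, this]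
      simp
    rw [e1, e2, volume_pi]
    exact Measure.univ_pi_Ioc_ae_eq_Icc.trans Measure.univ_pi_Ico_ae_eq_Icc.symm
  have hcell : MeasurableSet (unitCell b) := ZSpan.fundamentalDomain_measurableSet b
  rw [h2, cellMeasure, Measure.restrict_congr_set hset, ← Measure.restrict_map hψ hcell,
    ← Measure.restrict_smul]
  conv_lhs => rw [hc]
  rfl

/-- The torus has mass one, so evaluation on the whole space identifies the constant of
`map_torusToCell`. -/
theorem cellMeasure_eq (b : Module.Basis (Fin d) ℝ (E d)) :
    cellMeasure b = volume (unitCell b) •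
      (volume : Measure (UnitAddTorus (Fin d))).map (torusToCell b) := by
  obtain ⟨c, hc⟩ := map_torusToCell b
  have h : cellMeasure b univ = c := by
    rw [hc, Measure.smul_apply, Measure.map_apply (measurable_torusToCell b) MeasurableSet.univ]
    rw [preimage_univ, smul_eq_mul]
    exact (congrArg _ measure_univ).trans (mul_one c)
  rw [hc, ← h]
  simp [cellMeasure]

theorem integral_cellMeasure (b : Module.Basis (Fin d) ℝ (E d)) {f : E d → ℂ}
    (hf : AEStronglyMeasurable f (cellMeasure b)) :
    ∫ r, f r ∂(cellMeasure b) = volume.real (unitCell b) * ∫ x, f (torusToCell b x) := by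
  have hf' : AEStronglyMeasurable f
      ((volume : Measure (UnitAddTorus (Fin d))).map (torusToCell b)) := by
    refine hf.mono_ac ?_
    rw [cellMeasure_eq]
    exact Measure.absolutelyContinuous_smul (ZSpan.measure_fundamentalDomain_ne_zero b)
  rw [cellMeasure_eq, integral_smul_measure,
    integral_map (measurable_torusToCell b).aemeasurable hf', Complex.real_smul]
  rfl

/-- The reciprocal lattice is free with basis the reciprocal basis. -/
def recipIndex (b : Module.Basis (Fin d) ℝ (E d)) : (Fin d → ℤ) ≃ recipLattice b :=
  ((recipBasis b).restrictScalars ℤ).equivFun.symm.toEquiv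

theorem recipIndex_coe (b : Module.Basis (Fin d) ℝ (E d)) (n : Fin d → ℤ) :
    (recipIndex b n : E d) = ∑ i, (n i : ℝ) • recipBasis b i := by
  change (((recipBasis b).restrictScalars ℤ).equivFun.symm n : E d) = _
  simp [Module.Basis.equivFun_symm_apply, Module.Basis.restrictScalars_apply, Int.cast_smul_eq_zsmul]

theorem inner_recipIndex (b : Module.Basis (Fin d) ℝ (E d)) (n : Fin d → ℤ) (r : E d) :
    inner ℝ (recipIndex b n : E d) r = 2 * Real.pi * ∑ i, n i * b.repr r i := by
  conv_lhs => rw [recipIndex_coe, ← b.sum_repr r]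
  simp only [sum_inner, inner_sum, inner_smul_left, inner_smul_right, inner_recipBasis]
  simp only [mul_ite, mul_zero, Finset.mul_sum]
  refine Finset.sum_congr rfl fun i _ => ?_
  simp; ring

theorem planeWave_torusToCell (b : Module.Basis (Fin d) ℝ (E d)) (n : Fin d → ℤ)
    (x : UnitAddTorus (Fin d)) :
    planeWave b (recipIndex b n) (torusToCell b x) =
      (cellNorm b : ℂ) * UnitAddTorus.mFourier n x := by
  set y := (UnitAddTorus.measurableEquivPiIoc (fun _ => (0 : ℝ)) x).1 with hy
  have hx : x = fun i => ((y i : ℝ) : UnitAddCircle) := by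
    rw [hy, ← UnitAddTorus.coe_symm_measurableEquivPiIoc_apply, MeasurableEquiv.symm_apply_apply]
  have hr : ∀ i, b.repr (torusToCell b x) i = y i := fun i => by
    exact congrFun (b.equivFun.apply_symm_apply y) i
  rw [planeWave_apply, inner_recipIndex]
  simp only [hr]
  congr 1
  rw [hx]
  simp only [UnitAddTorus.mFourier, ContinuousMap.coe_mk, fourier_coe_apply]
  rw [← Complex.exp_sum]
  congr 1
  push_cast
  simp only [Finset.mul_sum]
  refine Finset.sum_congr rfl fun i _ => ?_
  simp; ring

theorem planeWaveLp_orthonormal (b : Module.Basis (Fin d) ℝ (E d)) :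
    Orthonormal ℂ (fun K : recipLattice b => planeWaveLp b K) := by
  have key : Orthonormal ℂ (fun n => planeWaveLp b (recipIndex b n)) := by
    rw [orthonormal_iff_ite]
    intro m n
    have h0 := orthonormal_iff_ite.mp (UnitAddTorus.orthonormal_mFourier (d := Fin d)) m n
    rw [ContinuousMap.inner_toLp] at h0
    rw [inner_planeWaveLp, fourierCoeffPer_eq]
    rw [integral_congr_ae (g := fun r => conj (planeWave b (recipIndex b m) r) *
      planeWave b (recipIndex b n) r)
      (by filter_upwards [planeWaveLp_coe b (recipIndex b n)] with r hr; rw [hr])]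
    rw [integral_cellMeasure b (by
      refine Continuous.aestronglyMeasurable ?_
      exact (Complex.continuous_conj.comp (planeWave b _).continuous).mul
        (planeWave b _).continuous)]
    simp only [planeWave_torusToCell, map_mul, Complex.conj_ofReal]
    rw [← h0, integral_congr_ae
      (g := fun x => ((cellNorm b : ℂ) * cellNorm b) * (UnitAddTorus.mFourier n x *
        conj (UnitAddTorus.mFourier m x))) (ae_of_all _ fun x => by simp only; ring),
      integral_const_mul, ← mul_assoc]
    have h1 := congrArg (fun x : ℝ => (x : ℂ)) (cellNorm_sq b)
    push_cast at h1
    rw [mul_comm (volume.real (unitCell b) : ℂ), h1, one_mul]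
  have := key.comp (recipIndex b).symm (recipIndex b).symm.injective
  simpa [Function.comp_def] using this

/-- A function orthogonal to all plane waves pulls back to a function on the torus whose Fourier
coefficients vanish. Completeness of the characters of the torus makes it zero almost everywhere. -/
theorem planeWaveLp_complete (b : Module.Basis (Fin d) ℝ (E d)) :
    (Submodule.span ℂ (range fun K : recipLattice b => planeWaveLp b K))ᗮ = ⊥ := by
  rw [Submodule.eq_bot_iff]
  intro f hf
  have hf' : ∀ n, fourierCoeffPer b f (recipIndex b n) = 0 := fun n => by
    rw [← inner_planeWaveLp]
    exact (Submodule.mem_orthogonal _ _).mp hf _ (Submodule.subset_span ⟨recipIndex b n, rfl⟩)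
  have hμ0 : volume (unitCell b) ≠ 0 := ZSpan.measure_fundamentalDomain_ne_zero b
  have hac : (volume : Measure (UnitAddTorus (Fin d))).map (torusToCell b) ≪ cellMeasure b := by
    rw [cellMeasure_eq]
    exact Measure.absolutelyContinuous_smul hμ0
  have hac' : cellMeasure b ≪ (volume : Measure (UnitAddTorus (Fin d))).map (torusToCell b) := by
    rw [cellMeasure_eq]
    exact Measure.smul_absolutelyContinuous
  have hmem : MemLp (fun x => f (torusToCell b x)) 2 volume := by
    have h1 : MemLp f 2 ((volume : Measure (UnitAddTorus (Fin d))).map (torusToCell b)) := by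
      have h2 : (volume : Measure (UnitAddTorus (Fin d))).map (torusToCell b) =
          (volume (unitCell b))⁻¹ • cellMeasure b := by
        rw [cellMeasure_eq, smul_smul, ENNReal.inv_mul_cancel hμ0 (unitCell_volume_ne_top b),
          one_smul]
      rw [h2]
      exact (Lp.memLp f).smul_measure (by simpa using hμ0)
    exact (memLp_map_measure_iff h1.1 (measurable_torusToCell b).aemeasurable).mp h1
  have hF : hmem.toLp = 0 := by
    refine (UnitAddTorus.mFourierBasis (d := Fin d)).repr.injective (a₁ := hmem.toLp) (a₂ := 0) ?_
    ext n
    rw [UnitAddTorus.mFourierBasis_repr, map_zero]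
    have h3 := hf' n
    rw [fourierCoeffPer_eq, integral_cellMeasure b (by
      refine AEStronglyMeasurable.mul ?_ (Lp.aestronglyMeasurable f)
      exact (Complex.continuous_conj.comp (planeWave b _).continuous).aestronglyMeasurable)] at h3
    simp only [planeWave_torusToCell, map_mul, Complex.conj_ofReal, mul_assoc] at h3
    rw [integral_const_mul] at h3
    have hc : (cellNorm b : ℂ) ≠ 0 := by exact_mod_cast (cellNorm_pos b).ne'
    have hv : (volume.real (unitCell b) : ℂ) ≠ 0 := by
      exact_mod_cast (unitCell_measureReal_pos b).ne'
    have h4 := (mul_eq_zero.mp ((mul_eq_zero.mp h3).resolve_left hv)).resolve_left hc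
    simp only [lp.coeFn_zero, Pi.zero_apply]
    rw [← h4, UnitAddTorus.mFourierCoeff]
    refine integral_congr_ae ?_
    filter_upwards [hmem.coeFn_toLp] with x hx
    rw [hx, UnitAddTorus.mFourier_neg, smul_eq_mul]
  have h5 : ∀ᵐ x ∂(volume : Measure (UnitAddTorus (Fin d))), f (torusToCell b x) = 0 := by
    have := (Lp.eq_zero_iff_ae_eq_zero).mp hF
    filter_upwards [this, hmem.coeFn_toLp] with x hx hx'
    rw [← hx', hx]; rfl
  rw [Lp.eq_zero_iff_ae_eq_zero]
  refine hac'.ae_le ?_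
  exact (ae_map_iff (measurable_torusToCell b).aemeasurable
    ((Lp.stronglyMeasurable f).measurableSet_eq_fun stronglyMeasurable_const)).mpr h5

end Torus

/-- The plane waves as a Hilbert basis of `L²_per`. -/
def planeWaveBasis (b : Module.Basis (Fin d) ℝ (E d)) :
    HilbertBasis (recipLattice b) ℂ (L2per b) :=
  HilbertBasis.mkOfOrthogonalEqBot (planeWaveLp_orthonormal b) (planeWaveLp_complete b)

theorem planeWaveBasis_apply (b : Module.Basis (Fin d) ℝ (E d)) (K : recipLattice b) :
    planeWaveBasis b K = planeWaveLp b K := by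
  simp [planeWaveBasis]

theorem planeWaveBasis_repr (b : Module.Basis (Fin d) ℝ (E d)) (f : L2per b)
    (K : recipLattice b) : (planeWaveBasis b).repr f K = fourierCoeffPer b f K := by
  rw [HilbertBasis.repr_apply_apply, planeWaveBasis_apply, inner_planeWaveLp]

theorem fourierCoeffPer_congr {b : Module.Basis (Fin d) ℝ (E d)} {f g : E d → ℂ}
    (h : f =ᵐ[cellMeasure b] g) (K : E d) : fourierCoeffPer b f K = fourierCoeffPer b g K := by
  simp only [fourierCoeffPer_eq]
  refine integral_congr_ae ?_
  filter_upwards [h] with r hr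
  rw [hr]

/-- Fourier coefficients of a product of a bounded and a square integrable function. -/
theorem hasSum_fourierCoeffPer_mul (b : Module.Basis (Fin d) ℝ (E d)) {g : E d → ℂ}
    (hg : MemLp g ∞ (cellMeasure b)) (f : L2per b) (K : recipLattice b) :
    HasSum (fun K' : recipLattice b => (cellNorm b : ℂ) *
        fourierCoeffPer b g ((K - K' : recipLattice b) : E d) * fourierCoeffPer b f K')
      (fourierCoeffPer b (fun r => g r * f r) K) := by
  -- The coefficient of `g f` is the inner product of `ḡ e_K` with `f`. Parseval's identity for this
  -- pair of square integrable functions is the convolution formula.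
  have hm : MemLp (fun r => conj (g r) * planeWaveLp b K r) 2 (cellMeasure b) :=
    (Lp.memLp (planeWaveLp b K)).mul (hg.star)
  have h := (planeWaveBasis b).hasSum_inner_mul_inner hm.toLp f
  have e1 : (fun K' : recipLattice b => (cellNorm b : ℂ) *
        fourierCoeffPer b g ((K - K' : recipLattice b) : E d) * fourierCoeffPer b f K') =
      fun K' => inner ℂ hm.toLp (planeWaveBasis b K') * inner ℂ (planeWaveBasis b K') f := by
    funext K'
    rw [planeWaveBasis_apply, inner_planeWaveLp, L2.inner_def]
    congr 1
    rw [fourierCoeffPer_eq, ← integral_const_mul]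
    refine integral_congr_ae ?_
    filter_upwards [hm.coeFn_toLp, planeWaveLp_coe b K, planeWaveLp_coe b K'] with r h1 h2 h3
    rw [h1, h2, h3, RCLike.inner_apply, map_mul, Complex.conj_conj, conj_planeWave_eq_neg,
      conj_planeWave_eq_neg]
    have := planeWave_add b (-(K : E d)) K' r
    have e : -((K - K' : recipLattice b) : E d) = -(K : E d) + K' := by
      push_cast; abel
    rw [e, ← mul_assoc, ← this]
    ring
  have e2 : fourierCoeffPer b (fun r => g r * f r) K = inner ℂ hm.toLp f := by
    rw [fourierCoeffPer_eq, L2.inner_def]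
    refine integral_congr_ae ?_
    filter_upwards [hm.coeFn_toLp, planeWaveLp_coe b K] with r h1 h2
    rw [h1, h2, RCLike.inner_apply, map_mul, Complex.conj_conj]
    ring
  rw [e1, e2]
  exact h

/-! ### Weights on the reciprocal lattice -/

/-- The weight `1 + |K|²`. -/
def sobWeight (K : E d) : ℝ := 1 + ‖K‖ ^ 2

theorem one_le_sobWeight (K : E d) : 1 ≤ sobWeight K := by
  rw [sobWeight]; nlinarith [sq_nonneg ‖K‖]

theorem sobWeight_pos (K : E d) : 0 < sobWeight K := zero_lt_one.trans_le (one_le_sobWeight K)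

theorem sobWeight_neg (K : E d) : sobWeight (-K) = sobWeight K := by simp [sobWeight]

/-- The larger of the two weights controls the weight of the sum. In convolution estimates this
plays the role of the Leibniz rule. -/
theorem sobWeight_rpow_add_le {t : ℝ} (ht : 0 ≤ t) (K K' : E d) :
    sobWeight (K + K') ^ t ≤ 4 ^ t * (sobWeight K ^ t + sobWeight K' ^ t) := by
  have h1 : sobWeight (K + K') ≤ 4 * max (sobWeight K) (sobWeight K') := by
    have h := norm_add_le K K'
    have h2 : ‖K + K'‖ ^ 2 ≤ (‖K‖ + ‖K'‖) ^ 2 := by gcongr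
    have h3 := le_max_left (sobWeight K) (sobWeight K')
    have h4 := le_max_right (sobWeight K) (sobWeight K')
    simp only [sobWeight] at *
    nlinarith [sq_nonneg (‖K‖ - ‖K'‖)]
  calc sobWeight (K + K') ^ t ≤ (4 * max (sobWeight K) (sobWeight K')) ^ t :=
        Real.rpow_le_rpow (sobWeight_pos _).le h1 ht
    _ = 4 ^ t * max (sobWeight K) (sobWeight K') ^ t :=
        Real.mul_rpow (by norm_num) ((sobWeight_pos K).le.trans (le_max_left _ _))
    _ ≤ _ := by
        gcongr
        rcases max_choice (sobWeight K) (sobWeight K') with h | h <;> rw [h]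
        · exact le_add_of_nonneg_right (Real.rpow_nonneg (sobWeight_pos _).le _)
        · exact le_add_of_nonneg_left (Real.rpow_nonneg (sobWeight_pos _).le _)

instance recipLattice_discreteTopology (b : Module.Basis (Fin d) ℝ (E d)) :
    DiscreteTopology (recipLattice b) :=
  inferInstanceAs (DiscreteTopology (Submodule.span ℤ (range (recipBasis b))))

instance recipLattice_isZLattice (b : Module.Basis (Fin d) ℝ (E d)) :
    IsZLattice ℝ (recipLattice b) :=
  inferInstanceAs (IsZLattice ℝ (Submodule.span ℤ (range (recipBasis b))))

theorem recipLattice_finite_norm_le (b : Module.Basis (Fin d) ℝ (E d)) (r : ℝ) :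
    {K : recipLattice b | ‖(K : E d)‖ ≤ r}.Finite := by
  have h := ZSpan.setFinite_inter (recipBasis b) (Metric.isBounded_closedBall (x := 0) (r := r))
  refine Set.Finite.of_finite_image (f := Subtype.val) (h.subset ?_) Subtype.val_injective.injOn
  rintro _ ⟨K, hK, rfl⟩
  exact ⟨by simpa using hK, K.2⟩

/-- The sum converges because `7/2 > 3 ≥ d`. The exponent `7/4` is chosen between `d/2` and `2`:
`H^{7/4}` has absolutely summable Fourier coefficients, and fewer derivatives are spent than the
Laplacian returns. -/
theorem summable_sobWeight_rpow (b : Module.Basis (Fin d) ℝ (E d)) (hd : d ≤ 3) :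
    Summable fun K : recipLattice b => sobWeight (K : E d) ^ (-(7 / 4) : ℝ) := by
  have hr : Module.finrank ℤ (recipLattice b) = d := by
    rw [ZLattice.rank ℝ (recipLattice b)]; simp
  have h := ZLattice.summable_norm_rpow (recipLattice b) (-(7 / 2)) (by
    rw [hr]
    have : (d : ℝ) ≤ 3 := by exact_mod_cast hd
    linarith)
  refine Summable.of_norm_bounded_eventually h ?_
  have : ∀ᶠ K : recipLattice b in cofinite, K ≠ 0 := by
    simp
  filter_upwards [this] with K hK
  have hK' : 0 < ‖(K : E d)‖ := norm_pos_iff.mpr (by simpa using hK)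
  rw [Real.norm_of_nonneg (Real.rpow_nonneg (sobWeight_pos _).le _)]
  calc sobWeight (K : E d) ^ (-(7 / 4) : ℝ) ≤ (‖(K : E d)‖ ^ (2 : ℝ)) ^ (-(7 / 4) : ℝ) := by
        refine Real.rpow_le_rpow_of_nonpos (by positivity) ?_ (by norm_num)
        rw [sobWeight, Real.rpow_two]; linarith
    _ = ‖K‖ ^ (-(7 / 2) : ℝ) := by
        rw [← Real.rpow_mul hK'.le, Submodule.coe_norm]; norm_num

end

section

variable {d : ℕ}

/-! ### Elementary inequalities for series -/

theorem ennreal_two_mul_le_add_sq (x y : ℝ≥0∞) : 2 * (x * y) ≤ x ^ 2 + y ^ 2 := by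
  rcases eq_or_ne x ⊤ with rfl | hx
  · simp
  rcases eq_or_ne y ⊤ with rfl | hy
  · simp
  lift x to NNReal using hx
  lift y to NNReal using hy
  norm_cast
  have := two_mul_le_add_sq x y
  rwa [mul_assoc] at this

theorem ennreal_add_sq_le (x y : ℝ≥0∞) : (x + y) ^ 2 ≤ 2 * x ^ 2 + 2 * y ^ 2 := by
  have h := ennreal_two_mul_le_add_sq x y
  calc (x + y) ^ 2 = x ^ 2 + y ^ 2 + 2 * (x * y) := by ring
    _ ≤ x ^ 2 + y ^ 2 + (x ^ 2 + y ^ 2) := by gcongr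
    _ = _ := by ring

theorem ennreal_tsum_sq {ι : Type*} (f : ι → ℝ≥0∞) :
    (∑' i, f i) ^ 2 = ∑' i, ∑' j, f i * f j := by
  rw [sq, ← ENNReal.tsum_mul_right]
  simp_rw [ENNReal.tsum_mul_left]

/-- Cauchy-Schwarz for the weights `g`: sum `2 f_i f_j ≤ f_i² + f_j²` against `g_i g_j` over all
pairs. Infinite values are harmless, so finiteness never has to be discussed in advance. -/
theorem ennreal_sq_tsum_mul_le {ι : Type*} (f g : ι → ℝ≥0∞) :
    (∑' i, f i * g i) ^ 2 ≤ (∑' i, f i ^ 2 * g i) * ∑' i, g i := by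
  refine (ENNReal.mul_le_mul_iff_right (a := 2) (by norm_num) (by norm_num)).mp ?_
  rw [ennreal_tsum_sq]
  have h1 : (∑' i, f i ^ 2 * g i) * ∑' i, g i = ∑' i, ∑' j, f i ^ 2 * g i * g j := by
    rw [← ENNReal.tsum_mul_right]; simp_rw [ENNReal.tsum_mul_left]
  have h2 : (∑' i, f i ^ 2 * g i) * ∑' i, g i = ∑' i, ∑' j, g i * (f j ^ 2 * g j) := by
    rw [mul_comm, ← ENNReal.tsum_mul_right]; simp_rw [ENNReal.tsum_mul_left]
  rw [two_mul ((∑' i, f i ^ 2 * g i) * ∑' i, g i)]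
  nth_rw 1 [h1]
  rw [h2, ← ENNReal.tsum_add, ← ENNReal.tsum_mul_left]
  refine ENNReal.tsum_le_tsum fun i => ?_
  rw [← ENNReal.tsum_add, ← ENNReal.tsum_mul_left]
  refine ENNReal.tsum_le_tsum fun j => ?_
  calc 2 * (f i * g i * (f j * g j)) = 2 * (f i * f j) * (g i * g j) := by ring
    _ ≤ (f i ^ 2 + f j ^ 2) * (g i * g j) := by gcongr; exact ennreal_two_mul_le_add_sq _ _
    _ = _ := by ring

theorem ennreal_cauchy_schwarz_tsum {ι : Type*} (f g : ι → ℝ≥0∞) :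
    (∑' i, f i * g i) ^ 2 ≤ (∑' i, f i ^ 2) * ∑' i, g i ^ 2 := by
  refine (ENNReal.mul_le_mul_iff_right (a := 2) (by norm_num) (by norm_num)).mp ?_
  rw [ennreal_tsum_sq]
  have h1 : (∑' i, f i ^ 2) * ∑' i, g i ^ 2 = ∑' i, ∑' j, f i ^ 2 * g j ^ 2 := by
    rw [← ENNReal.tsum_mul_right]; simp_rw [ENNReal.tsum_mul_left]
  have h2 : (∑' i, f i ^ 2) * ∑' i, g i ^ 2 = ∑' i, ∑' j, g i ^ 2 * f j ^ 2 := by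
    rw [mul_comm, ← ENNReal.tsum_mul_right]; simp_rw [ENNReal.tsum_mul_left]
  rw [two_mul ((∑' i, f i ^ 2) * ∑' i, g i ^ 2)]
  nth_rw 1 [h1]
  rw [h2, ← ENNReal.tsum_add, ← ENNReal.tsum_mul_left]
  refine ENNReal.tsum_le_tsum fun i => ?_
  rw [← ENNReal.tsum_add, ← ENNReal.tsum_mul_left]
  refine ENNReal.tsum_le_tsum fun j => ?_
  calc 2 * (f i * g i * (f j * g j)) = 2 * ((f i * g j) * (g i * f j)) := by ring
    _ ≤ (f i * g j) ^ 2 + (g i * f j) ^ 2 := ennreal_two_mul_le_add_sq _ _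
    _ = _ := by ring

/-- Young's inequality `ℓ² * ℓ¹ ⊂ ℓ²` on an abelian group. -/
theorem ennreal_young {G : Type*} [AddCommGroup G] (f g : G → ℝ≥0∞) :
    ∑' x, (∑' y, f (x - y) * g y) ^ 2 ≤ (∑' x, f x ^ 2) * (∑' y, g y) ^ 2 := by
  calc ∑' x, (∑' y, f (x - y) * g y) ^ 2
      ≤ ∑' x, (∑' y, f (x - y) ^ 2 * g y) * ∑' y, g y :=
        ENNReal.tsum_le_tsum fun x => ennreal_sq_tsum_mul_le _ _
    _ = (∑' y, (∑' x, f (x - y) ^ 2) * g y) * ∑' y, g y := by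
        rw [ENNReal.tsum_mul_right, ENNReal.tsum_comm]
        simp_rw [ENNReal.tsum_mul_right]
    _ = _ := by
        have : ∀ y, ∑' x, f (x - y) ^ 2 = ∑' x, f x ^ 2 := fun y =>
          (Equiv.subRight y).tsum_eq (fun x => f x ^ 2)
        simp_rw [this, ENNReal.tsum_mul_left]
        ring

/-! ### Sobolev norms of sequences of Fourier coefficients -/

/-- Square summable sequences of Fourier coefficients. -/
abbrev Coef (b : Module.Basis (Fin d) ℝ (E d)) : Type := lp (fun _ : recipLattice b => ℂ) 2

variable {b : Module.Basis (Fin d) ℝ (E d)}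

/-- The squared `H^σ` norm of a sequence. -/
def sobSq (σ : ℝ) (x : recipLattice b → ℂ) : ℝ≥0∞ :=
  ∑' K : recipLattice b, ENNReal.ofReal (sobWeight (K : E d) ^ σ * ‖x K‖ ^ 2)

theorem sobolevENorm_eq (σ : ℝ) (f : E d → ℂ) :
    sobolevENorm b σ f =
      (sobSq (b := b) σ fun K => fourierCoeffPer b f K) ^ (1 / 2 : ℝ) := rfl

theorem sobSq_eq_tsum_sq (σ : ℝ) (x : recipLattice b → ℂ) :
    sobSq σ x =
      ∑' K : recipLattice b, (ENNReal.ofReal (sobWeight (K : E d) ^ (σ / 2)) * ‖x K‖ₑ) ^ 2 := by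
  refine tsum_congr fun K => ?_
  have hw := (sobWeight_pos (K : E d)).le
  have e : (sobWeight (K : E d) ^ (σ / 2)) ^ 2 = sobWeight (K : E d) ^ σ := by
    rw [← Real.rpow_natCast, ← Real.rpow_mul hw]; norm_num
  rw [mul_pow, ← ENNReal.ofReal_pow (Real.rpow_nonneg hw _), e,
    ENNReal.ofReal_mul (Real.rpow_nonneg hw _), ← ofReal_norm,
    ENNReal.ofReal_pow (norm_nonneg _)]

theorem sobSq_mono {σ τ : ℝ} (h : σ ≤ τ) (x : recipLattice b → ℂ) : sobSq σ x ≤ sobSq τ x := by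
  refine ENNReal.tsum_le_tsum fun K => ENNReal.ofReal_le_ofReal ?_
  gcongr
  exact one_le_sobWeight _

theorem sobSq_zero_coe (x : Coef b) : sobSq 0 (x : recipLattice b → ℂ) = ENNReal.ofReal (‖x‖ ^ 2) := by
  have h := lp.hasSum_norm (p := 2) (by norm_num) x
  simp only [ENNReal.toReal_ofNat, Real.rpow_two] at h
  rw [← h.tsum_eq, ENNReal.ofReal_tsum_of_nonneg (fun K => sq_nonneg _) h.summable]
  simp [sobSq]

theorem memℓp_of_sobSq {x : recipLattice b → ℂ} (h : sobSq 0 x ≠ ⊤) : Memℓp x 2 := by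
  refine (memℓp_gen_iff (by norm_num)).mpr ?_
  have : Summable fun K : recipLattice b => ‖x K‖ ^ 2 := by
    have h' := ENNReal.summable_toReal h
    refine h'.congr fun K => ?_
    rw [Real.rpow_zero, one_mul, ENNReal.toReal_ofReal (sq_nonneg _)]
  simpa using this

theorem sobSq_add_le (σ : ℝ) (x y : recipLattice b → ℂ) :
    sobSq σ (fun K => x K + y K) ≤ 2 * sobSq σ x + 2 * sobSq σ y := by
  simp only [sobSq_eq_tsum_sq]
  rw [← ENNReal.tsum_mul_left, ← ENNReal.tsum_mul_left, ← ENNReal.tsum_add]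
  refine ENNReal.tsum_le_tsum fun K => ?_
  refine le_trans ?_ (ennreal_add_sq_le _ _)
  rw [← mul_add]
  gcongr
  exact enorm_add_le _ _

theorem sobSq_smul_le (σ : ℝ) {C : ℝ} (m : recipLattice b → ℂ) (hm : ∀ K, ‖m K‖ ≤ C)
    (x : recipLattice b → ℂ) :
    sobSq σ (fun K => m K * x K) ≤ ENNReal.ofReal (C ^ 2) * sobSq σ x := by
  rw [sobSq, sobSq, ← ENNReal.tsum_mul_left]
  refine ENNReal.tsum_le_tsum fun K => ?_
  rw [← ENNReal.ofReal_mul (sq_nonneg _)]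
  refine ENNReal.ofReal_le_ofReal ?_
  have hw := Real.rpow_nonneg (sobWeight_pos (K : E d)).le σ
  have h2 : ‖m K‖ ^ 2 ≤ C ^ 2 := by gcongr; exact hm K
  rw [norm_mul, mul_pow]
  nlinarith [mul_nonneg hw (sq_nonneg ‖x K‖)]

/-- `∑_K w_K^{-7/4}`. -/
def weightSum (b : Module.Basis (Fin d) ℝ (E d)) : ℝ≥0∞ :=
  ∑' K : recipLattice b, ENNReal.ofReal (sobWeight (K : E d) ^ (-(7 / 4) : ℝ))

theorem weightSum_ne_top (b : Module.Basis (Fin d) ℝ (E d)) (hd : d ≤ 3) : weightSum b ≠ ⊤ :=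
  (summable_sobWeight_rpow b hd).tsum_ofReal_ne_top

/-- Cauchy-Schwarz after the splitting `w^r = w^{-7/8} · w^{r + 7/8}`: weighted summability of the
coefficients costs `7/4` derivatives. -/
theorem sq_tsum_weight_le (r : ℝ) (x : recipLattice b → ℂ) :
    (∑' K : recipLattice b, ENNReal.ofReal (sobWeight (K : E d) ^ r) * ‖x K‖ₑ) ^ 2 ≤
      weightSum b * sobSq (2 * r + 7 / 4) x := by
  have h := ennreal_cauchy_schwarz_tsum
    (fun K : recipLattice b => ENNReal.ofReal (sobWeight (K : E d) ^ (-(7 / 8) : ℝ)))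
    (fun K : recipLattice b =>
      ENNReal.ofReal (sobWeight (K : E d) ^ ((2 * r + 7 / 4) / 2)) * ‖x K‖ₑ)
  rw [← sobSq_eq_tsum_sq] at h
  convert h using 3
  · funext K
    rw [← mul_assoc, ← ENNReal.ofReal_mul (Real.rpow_nonneg (sobWeight_pos _).le _),
      ← Real.rpow_add (sobWeight_pos _)]
    ring_nf
  · refine tsum_congr fun K => ?_
    rw [← ENNReal.ofReal_pow (Real.rpow_nonneg (sobWeight_pos _).le _), ← Real.rpow_natCast,
      ← Real.rpow_mul (sobWeight_pos _).le]
    norm_num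

/-- The weight at `K = (K - K') + K'` is split by `sobWeight_rpow_add_le`, so that the derivatives
fall on one factor of the convolution or on the other. -/
theorem sobSq_conv_le {t : ℝ} (ht : 0 ≤ t) {y v x : recipLattice b → ℂ}
    (h : ∀ K, ‖y K‖ₑ ≤ ∑' K', ‖v (K - K')‖ₑ * ‖x K'‖ₑ) :
    sobSq t y ≤ 2 * ENNReal.ofReal (4 ^ (t / 2)) ^ 2 *
      ((∑' K, (∑' K', ENNReal.ofReal (sobWeight ((K - K' : recipLattice b) : E d) ^ (t / 2)) *
          ‖v (K - K')‖ₑ * ‖x K'‖ₑ) ^ 2) +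
        ∑' K, (∑' K', ‖v (K - K')‖ₑ *
          (ENNReal.ofReal (sobWeight (K' : E d) ^ (t / 2)) * ‖x K'‖ₑ)) ^ 2) := by
  rw [sobSq_eq_tsum_sq, ← ENNReal.tsum_add, ← ENNReal.tsum_mul_left]
  refine ENNReal.tsum_le_tsum fun K => ?_
  calc (ENNReal.ofReal (sobWeight (K : E d) ^ (t / 2)) * ‖y K‖ₑ) ^ 2
      ≤ (∑' K', ENNReal.ofReal (sobWeight (K : E d) ^ (t / 2)) *
          (‖v (K - K')‖ₑ * ‖x K'‖ₑ)) ^ 2 := by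
        rw [ENNReal.tsum_mul_left]; gcongr; exact h K
    _ ≤ (ENNReal.ofReal (4 ^ (t / 2)) *
        ((∑' K', ENNReal.ofReal (sobWeight ((K - K' : recipLattice b) : E d) ^ (t / 2)) *
          ‖v (K - K')‖ₑ * ‖x K'‖ₑ) +
        ∑' K', ‖v (K - K')‖ₑ *
          (ENNReal.ofReal (sobWeight (K' : E d) ^ (t / 2)) * ‖x K'‖ₑ))) ^ 2 := by
        rw [← ENNReal.tsum_add, ← ENNReal.tsum_mul_left]
        refine pow_le_pow_left' (ENNReal.tsum_le_tsum fun K' => ?_) 2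
        have hw := sobWeight_rpow_add_le (t := t / 2) (by positivity)
          ((K - K' : recipLattice b) : E d) K'
        have e : ((K - K' : recipLattice b) : E d) + K' = K := by push_cast; abel
        rw [e] at hw
        calc _ ≤ ENNReal.ofReal (4 ^ (t / 2) *
              (sobWeight ((K - K' : recipLattice b) : E d) ^ (t / 2) +
                sobWeight (K' : E d) ^ (t / 2))) * (‖v (K - K')‖ₑ * ‖x K'‖ₑ) := by
              gcongr
          _ = _ := by
              rw [ENNReal.ofReal_mul (by positivity), ENNReal.ofReal_add
                (Real.rpow_nonneg (sobWeight_pos _).le _) (Real.rpow_nonneg (sobWeight_pos _).le _)]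
              ring
    _ ≤ _ := by
        rw [mul_pow]
        calc _ ≤ ENNReal.ofReal (4 ^ (t / 2)) ^ 2 * _ :=
              mul_le_mul_right (ennreal_add_sq_le _ _) _
          _ = _ := by ring

/-- `H^t * H^{t + 7/4} ⊂ H^t` for convolutions. -/
theorem sobSq_conv_le_of_left {t : ℝ} (ht : 0 ≤ t) {y v x : recipLattice b → ℂ}
    (h : ∀ K, ‖y K‖ₑ ≤ ∑' K', ‖v (K - K')‖ₑ * ‖x K'‖ₑ) :
    sobSq t y ≤ (4 * ENNReal.ofReal (4 ^ (t / 2)) ^ 2 * sobSq t v * weightSum b) *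
      sobSq (t + 7 / 4) x := by
  refine (sobSq_conv_le ht h).trans ?_
  -- In both halves `v` is the `ℓ²` factor, since it has no derivative to spare; the `ℓ¹` norm is
  -- always taken of `x`, at the price of `7/4` derivatives.
  have h1 := ennreal_young (fun K : recipLattice b =>
    ENNReal.ofReal (sobWeight (K : E d) ^ (t / 2)) * ‖v K‖ₑ) (fun K => ‖x K‖ₑ)
  have h2 := ennreal_young (fun K : recipLattice b => ‖v K‖ₑ)
    (fun K => ENNReal.ofReal (sobWeight (K : E d) ^ (t / 2)) * ‖x K‖ₑ)
  rw [← sobSq_eq_tsum_sq] at h1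
  have h3 : (∑' K, ‖v K‖ₑ ^ 2) = sobSq 0 v := by rw [sobSq_eq_tsum_sq]; simp
  have h4 : (∑' K, ‖x K‖ₑ) ^ 2 ≤ weightSum b * sobSq (t + 7 / 4) x := by
    have := sq_tsum_weight_le 0 x
    simp only [Real.rpow_zero, ENNReal.ofReal_one, one_mul] at this
    refine this.trans ?_
    gcongr
    exact sobSq_mono (by linarith) x
  have h5 := sq_tsum_weight_le (t / 2) x
  rw [mul_div_cancel₀ _ (two_ne_zero' ℝ)] at h5
  rw [h3] at h2
  calc _ ≤ 2 * ENNReal.ofReal (4 ^ (t / 2)) ^ 2 *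
      (sobSq t v * (weightSum b * sobSq (t + 7 / 4) x) +
        sobSq t v * (weightSum b * sobSq (t + 7 / 4) x)) := by
        gcongr
        · exact h1.trans (by gcongr)
        · exact h2.trans (by gcongr; exact sobSq_mono ht v)
    _ = _ := by ring

/-- `H^t` is an algebra for `t ≥ 2`. -/
theorem sobSq_conv_le_algebra {t : ℝ} (ht : 2 ≤ t) {y v x : recipLattice b → ℂ}
    (h : ∀ K, ‖y K‖ₑ ≤ ∑' K', ‖v (K - K')‖ₑ * ‖x K'‖ₑ) :
    sobSq t y ≤ (4 * ENNReal.ofReal (4 ^ (t / 2)) ^ 2 * weightSum b) *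
      (sobSq t v * sobSq t x) := by
  refine (sobSq_conv_le (by linarith) h).trans ?_
  have h1 := ennreal_young (fun K : recipLattice b =>
    ENNReal.ofReal (sobWeight (K : E d) ^ (t / 2)) * ‖v K‖ₑ) (fun K => ‖x K‖ₑ)
  have h2 := ennreal_young (fun K : recipLattice b =>
    ENNReal.ofReal (sobWeight (K : E d) ^ (t / 2)) * ‖x K‖ₑ) (fun K => ‖v K‖ₑ)
  rw [← sobSq_eq_tsum_sq] at h1 h2
  have h4 : ∀ z : recipLattice b → ℂ, (∑' K, ‖z K‖ₑ) ^ 2 ≤ weightSum b * sobSq t z := fun z => by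
    have := sq_tsum_weight_le 0 z
    simp only [Real.rpow_zero, ENNReal.ofReal_one, one_mul] at this
    refine this.trans ?_
    gcongr
    exact sobSq_mono (by linarith) z
  -- Here the derivatives fall on `x`. The change of variables `K' ↦ K - K'` exchanges the factors,
  -- so that `x` becomes the `ℓ²` factor and `v` the `ℓ¹` one.
  have h5 : ∀ K : recipLattice b, ∑' K', ‖v (K - K')‖ₑ *
      (ENNReal.ofReal (sobWeight (K' : E d) ^ (t / 2)) * ‖x K'‖ₑ) =
      ∑' K', ENNReal.ofReal (sobWeight ((K - K' : recipLattice b) : E d) ^ (t / 2)) *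
        ‖x (K - K')‖ₑ * ‖v K'‖ₑ := fun K => by
    rw [← (Equiv.subLeft K).tsum_eq]
    refine tsum_congr fun K' => ?_
    simp only [Equiv.subLeft_apply, sub_sub_cancel]
    ring
  simp_rw [h5]
  calc _ ≤ 2 * ENNReal.ofReal (4 ^ (t / 2)) ^ 2 *
      (sobSq t v * (weightSum b * sobSq t x) + sobSq t x * (weightSum b * sobSq t v)) := by
        gcongr
        · exact h1.trans (by gcongr; exact h4 x)
        · exact h2.trans (by gcongr; exact h4 v)
    _ = _ := by ring

end

section

variable {d : ℕ} {b : Module.Basis (Fin d) ℝ (E d)}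

/-! ### Diagonal operators -/

open Classical in
/-- The diagonal operator with bounded symbol `m` (zero if `m` is unbounded). -/
def diagOp (m : recipLattice b → ℂ) : Coef b →L[ℂ] Coef b :=
  if h : ∃ C : ℝ, 0 ≤ C ∧ ∀ K, ‖m K‖ ≤ C then
    lp.mapCLM 2 (fun K => m K • ContinuousLinearMap.id ℂ ℂ) h.choose_spec.1 (fun K => by
      rw [norm_smul, ContinuousLinearMap.norm_id, mul_one]; exact h.choose_spec.2 K)
  else 0

theorem diagOp_apply {m : recipLattice b → ℂ} {C : ℝ} (hm : ∀ K, ‖m K‖ ≤ C) (x : Coef b)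
    (K : recipLattice b) : diagOp m x K = m K * x K := by
  have h : ∃ C : ℝ, 0 ≤ C ∧ ∀ K, ‖m K‖ ≤ C := ⟨C, (norm_nonneg _).trans (hm 0), hm⟩
  rw [diagOp, dif_pos h, lp.mapCLM_apply_coe]
  simp

/-- Multiplication by `w^{-σ/2}`, whose range is `H^σ`. -/
def sobScale (b : Module.Basis (Fin d) ℝ (E d)) (σ : ℝ) : Coef b →L[ℂ] Coef b :=
  diagOp fun K => ((sobWeight (K : E d) ^ (-(σ / 2)) : ℝ) : ℂ)

theorem sobScale_apply {σ : ℝ} (hσ : 0 ≤ σ) (x : Coef b) (K : recipLattice b) :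
    sobScale b σ x K = ((sobWeight (K : E d) ^ (-(σ / 2)) : ℝ) : ℂ) * x K := by
  refine diagOp_apply (C := 1) (fun K => ?_) x K
  rw [Complex.norm_real, Real.norm_of_nonneg (Real.rpow_nonneg (sobWeight_pos _).le _)]
  exact Real.rpow_le_one_of_one_le_of_nonpos (one_le_sobWeight _) (by linarith)

theorem sobSq_sobScale {σ : ℝ} (hσ : 0 ≤ σ) (τ : ℝ) (x : Coef b) :
    sobSq τ (sobScale b σ x) = sobSq (τ - σ) x := by
  refine tsum_congr fun K => ?_
  have hw := sobWeight_pos (K : E d)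
  rw [sobScale_apply hσ, norm_mul, mul_pow, Complex.norm_real,
    Real.norm_of_nonneg (Real.rpow_nonneg hw.le _), ← Real.rpow_natCast, ← Real.rpow_mul hw.le,
    ← mul_assoc, ← Real.rpow_add hw]
  congr 3
  push_cast; ring

theorem sobSq_sobScale_self {σ : ℝ} (hσ : 0 ≤ σ) (x : Coef b) :
    sobSq σ (sobScale b σ x) = ENNReal.ofReal (‖x‖ ^ 2) := by
  rw [sobSq_sobScale hσ, sub_self, sobSq_zero_coe]

theorem sobScale_injective {σ : ℝ} (hσ : 0 ≤ σ) : Function.Injective (sobScale b σ) := by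
  intro x y h
  ext K
  have hK := congrArg (fun z : Coef b => z K) h
  simp only [sobScale_apply hσ] at hK
  refine mul_left_cancel₀ ?_ hK
  exact_mod_cast (Real.rpow_pos_of_pos (sobWeight_pos _) _).ne'

theorem sobScale_add {σ τ : ℝ} (hσ : 0 ≤ σ) (hτ : 0 ≤ τ) (x : Coef b) :
    sobScale b (σ + τ) x = sobScale b σ (sobScale b τ x) := by
  ext K
  rw [sobScale_apply (add_nonneg hσ hτ), sobScale_apply hσ, sobScale_apply hτ, ← mul_assoc,
    ← Complex.ofReal_mul, ← Real.rpow_add (sobWeight_pos _)]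
  ring_nf

theorem memℓp_weight_of_sobSq {σ : ℝ} {x : recipLattice b → ℂ} (h : sobSq σ x ≠ ⊤) :
    Memℓp (fun K : recipLattice b => ((sobWeight (K : E d) ^ (σ / 2) : ℝ) : ℂ) * x K) 2 := by
  refine memℓp_of_sobSq ?_
  have e : sobSq 0 (fun K : recipLattice b =>
      ((sobWeight (K : E d) ^ (σ / 2) : ℝ) : ℂ) * x K) = sobSq σ x := by
    refine tsum_congr fun K => ?_
    have hw := sobWeight_pos (K : E d)
    rw [norm_mul, mul_pow, Complex.norm_real, Real.norm_of_nonneg (Real.rpow_nonneg hw.le _),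
      ← Real.rpow_natCast, ← Real.rpow_mul hw.le, Real.rpow_zero, one_mul]
    norm_num
  rwa [e]

theorem weight_mul_weight_neg (σ : ℝ) (K : E d) (z : ℂ) :
    ((sobWeight K ^ (-(σ / 2)) : ℝ) : ℂ) * (((sobWeight K ^ (σ / 2) : ℝ) : ℂ) * z) = z := by
  rw [← mul_assoc, ← Complex.ofReal_mul, ← Real.rpow_add (sobWeight_pos _)]
  simp

theorem exists_coe_eq_weight_mul {σ : ℝ} {x : recipLattice b → ℂ} (h : sobSq σ x ≠ ⊤) :
    ∃ a : Coef b, (a : recipLattice b → ℂ) =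
      fun K : recipLattice b => ((sobWeight (K : E d) ^ (σ / 2) : ℝ) : ℂ) * x K :=
  ⟨⟨fun K : recipLattice b => ((sobWeight (K : E d) ^ (σ / 2) : ℝ) : ℂ) * x K,
    memℓp_weight_of_sobSq h⟩, rfl⟩

theorem exists_sobScale {σ : ℝ} (hσ : 0 ≤ σ) {x : recipLattice b → ℂ} (h : sobSq σ x ≠ ⊤) :
    ∃ a : Coef b, ∀ K, sobScale b σ a K = x K := by
  obtain ⟨a, ha⟩ := exists_coe_eq_weight_mul h
  refine ⟨a, fun K => ?_⟩
  rw [sobScale_apply hσ, ha]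
  exact weight_mul_weight_neg σ (K : E d) (x K)

/-- A bilinear map with values in `H^σ`, as a bounded map into the scaled space. -/
theorem exists_lift_bilinear {σ : ℝ} (hσ : 0 ≤ σ) {F G : Type*} [NormedAddCommGroup F]
    [NormedSpace ℝ F] [NormedAddCommGroup G] [NormedSpace ℝ G]
    (A : F →L[ℝ] G →L[ℝ] Coef b) {C : ℝ≥0∞} (hC : C ≠ ⊤)
    (h : ∀ x y, sobSq σ (A x y) ≤ C * ENNReal.ofReal (‖x‖ ^ 2 * ‖y‖ ^ 2)) :
    ∃ A' : F →L[ℝ] G →L[ℝ] Coef b, ∀ x y, sobScale b σ (A' x y) = A x y := by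
  have hfin : ∀ x y, sobSq σ (A x y) ≠ ⊤ := fun x y =>
    ((h x y).trans_lt (ENNReal.mul_lt_top hC.lt_top ENNReal.ofReal_lt_top)).ne
  choose T hT using fun x y => exists_sobScale hσ (hfin x y)
  have hT' : ∀ x y, sobScale b σ (T x y) = A x y := fun x y => by ext K; exact hT x y K
  have inj := sobScale_injective (b := b) hσ
  let L : F →ₗ[ℝ] G →ₗ[ℝ] Coef b := LinearMap.mk₂ ℝ T
    (fun x x' y => inj (by rw [map_add]; simp [hT']))
    (fun c x y => inj (by rw [ContinuousLinearMap.map_smul_of_tower]; simp [hT']))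
    (fun x y y' => inj (by rw [map_add]; simp [hT']))
    (fun c x y => inj (by rw [ContinuousLinearMap.map_smul_of_tower]; simp [hT']))
  refine ⟨LinearMap.mkContinuous₂ L (Real.sqrt C.toReal) fun x y => ?_, fun x y => hT' x y⟩
  have h1 := h x y
  rw [← hT' x y, sobSq_sobScale_self hσ] at h1
  have h2 : ‖T x y‖ ^ 2 ≤ C.toReal * (‖x‖ ^ 2 * ‖y‖ ^ 2) := by
    have := ENNReal.toReal_mono (ENNReal.mul_ne_top hC ENNReal.ofReal_ne_top) h1
    rwa [ENNReal.toReal_mul, ENNReal.toReal_ofReal (by positivity),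
      ENNReal.toReal_ofReal (by positivity)] at this
  change ‖T x y‖ ≤ _
  refine le_of_sq_le_sq (h2.trans (le_of_eq ?_)) (by positivity)
  rw [mul_pow, mul_pow, Real.sq_sqrt ENNReal.toReal_nonneg]
  ring

/-- A bounded operator with values in `H^σ`, as a bounded map into the scaled space. -/
theorem exists_lift_linear {σ : ℝ} (hσ : 0 ≤ σ) (A : Coef b →L[ℂ] Coef b) {C : ℝ≥0∞} (hC : C ≠ ⊤)
    (h : ∀ x, sobSq σ (A x) ≤ C * ENNReal.ofReal (‖x‖ ^ 2)) :
    ∃ A' : Coef b →L[ℂ] Coef b, ∀ x, sobScale b σ (A' x) = A x := by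
  have hfin : ∀ x, sobSq σ (A x) ≠ ⊤ := fun x =>
    ((h x).trans_lt (ENNReal.mul_lt_top hC.lt_top ENNReal.ofReal_lt_top)).ne
  choose T hT using fun x => exists_sobScale hσ (hfin x)
  have hT' : ∀ x, sobScale b σ (T x) = A x := fun x => by ext K; exact hT x K
  have inj := sobScale_injective (b := b) hσ
  let L : Coef b →ₗ[ℂ] Coef b :=
    { toFun := T
      map_add' := fun x y => inj (by rw [map_add]; simp [hT'])
      map_smul' := fun c x => inj (by simp [hT']) }
  refine ⟨L.mkContinuous (Real.sqrt C.toReal) fun x => ?_, fun x => hT' x⟩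
  have h1 := h x
  rw [← hT' x, sobSq_sobScale_self hσ] at h1
  have h2 : ‖T x‖ ^ 2 ≤ C.toReal * ‖x‖ ^ 2 := by
    have := ENNReal.toReal_mono (ENNReal.mul_ne_top hC ENNReal.ofReal_ne_top) h1
    rwa [ENNReal.toReal_mul, ENNReal.toReal_ofReal (by positivity),
      ENNReal.toReal_ofReal (by positivity)] at this
  change ‖T x‖ ≤ _
  refine le_of_sq_le_sq (h2.trans (le_of_eq ?_)) (by positivity)
  rw [mul_pow, Real.sq_sqrt ENNReal.toReal_nonneg]

/-- Translation of the Fourier coefficients, i.e. multiplication by `e^{-i K₀·r}`. -/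
def shiftOp (K₀ : recipLattice b) : Coef b →ₗᵢ[ℂ] Coef b where
  toFun x := ⟨fun K => x (K + K₀), by
    have h := (memℓp_gen_iff (p := 2) (by norm_num)).mp (lp.memℓp x)
    exact (memℓp_gen_iff (by norm_num)).mpr ((Equiv.addRight K₀).summable_iff.mpr h)⟩
  map_add' x y := by ext K; rfl
  map_smul' c x := by ext K; rfl
  norm_map' x := by
    rw [lp.norm_eq_tsum_rpow (by norm_num), lp.norm_eq_tsum_rpow (by norm_num)]
    congr 1
    exact (Equiv.addRight K₀).tsum_eq fun K => ‖x K‖ ^ (2 : ℝ≥0∞).toReal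

theorem shiftOp_apply (K₀ : recipLattice b) (x : Coef b) (K : recipLattice b) :
    shiftOp K₀ x K = x (K + K₀) := rfl

/-! ### Multiplication by the potential, on the Fourier side -/

/-- Multiplication by a bounded function, acting on Fourier coefficients. -/
def potOp (b : Module.Basis (Fin d) ℝ (E d)) {g : E d → ℂ} (hg : MemLp g ∞ (cellMeasure b)) :
    Coef b →L[ℂ] Coef b :=
  (planeWaveBasis b).repr.toContinuousLinearEquiv.toContinuousLinearMap ∘L
    ((ContinuousLinearMap.mul ℂ ℂ).holderL (cellMeasure b) ∞ 2 2 hg.toLp) ∘L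
      (planeWaveBasis b).repr.symm.toContinuousLinearEquiv.toContinuousLinearMap

theorem potOp_repr {g : E d → ℂ} (hg : MemLp g ∞ (cellMeasure b)) (u : L2per b)
    (K : recipLattice b) :
    potOp b hg ((planeWaveBasis b).repr u) K = fourierCoeffPer b (fun r => g r * u r) K := by
  have h : potOp b hg ((planeWaveBasis b).repr u) = (planeWaveBasis b).repr
      ((ContinuousLinearMap.mul ℂ ℂ).holder 2 hg.toLp u) := by
    change (planeWaveBasis b).repr ((ContinuousLinearMap.mul ℂ ℂ).holder 2 hg.toLp
      ((planeWaveBasis b).repr.symm ((planeWaveBasis b).repr u))) = _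
    rw [LinearIsometryEquiv.symm_apply_apply]
  rw [h, planeWaveBasis_repr]
  refine fourierCoeffPer_congr ?_ _
  filter_upwards [ContinuousLinearMap.coeFn_holder (r := 2) (ContinuousLinearMap.mul ℂ ℂ) hg.toLp u,
    hg.coeFn_toLp] with r h1 h2
  rw [h1, h2]; rfl

theorem hasSum_potOp {g : E d → ℂ} (hg : MemLp g ∞ (cellMeasure b)) (x : Coef b)
    (K : recipLattice b) :
    HasSum (fun K' : recipLattice b => (cellNorm b : ℂ) *
      fourierCoeffPer b g ((K - K' : recipLattice b) : E d) * x K') (potOp b hg x K) := by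
  obtain ⟨u, rfl⟩ := (planeWaveBasis b).repr.surjective x
  rw [potOp_repr]
  simpa only [planeWaveBasis_repr] using hasSum_fourierCoeffPer_mul b hg u K

theorem potOp_inner {V : E d → ℝ} (hV : MemLp (fun r => (V r : ℂ)) ∞ (cellMeasure b))
    (x y : Coef b) : inner ℂ (potOp b hV x) y = inner ℂ x (potOp b hV y) := by
  obtain ⟨u, rfl⟩ := (planeWaveBasis b).repr.surjective x
  obtain ⟨v, rfl⟩ := (planeWaveBasis b).repr.surjective y
  have h : ∀ u, potOp b hV ((planeWaveBasis b).repr u) = (planeWaveBasis b).repr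
      ((ContinuousLinearMap.mul ℂ ℂ).holder 2 hV.toLp u) := fun u => by
    ext K
    rw [potOp_repr, planeWaveBasis_repr]
    refine fourierCoeffPer_congr ?_ _
    filter_upwards [ContinuousLinearMap.coeFn_holder (r := 2) (ContinuousLinearMap.mul ℂ ℂ)
      hV.toLp u, hV.coeFn_toLp] with r h1 h2
    rw [h1, h2]; rfl
  rw [h, h, LinearIsometryEquiv.inner_map_map, LinearIsometryEquiv.inner_map_map, L2.inner_def,
    L2.inner_def]
  refine integral_congr_ae ?_
  filter_upwards [ContinuousLinearMap.coeFn_holder (r := 2) (ContinuousLinearMap.mul ℂ ℂ)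
    hV.toLp u, ContinuousLinearMap.coeFn_holder (r := 2) (ContinuousLinearMap.mul ℂ ℂ)
    hV.toLp v, hV.coeFn_toLp] with r h1 h2 h3
  rw [h1, h2, h3, RCLike.inner_apply, RCLike.inner_apply, ContinuousLinearMap.mul_apply',
    ContinuousLinearMap.mul_apply', map_mul, Complex.conj_ofReal]
  ring

/-- The properties of the multiplication by an `H^s` potential, in Fourier coefficients, that are
used below. -/
structure IsPotential (s : ℝ) (A : Coef b →L[ℂ] Coef b) : Prop where
  symm : ∀ x y, inner ℂ (A x) y = inner ℂ x (A y)
  shift : ∀ K₀ x, A (shiftOp K₀ x) = shiftOp K₀ (A x)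
  regular : ∀ t, 0 ≤ t → t ≤ s → ∃ C : ℝ≥0∞, C ≠ ⊤ ∧
    ∀ x, sobSq t (A x) ≤ C * sobSq (t + 7 / 4) x

/-- The matrix entries of the multiplication depend on `K - K'` only, which gives the commutation
with translations. The regularity is the convolution estimate with the `H^s` coefficients of `V`. -/
theorem isPotential_potOp (hd : d ≤ 3) {V : E d → ℝ}
    (hV : MemLp (fun r => (V r : ℂ)) ∞ (cellMeasure b)) {s : ℝ}
    (hVs : sobolevENorm b s (fun r => (V r : ℂ)) < ⊤) : IsPotential s (potOp b hV) where
  symm := potOp_inner hV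
  shift K₀ x := by
    ext K
    have h1 := hasSum_potOp hV (shiftOp K₀ x) K
    have h2 := hasSum_potOp hV x (K + K₀)
    rw [← (Equiv.addRight K₀).hasSum_iff] at h2
    rw [shiftOp_apply]
    refine h1.unique ?_
    convert h2 using 2 with K'
    simp [shiftOp_apply]
  regular t ht hts := by
    have hfin : sobSq (b := b) t (fun K => (cellNorm b : ℂ) *
        fourierCoeffPer b (fun r => (V r : ℂ)) K) ≠ ⊤ := by
      rw [sobolevENorm_eq, ENNReal.rpow_lt_top_iff_of_pos (by norm_num)] at hVs
      refine ne_top_of_le_ne_top ?_ (sobSq_smul_le t (fun _ => (cellNorm b : ℂ)) (C := cellNorm b)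
        (fun _ => by simp [abs_of_pos (cellNorm_pos b)]) _)
      exact ENNReal.mul_ne_top ENNReal.ofReal_ne_top
        (ne_top_of_le_ne_top hVs.ne (sobSq_mono hts _))
    refine ⟨_, ?_, fun x => sobSq_conv_le_of_left (v := fun K : recipLattice b =>
        (cellNorm b : ℂ) * fourierCoeffPer b (fun r => (V r : ℂ)) K) ht fun K => ?_⟩
    · exact ENNReal.mul_ne_top (ENNReal.mul_ne_top (ENNReal.mul_ne_top (by norm_num)
        (by simp)) hfin) (weightSum_ne_top b hd)
    · rw [← (hasSum_potOp hV x K).tsum_eq]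
      simp_rw [← enorm_mul]
      exact enorm_tsum_le_tsum_enorm

end

section

variable {d : ℕ} {b : Module.Basis (Fin d) ℝ (E d)}

/-! ### The fibers as operators on sequences -/

/-- `H_k x = y`, on the Fourier side, for the potential operator `A`. -/
def IsImage (A : Coef b →L[ℂ] Coef b) (k : E d) (x y : Coef b) : Prop :=
  sobSq 2 x ≠ ⊤ ∧ ∀ K : recipLattice b, y K = (((1 / 2) * ‖k + K‖ ^ 2 : ℝ) : ℂ) * x K + A x K

/-- The symbol of `½(-i∇ + k)²` relative to the weight. -/
def kinSymbol (b : Module.Basis (Fin d) ℝ (E d)) (k : E d) (K : recipLattice b) : ℂ :=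
  (((1 / 2) * ‖k + K‖ ^ 2 * sobWeight (K : E d) ^ (-1 : ℝ) : ℝ) : ℂ)

theorem norm_kinSymbol_le (k : E d) (K : recipLattice b) : ‖kinSymbol b k K‖ ≤ ‖k‖ ^ 2 + 1 := by
  have hw := sobWeight_pos (K : E d)
  rw [kinSymbol, Complex.norm_real, Real.norm_of_nonneg (by positivity), Real.rpow_neg_one,
    ← div_eq_mul_inv, div_le_iff₀ hw]
  have h1 := norm_add_le k K
  have h2 : ‖k + K‖ ^ 2 ≤ (‖k‖ + ‖(K : E d)‖) ^ 2 := by gcongr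
  have h3 := mul_nonneg (sq_nonneg ‖k‖) (sq_nonneg ‖(K : E d)‖)
  rw [sobWeight]
  nlinarith [sq_nonneg (‖k‖ - ‖(K : E d)‖)]

/-- `H_k` as a bounded operator from (the parametrisation of) `H²` to `L²`. -/
def hamOp (A : Coef b →L[ℂ] Coef b) (k : E d) : Coef b →L[ℂ] Coef b :=
  diagOp (kinSymbol b k) + A ∘L sobScale b 2

theorem hamOp_apply (A : Coef b →L[ℂ] Coef b) (k : E d) (a : Coef b) (K : recipLattice b) :
    hamOp A k a K = (((1 / 2) * ‖k + K‖ ^ 2 : ℝ) : ℂ) * sobScale b 2 a K +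
      A (sobScale b 2 a) K := by
  change diagOp (kinSymbol b k) a K + A (sobScale b 2 a) K = _
  rw [diagOp_apply (norm_kinSymbol_le k), sobScale_apply (by norm_num), ← mul_assoc,
    ← Complex.ofReal_mul, kinSymbol]
  norm_num

/-- With `H²` parametrised by `ℓ²`, the unbounded `H_k` becomes the bounded operator `hamOp A k`,
and linearity in the domain variable is inherited from it. -/
theorem isImage_iff {A : Coef b →L[ℂ] Coef b} {k : E d} {x y : Coef b} :
    IsImage A k x y ↔ ∃ a, sobScale b 2 a = x ∧ hamOp A k a = y := by
  constructor
  · rintro ⟨h1, h2⟩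
    obtain ⟨a, ha⟩ := exists_sobScale (by norm_num) h1
    have ha' : sobScale b 2 a = x := by ext K; exact ha K
    refine ⟨a, ha', ?_⟩
    ext K
    rw [hamOp_apply, ha', h2]
  · rintro ⟨a, rfl, rfl⟩
    exact ⟨by rw [sobSq_sobScale_self (by norm_num)]; exact ENNReal.ofReal_ne_top,
      fun K => hamOp_apply A k a K⟩

theorem isImage_sobScale (A : Coef b →L[ℂ] Coef b) (k : E d) (a : Coef b) :
    IsImage A k (sobScale b 2 a) (hamOp A k a) := isImage_iff.mpr ⟨a, rfl, rfl⟩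

theorem IsImage.unique {A : Coef b →L[ℂ] Coef b} {k : E d} {x y y' : Coef b}
    (h : IsImage A k x y) (h' : IsImage A k x y') : y = y' := by
  ext K; rw [h.2, h'.2]

theorem IsImage.add {A : Coef b →L[ℂ] Coef b} {k : E d} {x y x' y' : Coef b}
    (h : IsImage A k x y) (h' : IsImage A k x' y') : IsImage A k (x + x') (y + y') := by
  obtain ⟨a, rfl, rfl⟩ := isImage_iff.mp h
  obtain ⟨a', rfl, rfl⟩ := isImage_iff.mp h'
  exact isImage_iff.mpr ⟨a + a', map_add _ _ _, map_add _ _ _⟩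

theorem IsImage.smul {A : Coef b →L[ℂ] Coef b} {k : E d} {x y : Coef b}
    (h : IsImage A k x y) (c : ℂ) : IsImage A k (c • x) (c • y) := by
  obtain ⟨a, rfl, rfl⟩ := isImage_iff.mp h
  exact isImage_iff.mpr ⟨c • a, map_smul _ _ _, map_smul _ _ _⟩

theorem IsImage.sum {A : Coef b →L[ℂ] Coef b} {k : E d} {ι : Type*} (s : Finset ι)
    {x y : ι → Coef b} (h : ∀ i ∈ s, IsImage A k (x i) (y i)) :
    IsImage A k (∑ i ∈ s, x i) (∑ i ∈ s, y i) := by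
  classical
  induction s using Finset.induction_on with
  | empty => exact isImage_iff.mpr ⟨0, by simp, by simp⟩
  | insert i s hi ih =>
    rw [Finset.sum_insert hi, Finset.sum_insert hi]
    exact (h i (Finset.mem_insert_self i s)).add
      (ih fun j hj => h j (Finset.mem_insert_of_mem hj))

theorem ofReal_mul_mul_conj (c : ℝ) (z : ℂ) :
    (c : ℂ) * z * conj z = ((c * ‖z‖ ^ 2 : ℝ) : ℂ) := by
  rw [mul_assoc, Complex.mul_conj, Complex.normSq_eq_norm_sq]; push_cast; rfl

/-- The kinetic part `½(-i∇ + k)² x` of an image. -/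
theorem IsImage.kinetic_hasSum {A : Coef b →L[ℂ] Coef b} {k : E d} {x y : Coef b}
    (h : IsImage A k x y) :
    HasSum (fun K : recipLattice b => (1 / 2) * ‖k + K‖ ^ 2 * ‖x K‖ ^ 2)
      (RCLike.re (inner ℂ x y) - RCLike.re (inner ℂ x (A x))) := by
  have h1 := lp.hasSum_inner (𝕜 := ℂ) x (y - A x)
  have h2 := RCLike.hasSum_re ℂ h1
  rw [inner_sub_right, map_sub] at h2
  refine h2.congr_fun fun K => ?_
  rw [lp.coeFn_sub, Pi.sub_apply, h.2 K, add_sub_cancel_right, RCLike.inner_apply,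
    ofReal_mul_mul_conj]
  rfl

theorem IsImage.symm_inner {A : Coef b →L[ℂ] Coef b}
    (hA : ∀ x y, inner ℂ (A x) y = inner ℂ x (A y)) {k : E d} {x y x' y' : Coef b}
    (h : IsImage A k x y) (h' : IsImage A k x' y') : inner ℂ y x' = inner ℂ x y' := by
  have e : inner ℂ (y - A x) x' = inner ℂ x (y' - A x') := by
    rw [lp.inner_eq_tsum, lp.inner_eq_tsum]
    refine tsum_congr fun K => ?_
    rw [lp.coeFn_sub, Pi.sub_apply, h.2 K, add_sub_cancel_right, lp.coeFn_sub, Pi.sub_apply,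
      h'.2 K, add_sub_cancel_right, RCLike.inner_apply, RCLike.inner_apply, map_mul,
      Complex.conj_ofReal]
    ring
  rw [inner_sub_left, inner_sub_right, hA] at e
  exact sub_left_injective e

/-- The shifted form `⟨x, (H_k + ‖A‖) x⟩` and its dependence on `k`. -/
theorem IsImage.form_le {A : Coef b →L[ℂ] Coef b} {k k' : E d} {x y y' : Coef b}
    (h : IsImage A k x y) (h' : IsImage A k' x y') {θ : ℝ} (hθ : 0 < θ) :
    RCLike.re (inner ℂ x y') + ‖A‖ * ‖x‖ ^ 2 ≤
      (1 + θ) * (RCLike.re (inner ℂ x y) + ‖A‖ * ‖x‖ ^ 2) +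
        (1 + 1 / θ) * (‖k' - k‖ ^ 2 / 2) * ‖x‖ ^ 2 := by
  have s1 := h.kinetic_hasSum
  have s2 := h'.kinetic_hasSum
  have s3 := lp.hasSum_norm (p := 2) (by norm_num) x
  simp only [ENNReal.toReal_ofNat, Real.rpow_two] at s3
  have s4 := hasSum_le (fun K => ?_) s2
    ((s1.mul_left (1 + θ)).add (s3.mul_left ((1 + 1 / θ) * (‖k' - k‖ ^ 2 / 2))))
  -- After the shift by `‖A‖` the potential part of the form is nonnegative, so multiplying it by `1
  -- + θ` only increases it; the series comparison takes care of the kinetic part.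
  · have hb : |RCLike.re (inner ℂ x (A x))| ≤ ‖A‖ * ‖x‖ ^ 2 := by
      refine (RCLike.abs_re_le_norm _).trans ((norm_inner_le_norm _ _).trans ?_)
      nlinarith [A.le_opNorm x, norm_nonneg x]
    have hb' := neg_le_of_abs_le hb
    nlinarith
  · have t1 : ‖k' + K‖ ≤ ‖k + K‖ + ‖k' - k‖ := by
      have : k' + (K : E d) = (k + K) + (k' - k) := by abel
      rw [this]; exact norm_add_le _ _
    -- Young's inequality with parameter `θ` on the cross term; the nonnegative square in `t4` is
    -- its proof.
    have t2 : ‖k' + K‖ ^ 2 ≤ (1 + θ) * ‖k + K‖ ^ 2 + (1 + 1 / θ) * ‖k' - k‖ ^ 2 := by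
      have t3 : ‖k' + K‖ ^ 2 ≤ (‖k + K‖ + ‖k' - k‖) ^ 2 := by gcongr
      have t4 : 0 ≤ (θ * ‖k + K‖ - ‖k' - k‖) ^ 2 / θ := by positivity
      have t5 : (θ * ‖k + K‖ - ‖k' - k‖) ^ 2 / θ =
          θ * ‖k + K‖ ^ 2 - 2 * ‖k + K‖ * ‖k' - k‖ + ‖k' - k‖ ^ 2 / θ := by
        rw [div_eq_iff hθ.ne', add_mul, div_mul_cancel₀ _ hθ.ne']; ring
      have t6 : (1 + 1 / θ) * ‖k' - k‖ ^ 2 = ‖k' - k‖ ^ 2 + ‖k' - k‖ ^ 2 / θ := by ring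
      nlinarith
    nlinarith [mul_le_mul_of_nonneg_right t2 (sq_nonneg ‖x K‖)]

/-! ### Rayleigh quotients -/

/-- A complete orthonormal system of eigenvectors with nondecreasing eigenvalues. -/
structure IsEigensystem (A : Coef b →L[ℂ] Coef b) (k : E d) (e : ℕ → ℝ) (x : ℕ → Coef b) :
    Prop where
  orthonormal : Orthonormal ℂ x
  complete : (Submodule.span ℂ (range x))ᗮ = ⊥
  eigen : ∀ n, IsImage A k (x n) ((e n : ℂ) • x n)
  mono : Monotone e

/-- Upper half of the min-max principle: in orthonormal eigenvectors the quadratic form is diagonal,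
with all entries at most `l`. -/
theorem rayleigh_le {A : Coef b →L[ℂ] Coef b} {k : E d} {m : ℕ} {v : Fin m → Coef b}
    (hv : Orthonormal ℂ v) {l : ℝ}
    (h : ∀ i, ∃ μ : ℝ, μ ≤ l ∧ IsImage A k (v i) ((μ : ℂ) • v i)) (c : Fin m → ℂ) :
    ∃ y, IsImage A k (∑ i, c i • v i) y ∧
      RCLike.re (inner ℂ (∑ i, c i • v i) y) ≤ l * ‖∑ i, c i • v i‖ ^ 2 := by
  choose μ hμ hi using h
  refine ⟨∑ i, c i • (μ i : ℂ) • v i, IsImage.sum _ fun i _ => (hi i).smul _, ?_⟩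
  have e1 : inner ℂ (∑ i, c i • v i) (∑ i, c i • (μ i : ℂ) • v i) =
      ∑ i, conj (c i) * (c i * μ i) := by
    simp_rw [smul_smul]
    rw [hv.inner_sum]
  have e2 : inner ℂ (∑ i, c i • v i) (∑ i, c i • v i) = ∑ i, conj (c i) * c i := hv.inner_sum _ _ _
  rw [inner_self_eq_norm_sq_to_K] at e2
  have e3 : ‖∑ i, c i • v i‖ ^ 2 = ∑ i, ‖c i‖ ^ 2 := by
    have := congrArg RCLike.re e2
    rw [map_sum] at this
    simp only [RCLike.conj_mul] at this
    norm_cast at this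
  rw [e1, e3, map_sum, Finset.mul_sum]
  refine Finset.sum_le_sum fun i _ => ?_
  rw [← mul_assoc, RCLike.conj_mul]
  have : RCLike.re ((((‖c i‖ : ℝ) : ℂ)) ^ 2 * ((μ i : ℝ) : ℂ)) = ‖c i‖ ^ 2 * μ i := by
    norm_cast
  refine this.le.trans ?_
  nlinarith [hμ i, sq_nonneg ‖c i‖]

/-- Dimension count: `n` linear conditions on `m > n` independent vectors leave a nontrivial
combination. -/
theorem exists_combination {m n : ℕ} (hmn : n < m) {v : Fin m → Coef b} (hv : Orthonormal ℂ v)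
    (φ : Coef b →ₗ[ℂ] (Fin n → ℂ)) :
    ∃ c : Fin m → ℂ, ∑ i, c i • v i ≠ 0 ∧ φ (∑ i, c i • v i) = 0 := by
  let ψ : (Fin m → ℂ) →ₗ[ℂ] Coef b := Fintype.linearCombination ℂ v
  have h : LinearMap.ker (φ ∘ₗ ψ) ≠ ⊥ := LinearMap.ker_ne_bot_of_finrank_lt (by simpa using hmn)
  obtain ⟨c, hc, hc0⟩ := (Submodule.ne_bot_iff _).mp h
  refine ⟨c, fun h0 => hc0 ?_, ?_⟩
  · exact funext (Fintype.linearIndependent_iff.mp hv.linearIndependent c h0)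
  · simpa [ψ, Fintype.linearCombination_apply] using hc

/-- Lower half of the min-max principle. By symmetry the coefficients of `H z` in the eigenbasis are
`e j` times those of `z`, and only indices `j ≥ n` contribute. -/
theorem IsEigensystem.le_rayleigh {A : Coef b →L[ℂ] Coef b}
    (hA : ∀ x y, inner ℂ (A x) y = inner ℂ x (A y)) {k : E d} {e : ℕ → ℝ} {x : ℕ → Coef b}
    (hx : IsEigensystem A k e x) {n : ℕ} {z y : Coef b} (hz : IsImage A k z y)
    (hzn : ∀ j < n, inner ℂ (x j) z = 0) :
    e n * ‖z‖ ^ 2 ≤ RCLike.re (inner ℂ z y) := by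
  let B := HilbertBasis.mkOfOrthogonalEqBot hx.orthonormal hx.complete
  have hB : ∀ j, B j = x j := fun j => by simp [B]
  have h1 := RCLike.hasSum_re ℂ (B.hasSum_inner_mul_inner z y)
  have h2 := RCLike.hasSum_re ℂ (B.hasSum_inner_mul_inner z z)
  have h3 : RCLike.re (inner ℂ z z) = ‖z‖ ^ 2 := inner_self_eq_norm_sq z
  rw [h3] at h2
  refine hasSum_le (fun j => ?_) (h2.mul_left (e n)) h1
  rw [hB]
  have h4 : inner ℂ (x j) y = (e j : ℂ) * inner ℂ (x j) z := by
    rw [← (hx.eigen j).symm_inner hA hz, inner_smul_left, Complex.conj_ofReal]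
  rw [h4, ← inner_conj_symm z (x j)]
  have h5 : conj (inner ℂ (x j) z) * ((e j : ℂ) * inner ℂ (x j) z) =
      ((e j * ‖inner ℂ (x j) z‖ ^ 2 : ℝ) : ℂ) := by
    rw [mul_left_comm, RCLike.conj_mul, Complex.ofReal_mul, Complex.ofReal_pow]; rfl
  have h6 : conj (inner ℂ (x j) z) * inner ℂ (x j) z = ((‖inner ℂ (x j) z‖ ^ 2 : ℝ) : ℂ) := by
    rw [RCLike.conj_mul]; norm_cast
  rw [h5, h6]
  change e n * ‖inner ℂ (x j) z‖ ^ 2 ≤ e j * ‖inner ℂ (x j) z‖ ^ 2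
  rcases lt_or_ge j n with hj | hj
  · rw [hzn j hj]; simp
  · exact mul_le_mul_of_nonneg_right (hx.mono hj) (sq_nonneg _)

/-- The number of orthonormal eigenvectors below a given energy is bounded. -/
theorem exists_card_le (A : Coef b →L[ℂ] Coef b) (k : E d) (l : ℝ) :
    ∃ n : ℕ, ∀ (m : ℕ) (v : Fin m → Coef b), Orthonormal ℂ v →
      (∀ i, ∃ μ : ℝ, μ ≤ l ∧ IsImage A k (v i) ((μ : ℂ) • v i)) → m ≤ n := by
  -- Outside the ball of radius `r` the kinetic symbol exceeds `l + ‖A‖`, so the form of `H_k` is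
  -- above `l` on sequences supported there.
  obtain ⟨r, hr⟩ : ∃ r : ℝ, ∀ K : E d, r < ‖K‖ → l + ‖A‖ < (1 / 2) * ‖k + K‖ ^ 2 := by
    refine ⟨‖k‖ + (|l + ‖A‖| + 2), fun K hK => ?_⟩
    have h1 : |l + ‖A‖| + 2 < ‖k + K‖ := by
      have : ‖K‖ ≤ ‖k + K‖ + ‖k‖ := by
        have e : K = (k + K) - k := by abel
        nth_rw 1 [e]; exact norm_sub_le _ _
      linarith
    have h2 := le_abs_self (l + ‖A‖)
    nlinarith [abs_nonneg (l + ‖A‖)]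
  have hfin := recipLattice_finite_norm_le b r
  let S := hfin.toFinset
  refine ⟨S.card, fun m v hv h => ?_⟩
  by_contra! hm
  -- `φ` reads off the finitely many coefficients with `‖K‖ ≤ r`. More eigenvectors than such `K`
  -- would give a combination without low frequencies whose Rayleigh quotient is still at most `l`.
  let φ : Coef b →ₗ[ℂ] (Fin S.card → ℂ) :=
    { toFun := fun x i => x (S.equivFin.symm i : recipLattice b)
      map_add' := fun x y => by ext i; rfl
      map_smul' := fun c x => by ext i; rfl }
  obtain ⟨c, hc0, hc⟩ := exists_combination hm hv φ
  obtain ⟨y, hy, hle⟩ := rayleigh_le hv h c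
  set x := ∑ i, c i • v i
  have hS : ∀ K : recipLattice b, ‖(K : E d)‖ ≤ r → x K = 0 := fun K hK => by
    have hKS : K ∈ S := hfin.mem_toFinset.mpr hK
    have := congrFun hc (S.equivFin ⟨K, hKS⟩)
    simpa [φ] using this
  have s3 := lp.hasSum_norm (p := 2) (by norm_num) x
  simp only [ENNReal.toReal_ofNat, Real.rpow_two] at s3
  have hpos : 0 < ‖x‖ ^ 2 := by positivity
  obtain ⟨K₀, hK₀⟩ : ∃ K, x K ≠ 0 := by
    by_contra! h0
    exact hc0 (by ext K; exact h0 K)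
  have hlt := hasSum_lt (f := fun K => (l + ‖A‖) * ‖x K‖ ^ 2) (i := K₀) (fun K => ?_) ?_
    (s3.mul_left (l + ‖A‖)) hy.kinetic_hasSum
  · have hb : |RCLike.re (inner ℂ x (A x))| ≤ ‖A‖ * ‖x‖ ^ 2 := by
      refine (RCLike.abs_re_le_norm _).trans ((norm_inner_le_norm _ _).trans ?_)
      nlinarith [A.le_opNorm x, norm_nonneg x]
    have hb' := neg_le_of_abs_le hb
    nlinarith
  · rcases le_or_gt ‖(K : E d)‖ r with hK | hK
    · simp [hS K hK]
    · exact mul_le_mul_of_nonneg_right (hr K hK).le (sq_nonneg _)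
  · have hK : r < ‖(K₀ : E d)‖ := by
      by_contra! h1; exact hK₀ (hS K₀ h1)
    have : 0 < ‖x K₀‖ := norm_pos_iff.mpr hK₀
    exact mul_lt_mul_of_pos_right (hr K₀ hK) (by positivity)

end

section

variable {d : ℕ} {b : Module.Basis (Fin d) ℝ (E d)}

/-! ### Existence of eigensystems -/

theorem norm_diagOp_le {m : recipLattice b → ℂ} {C : ℝ} (hm : ∀ K, ‖m K‖ ≤ C) :
    ‖diagOp m‖ ≤ C := by
  have hC : 0 ≤ C := (norm_nonneg _).trans (hm 0)
  refine ContinuousLinearMap.opNorm_le_bound _ hC fun x => ?_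
  refine lp.norm_le_of_forall_sum_le (p := 2) (by norm_num) (by positivity) fun s => ?_
  have h := lp.sum_rpow_le_norm_rpow (p := 2) (by norm_num) x s
  simp only [ENNReal.toReal_ofNat, Real.rpow_two] at h ⊢
  rw [mul_pow]
  refine le_trans ?_ (mul_le_mul_of_nonneg_left h (sq_nonneg C))
  rw [Finset.mul_sum]
  refine Finset.sum_le_sum fun K _ => ?_
  rw [diagOp_apply hm, norm_mul, mul_pow]
  gcongr
  exact hm K

/-- The truncations of the symbol to finitely many `K` give finite rank operators, which converge in
norm as the symbol tends to zero at infinity. -/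
theorem isCompactOperator_diagOp {m : recipLattice b → ℂ}
    (hm : ∀ ε > 0, ∃ r : ℝ, ∀ K : recipLattice b, r < ‖(K : E d)‖ → ‖m K‖ ≤ ε)
    {C : ℝ} (hC : ∀ K, ‖m K‖ ≤ C) : IsCompactOperator (diagOp m) := by
  classical
  have hclosed := isClosed_setOfPred_isCompactOperator (𝕜₁ := ℂ) (𝕜₂ := ℂ) (σ₁₂ := RingHom.id ℂ)
    (M₁ := Coef b) (M₂ := Coef b)
  refine hclosed.closure_subset (Metric.mem_closure_iff.mpr fun ε hε => ?_)
  obtain ⟨r, hr⟩ := hm (ε / 2) (by positivity)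
  let S := (recipLattice_finite_norm_le b r).toFinset
  have hS : ∀ K, K ∈ S ↔ ‖(K : E d)‖ ≤ r := fun K => (recipLattice_finite_norm_le b r).mem_toFinset
  let ev : recipLattice b → (Coef b →L[ℂ] ℂ) := fun K => lp.evalCLM ℂ (fun _ => ℂ) 2 K
  let F : Coef b →L[ℂ] Coef b := ∑ K ∈ S,
    (lp.singleContinuousLinearMap ℂ (fun _ : recipLattice b => ℂ) 2 K) ∘L (m K • ev K)
  have hF : IsCompactOperator F := by
    have : F ∈ compactOperator (RingHom.id ℂ) (Coef b) (Coef b) := by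
      refine Submodule.sum_mem _ fun K _ => ?_
      have h1 : IsCompactOperator (m K • ev K) := isCompactOperator_of_locallyCompactSpace_dom _
      exact h1.clm_comp (lp.singleContinuousLinearMap ℂ (fun _ : recipLattice b => ℂ) 2 K)
    exact this
  refine ⟨F, hF, ?_⟩
  have hFa : ∀ x K, F x K = if K ∈ S then m K * x K else 0 := fun x K => by
    have h1 : F x = ∑ K' ∈ S, lp.single 2 K' (m K' * x K') := by
      simp only [F, sum_apply]; rfl
    rw [h1, lp.coeFn_sum, Finset.sum_apply]
    simp only [lp.single_apply]
    simp [Pi.single_apply]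
  have e : diagOp m - F = diagOp (fun K => if K ∈ S then 0 else m K) := by
    ext x K
    have hb : ∀ K, ‖(if K ∈ S then 0 else m K)‖ ≤ C := fun K => by
      split_ifs
      · simpa using (norm_nonneg _).trans (hC K)
      · exact hC K
    rw [diagOp_apply hb]
    change diagOp m x K - F x K = _
    rw [diagOp_apply hC, hFa]
    split_ifs <;> simp
  rw [dist_eq_norm, e]
  refine (norm_diagOp_le (C := ε / 2) fun K => ?_).trans_lt (by linarith)
  split_ifs with h
  · simpa using by positivity
  · exact hr K (not_le.mp fun h' => h ((hS K).mpr h'))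

/-- `T` is the resolvent `(H_k + c)⁻¹`. With the free resolvent `R`, which is diagonal and compact,
`(H_k + c) R = 1 + A R` is inverted by a Neumann series, and `T = R (1 + A R)⁻¹`. The two identities
say that `T` is a right and a left inverse, the first also that it maps into the domain. -/
theorem exists_resolvent (A : Coef b →L[ℂ] Coef b) (k : E d) :
    ∃ (c : ℝ) (T : Coef b →L[ℂ] Coef b), IsCompactOperator T ∧
      (∀ y, IsImage A k (T y) (y - (c : ℂ) • T y)) ∧
      ∀ x w, IsImage A k x w → T (w + (c : ℂ) • x) = x := by
  -- Since `‖R‖ ≤ 1 / c`, this choice makes `‖A R‖ < 1`. It also ensures `c ≥ 1`, used for the `H²`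
  -- bound.
  set c : ℝ := 2 * ‖A‖ + 1 with hc
  have hcpos : 0 < c := by positivity
  let D : recipLattice b → ℝ := fun K => (1 / 2) * ‖k + K‖ ^ 2
  have hD : ∀ K, 0 ≤ D K := fun K => by positivity
  let m : recipLattice b → ℂ := fun K => (((D K + c)⁻¹ : ℝ) : ℂ)
  have hmn : ∀ K, ‖m K‖ = (D K + c)⁻¹ := fun K => by
    simp only [m]
    rw [Complex.norm_real, Real.norm_of_nonneg (inv_nonneg.mpr (by linarith [hD K]))]
  have hm : ∀ K, ‖m K‖ ≤ c⁻¹ := fun K => by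
    rw [hmn]; exact inv_anti₀ hcpos (by linarith [hD K])
  let R : Coef b →L[ℂ] Coef b := diagOp m
  have hRc : IsCompactOperator R := by
    refine isCompactOperator_diagOp (fun ε hε => ?_) hm
    refine ⟨‖k‖ + (2 / ε + 1), fun K hK => ?_⟩
    have h1 : 2 / ε + 1 < ‖k + K‖ := by
      have : ‖(K : E d)‖ ≤ ‖k + K‖ + ‖k‖ := by
        have e : (K : E d) = (k + K) - k := by abel
        nth_rw 1 [e]; exact norm_sub_le _ _
      linarith
    rw [hmn]
    refine inv_le_of_inv_le₀ hε ?_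
    have h2 : 0 < 2 / ε := by positivity
    have h3 : ε⁻¹ = (2 / ε) / 2 := by field_simp
    rw [h3]
    simp only [D]
    nlinarith
  have hAR : ‖-(A * R)‖ < 1 := by
    rw [norm_neg]
    calc ‖A * R‖ ≤ ‖A‖ * ‖R‖ := norm_mul_le _ _
      _ ≤ ‖A‖ * c⁻¹ := by gcongr; exact norm_diagOp_le hm
      _ < 1 := by
        rw [← div_eq_mul_inv, div_lt_one hcpos]; linarith [norm_nonneg A]
  obtain ⟨U, hU⟩ := isUnit_one_sub_of_norm_lt_one hAR
  have hU1 : ∀ z, (U : Coef b →L[ℂ] Coef b) z = z + A (R z) := fun z => by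
    rw [hU]; simp
  obtain ⟨W, hUi, hUi'⟩ : ∃ W : Coef b →L[ℂ] Coef b,
      (∀ z, (U : Coef b →L[ℂ] Coef b) (W z) = z) ∧ ∀ z, W ((U : Coef b →L[ℂ] Coef b) z) = z :=
    ⟨(U⁻¹ : (Coef b →L[ℂ] Coef b)ˣ), fun z => DFunLike.congr_fun (Units.mul_inv U) z,
      fun z => DFunLike.congr_fun (Units.inv_mul U) z⟩
  have hRz : ∀ z K, ((D K : ℂ) + c) * R z K = z K := fun z K => by
    rw [diagOp_apply hm, ← mul_assoc]
    simp only [m]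
    have : ((D K + c : ℝ) : ℂ) ≠ 0 := by exact_mod_cast (by linarith [hD K] : 0 < D K + c).ne'
    push_cast at this ⊢
    rw [mul_inv_cancel₀ this, one_mul]
  refine ⟨c, R ∘L W, hRc.comp_clm _, fun y => ?_, fun x w hxw => ?_⟩
  · set z := W y with hz
    have hy : y = z + A (R z) := by rw [← hU1, hz, hUi]
    change IsImage A k (R z) (y - (c : ℂ) • R z)
    refine ⟨?_, fun K => ?_⟩
    · have hle : sobSq 2 (R z) ≤ ENNReal.ofReal ((4 + (2 * ‖k‖ ^ 2 + 1)) ^ 2) * sobSq 0 z := by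
        rw [sobSq, sobSq, ← ENNReal.tsum_mul_left]
        refine ENNReal.tsum_le_tsum fun K => ?_
        rw [← ENNReal.ofReal_mul (sq_nonneg _)]
        refine ENNReal.ofReal_le_ofReal ?_
        have hDc : 0 < D K + c := by linarith [hD K]
        have hw : sobWeight (K : E d) ≤ (4 + (2 * ‖k‖ ^ 2 + 1)) * (D K + c) := by
          have h1 : ‖(K : E d)‖ ≤ ‖k + K‖ + ‖k‖ := by
            have e : (K : E d) = (k + K) - k := by abel
            nth_rw 1 [e]; exact norm_sub_le _ _
          have h2 : ‖(K : E d)‖ ^ 2 ≤ (‖k + K‖ + ‖k‖) ^ 2 := by gcongr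
          have h3 : ‖(K : E d)‖ ^ 2 ≤ 4 * D K + 2 * ‖k‖ ^ 2 := by
            simp only [D]; nlinarith [sq_nonneg (‖k + K‖ - ‖k‖)]
          have h4 : 1 ≤ c := by linarith [norm_nonneg A]
          rw [sobWeight]
          nlinarith [hD K, sq_nonneg ‖k‖, mul_nonneg (sq_nonneg ‖k‖) (hD K),
            mul_nonneg (sq_nonneg ‖k‖) (sub_nonneg.mpr h4)]
        rw [diagOp_apply hm, norm_mul, hmn, Real.rpow_two, Real.rpow_zero, one_mul, mul_pow,
          ← mul_assoc, ← mul_pow]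
        have hw' : sobWeight (K : E d) * (D K + c)⁻¹ ≤ 4 + (2 * ‖k‖ ^ 2 + 1) := by
          rw [← div_eq_mul_inv, div_le_iff₀ hDc]
          exact hw
        have h0 : 0 ≤ sobWeight (K : E d) * (D K + c)⁻¹ :=
          mul_nonneg (sobWeight_pos _).le (inv_nonneg.mpr hDc.le)
        gcongr
      refine ne_top_of_le_ne_top ?_ hle
      rw [sobSq_zero_coe]
      exact ENNReal.mul_ne_top ENNReal.ofReal_ne_top ENNReal.ofReal_ne_top
    · rw [lp.coeFn_sub, Pi.sub_apply, lp.coeFn_smul, Pi.smul_apply, smul_eq_mul]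
      nth_rw 1 [hy]
      rw [lp.coeFn_add, Pi.add_apply, ← hRz z K]
      simp only [D]
      ring
  · set z := w + (c : ℂ) • x - A x with hz
    have hzK : ∀ K, z K = ((D K : ℂ) + c) * x K := fun K => by
      rw [hz, lp.coeFn_sub, Pi.sub_apply, lp.coeFn_add, Pi.add_apply, lp.coeFn_smul, Pi.smul_apply,
        smul_eq_mul, hxw.2 K]
      simp only [D]
      ring
    have hR : R z = x := by
      ext K
      have h1 := hRz z K
      rw [hzK] at h1
      refine mul_left_cancel₀ ?_ h1
      exact_mod_cast (by linarith [hD K] : 0 < D K + c).ne'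
    have : w + (c : ℂ) • x = (U : Coef b →L[ℂ] Coef b) z := by rw [hU1, hR, hz]; abel
    change R (W (w + (c : ℂ) • x)) = x
    rw [this, hUi', hR]

/-- Increasing enumeration of a function with finite sublevel sets. -/
theorem exists_monotone_enumeration {ι : Type*} [Infinite ι] (f : ι → ℝ)
    (hf : ∀ l, {i | f i ≤ l}.Finite) : ∃ g : ℕ → ι, Function.Bijective g ∧ Monotone (f ∘ g) := by
  classical
  have h1 : ∀ s : Finset ι, ∃ i, i ∉ s ∧ ∀ j, j ∉ s → f i ≤ f j := fun s => by
    obtain ⟨i₀, hi₀⟩ := Infinite.exists_notMem_finset s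
    have hfin : ({i | f i ≤ f i₀} \ s).Finite := (hf _).sdiff
    obtain ⟨i, hi, hmin⟩ := hfin.exists_minimalFor f _ ⟨i₀, le_refl (f i₀), hi₀⟩
    refine ⟨i, hi.2, fun j hj => ?_⟩
    by_contra! hlt
    have := hmin (j := j) ⟨hlt.le.trans hi.1, hj⟩ hlt.le
    linarith
  choose a ha hmin using h1
  -- Greedy choice: `F n` collects the first `n` chosen indices and `a s` minimises `f` off `s`. An
  -- index `i` that is never chosen would leave infinitely many indices with values at most `f i`.
  let F : ℕ → Finset ι := fun n => Nat.rec ∅ (fun _ s => insert (a s) s) n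
  have hF : ∀ n, F (n + 1) = insert (a (F n)) (F n) := fun n => rfl
  have hmono : Monotone F := monotone_nat_of_le_succ fun n => by
    rw [hF]; exact Finset.subset_insert _ _
  let g : ℕ → ι := fun n => a (F n)
  have hg : ∀ m n, m < n → g m ∈ F n := fun m n hmn =>
    hmono hmn (by rw [hF]; exact Finset.mem_insert_self _ _)
  have hinj : Function.Injective g := by
    intro m n h
    by_contra hne
    rcases lt_or_gt_of_ne hne with h' | h'
    · exact ha (F n) (by have := hg m n h'; rwa [h] at this)
    · exact ha (F m) (by have := hg n m h'; rwa [← h] at this)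
  refine ⟨g, ⟨hinj, fun i => ?_⟩, monotone_nat_of_le_succ fun n => ?_⟩
  · by_contra! hi
    have hFi : ∀ n, i ∉ F n := fun n => by
      induction n with
      | zero => simp [F]
      | succ n ih =>
        rw [hF, Finset.mem_insert, not_or]
        exact ⟨fun h => hi n h.symm, ih⟩
    exact Set.infinite_range_of_injective hinj
      ((hf (f i)).subset (by rintro _ ⟨n, rfl⟩; exact hmin (F n) i (hFi n)))
  · exact hmin (F n) _ fun h => ha (F (n + 1)) (hmono (Nat.le_succ n) h)

theorem recipLattice_infinite (hd : 1 ≤ d) : Infinite (recipLattice b) := by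
  have : Nonempty (Fin d) := ⟨⟨0, hd⟩⟩
  exact Infinite.of_injective _ (recipIndex b).injective

/-- The spectral theorem for the compact symmetric resolvent `T`. As `T` is injective its
eigenvalues `μ` are nonzero, and they correspond to the eigenvalues `μ⁻¹ - c` of `H_k`. Finiteness
of each sublevel set allows them to be listed in increasing order. -/
theorem exists_eigensystem (hd : 1 ≤ d) {A : Coef b →L[ℂ] Coef b}
    (hA : ∀ x y, inner ℂ (A x) y = inner ℂ x (A y)) (k : E d) :
    ∃ (e : ℕ → ℝ) (x : ℕ → Coef b), IsEigensystem A k e x := by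
  classical
  obtain ⟨c, T, hTc, hT, hT'⟩ := exists_resolvent A k
  have hTs : (T : Coef b →ₗ[ℂ] Coef b).IsSymmetric := fun y y' => by
    change inner ℂ (T y) y' = inner ℂ y (T y')
    have h := (hT y).symm_inner hA (hT y')
    rw [inner_sub_left, inner_sub_right, inner_smul_left, inner_smul_right, Complex.conj_ofReal] at h
    exact (sub_left_injective h).symm
  have hTi : ∀ y, T y = 0 → y = 0 := fun y hy => by
    have h := hT y
    rw [hy, smul_zero, sub_zero] at h
    have h0 : IsImage A k 0 (0 : Coef b) := isImage_iff.mpr ⟨0, by simp, by simp⟩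
    exact h.unique h0
  have hV := hTs.orthogonalFamily_eigenspaces
  have hbot := ContinuousLinearMap.orthogonalComplement_iSup_eigenspaces_eq_bot hTc hTs
  have hcompl : ∀ μ : ℂ, CompleteSpace (Module.End.eigenspace (T : Coef b →ₗ[ℂ] Coef b) μ) :=
    fun μ => by
      have : IsClosed (Module.End.eigenspace (T : Coef b →ₗ[ℂ] Coef b) μ : Set (Coef b)) := by
        have e : (Module.End.eigenspace (T : Coef b →ₗ[ℂ] Coef b) μ : Set (Coef b)) =
            {x | T x = μ • x} := by
          ext x; exact Module.End.mem_eigenspace_iff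
        rw [e]
        exact isClosed_eq T.continuous (continuous_const_smul μ)
      exact this.completeSpace_coe
  choose w B hB using fun μ : ℂ =>
    exists_hilbertBasis ℂ (Module.End.eigenspace (T : Coef b →ₗ[ℂ] Coef b) μ)
  let v : (Σ μ : ℂ, w μ) → Coef b := fun i => (B i.1 i.2 : Coef b)
  have hv : Orthonormal ℂ v :=
    hV.orthonormal_sigma_orthonormal (v_family := fun μ i => B μ i) fun μ => (B μ).orthonormal
  have hvT : ∀ i, T (v i) = i.1 • v i := fun i =>
    Module.End.mem_eigenspace_iff.mp (B i.1 i.2).2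
  have hvc : (Submodule.span ℂ (range v))ᗮ = ⊥ := by
    rw [eq_bot_iff, ← hbot]
    intro x hx
    rw [Submodule.mem_orthogonal] at hx
    rw [← Submodule.iInf_orthogonal, Submodule.mem_iInf]
    intro μ
    rw [Submodule.mem_orthogonal]
    intro y hy
    have h1 := ((B μ).hasSum_repr ⟨y, hy⟩).mapL
      (Module.End.eigenspace (T : Coef b →ₗ[ℂ] Coef b) μ).subtypeL
    have h2 := h1.mapL (innerSL ℂ x)
    have h3 : ∀ i, (innerSL ℂ x) ((Module.End.eigenspace (T : Coef b →ₗ[ℂ] Coef b) μ).subtypeL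
        ((B μ).repr ⟨y, hy⟩ i • B μ i)) = 0 := fun i => by
      have h4 : inner ℂ x (v ⟨μ, i⟩) = 0 := by
        rw [inner_eq_zero_symm]
        exact hx _ (Submodule.subset_span ⟨⟨μ, i⟩, rfl⟩)
      rw [map_smul, map_smul]
      change _ • inner ℂ x (v ⟨μ, i⟩) = 0
      rw [h4, smul_zero]
    simp only [h3] at h2
    have h5 : inner ℂ x y = 0 := h2.unique hasSum_zero
    rwa [inner_eq_zero_symm]
  have hne : ∀ i, v i ≠ 0 := fun i => hv.ne_zero i
  have hμ0 : ∀ i : (Σ μ : ℂ, w μ), i.1 ≠ 0 := fun i h => by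
    refine hne i (hTi _ ?_)
    rw [hvT, h, zero_smul]
  have hμr : ∀ i : (Σ μ : ℂ, w μ), conj i.1 = i.1 := fun i =>
    hTs.conj_eigenvalue_eq_self (Module.End.hasEigenvalue_of_hasEigenvector
      ⟨(B i.1 i.2).2, hne i⟩)
  let f : (Σ μ : ℂ, w μ) → ℝ := fun i => (i.1⁻¹).re - c
  have hf : ∀ i, IsImage A k (v i) ((f i : ℂ) • v i) := fun i => by
    have h1 := (hT (v i)).smul (i.1⁻¹)
    rw [hvT, smul_smul, inv_mul_cancel₀ (hμ0 i), one_smul] at h1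
    convert h1 using 1
    have h2 : ((i.1⁻¹).re : ℂ) = i.1⁻¹ := by
      rw [← Complex.conj_eq_iff_re, map_inv₀, hμr]
    rw [smul_sub, smul_smul, mul_comm (i.1⁻¹), smul_smul, mul_assoc,
      inv_mul_cancel₀ (hμ0 i), mul_one, ← sub_smul, ← h2]
    simp [f]
  -- Here `1 ≤ d` enters: the reciprocal lattice is infinite, so `ℓ²` over it is infinite
  -- dimensional and the bands form an infinite sequence.
  have hinf : Infinite (Σ μ : ℂ, w μ) := by
    by_contra hfin
    rw [not_infinite_iff_finite] at hfin
    have := Fintype.ofFinite (Σ μ : ℂ, w μ)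
    have hH := HilbertBasis.mkOfOrthogonalEqBot hv hvc
    have hfd : FiniteDimensional ℂ (Coef b) :=
      Module.Finite.of_basis hH.toOrthonormalBasis.toBasis
    have hinf' := recipLattice_infinite (b := b) hd
    exact hinf'.not_finite (planeWaveBasis b |>.orthonormal.linearIndependent.map'
      ((planeWaveBasis b).repr.toLinearEquiv : L2per b →ₗ[ℂ] Coef b)
      (LinearEquiv.ker _) |>.finite)
  have hsub : ∀ l, {i | f i ≤ l}.Finite := fun l => by
    obtain ⟨n, hn⟩ := exists_card_le A k l
    by_contra hinf'
    obtain ⟨t, ht, htc⟩ := Set.Infinite.exists_subset_card_eq hinf' (n + 1)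
    let g : Fin (n + 1) → (Σ μ : ℂ, w μ) := fun j => (t.equivFinOfCardEq htc).symm j
    have hg : Function.Injective g :=
      Subtype.val_injective.comp (t.equivFinOfCardEq htc).symm.injective
    have := hn (n + 1) (v ∘ g) (hv.comp g hg)
      fun j => ⟨f (g j), ht ((t.equivFinOfCardEq htc).symm j).2, hf (g j)⟩
    omega
  obtain ⟨g, hg, hmono⟩ := exists_monotone_enumeration f hsub
  refine ⟨f ∘ g, v ∘ g, hv.comp g hg.1, ?_, fun n => hf (g n), hmono⟩
  rw [range_comp, hg.2.range_eq, image_univ]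
  exact hvc

end

section

variable {d : ℕ} {b : Module.Basis (Fin d) ℝ (E d)}

/-! ### Bands -/

/-- The bands of a potential operator on the Fourier side. -/
def bandE (A : Coef b →L[ℂ] Coef b) (n : ℕ) (k : E d) : ℝ :=
  sInf {l : ℝ | ∃ v : Fin (n + 1) → Coef b, Orthonormal ℂ v ∧
    ∀ i, ∃ m : ℝ, m ≤ l ∧ IsImage A k (v i) ((m : ℂ) • v i)}

/-- Among any `n + 1` competing eigenvectors some combination is orthogonal to the `n` lowest `x j`.
Its Rayleigh quotient is at least `e n` by `le_rayleigh` and at most `l` by `rayleigh_le`. -/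
theorem IsEigensystem.isLeast {A : Coef b →L[ℂ] Coef b}
    (hA : ∀ x y, inner ℂ (A x) y = inner ℂ x (A y)) {k : E d} {e : ℕ → ℝ} {x : ℕ → Coef b}
    (hx : IsEigensystem A k e x) (n : ℕ) :
    IsLeast {l : ℝ | ∃ v : Fin (n + 1) → Coef b, Orthonormal ℂ v ∧
      ∀ i, ∃ m : ℝ, m ≤ l ∧ IsImage A k (v i) ((m : ℂ) • v i)} (e n) := by
  refine ⟨⟨fun i => x i, hx.orthonormal.comp _ Fin.val_injective, fun i =>
    ⟨e i, hx.mono (Nat.lt_succ_iff.mp i.2), hx.eigen i⟩⟩, ?_⟩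
  rintro l ⟨v, hv, hl⟩
  let φ : Coef b →ₗ[ℂ] (Fin n → ℂ) := LinearMap.pi fun j => (innerSL ℂ (x j)).toLinearMap
  obtain ⟨c, hc0, hc⟩ := exists_combination (Nat.lt_succ_self n) hv φ
  obtain ⟨y, hy, hle⟩ := rayleigh_le hv hl c
  have h1 := hx.le_rayleigh hA (n := n) hy fun j hj => congrFun hc ⟨j, hj⟩
  have h2 : 0 < ‖∑ i, c i • v i‖ ^ 2 := by positivity
  exact le_of_mul_le_mul_right (h1.trans hle) h2

theorem IsEigensystem.bandE_eq {A : Coef b →L[ℂ] Coef b}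
    (hA : ∀ x y, inner ℂ (A x) y = inner ℂ x (A y)) {k : E d} {e : ℕ → ℝ} {x : ℕ → Coef b}
    (hx : IsEigensystem A k e x) (n : ℕ) : bandE A n k = e n :=
  (hx.isLeast hA n).csInf_eq

theorem exists_bandE_eigensystem (hd : 1 ≤ d) {A : Coef b →L[ℂ] Coef b}
    (hA : ∀ x y, inner ℂ (A x) y = inner ℂ x (A y)) (k : E d) :
    ∃ x : ℕ → Coef b, IsEigensystem A k (fun n => bandE A n k) x := by
  obtain ⟨e, x, hx⟩ := exists_eigensystem hd hA k
  refine ⟨x, ?_⟩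
  have : (fun n => bandE A n k) = e := funext fun n => hx.bandE_eq hA n
  rwa [this]

theorem isBlochImage_iff {V : E d → ℝ} (hV : MemLp (fun r => (V r : ℂ)) ∞ (cellMeasure b))
    (k : E d) (u w : L2per b) : IsBlochImage b V k u w ↔
      IsImage (potOp b hV) k ((planeWaveBasis b).repr u) ((planeWaveBasis b).repr w) := by
  have e : sobolevENorm b 2 u < ⊤ ↔ sobSq (b := b) 2 ((planeWaveBasis b).repr u) ≠ ⊤ := by
    rw [sobolevENorm_eq, ENNReal.rpow_lt_top_iff_of_pos (by norm_num), lt_top_iff_ne_top]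
    simp only [← planeWaveBasis_repr]
  rw [IsBlochImage, IsImage, e]
  refine and_congr_right fun _ => ⟨fun h K => ?_, fun h K hK => ?_⟩
  · rw [potOp_repr, planeWaveBasis_repr, planeWaveBasis_repr]
    exact h K K.2
  · have := h ⟨K, hK⟩
    rwa [potOp_repr, planeWaveBasis_repr, planeWaveBasis_repr] at this

theorem bandEnergy_eq_bandE {V : E d → ℝ} (hV : MemLp (fun r => (V r : ℂ)) ∞ (cellMeasure b))
    (n : ℕ) : bandEnergy b V n = bandE (potOp b hV) n := by
  funext k
  rw [bandEnergy, bandE]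
  congr 1
  ext l
  constructor
  · rintro ⟨v, hv, h⟩
    refine ⟨fun i => (planeWaveBasis b).repr (v i),
      hv.comp_linearIsometry (planeWaveBasis b).repr.toLinearIsometry, fun i => ?_⟩
    obtain ⟨m, hm, him⟩ := h i
    refine ⟨m, hm, ?_⟩
    rw [isBlochImage_iff hV, map_smul] at him
    exact him
  · rintro ⟨v, hv, h⟩
    refine ⟨fun i => (planeWaveBasis b).repr.symm (v i),
      hv.comp_linearIsometry (planeWaveBasis b).repr.symm.toLinearIsometry, fun i => ?_⟩
    obtain ⟨m, hm, him⟩ := h i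
    refine ⟨m, hm, ?_⟩
    rw [isBlochImage_iff hV, map_smul, LinearIsometryEquiv.apply_symm_apply]
    exact him

theorem IsEigenbasis.isEigensystem (hd : 1 ≤ d) {V : E d → ℝ}
    (hV : MemLp (fun r => (V r : ℂ)) ∞ (cellMeasure b)) {u : ℕ → E d → L2per b}
    (hu : IsEigenbasis b V u) (k : E d) :
    IsEigensystem (potOp b hV) k (fun n => bandE (potOp b hV) n k)
      (fun n => (planeWaveBasis b).repr (u n k)) where
  orthonormal := (hu.orthonormal k).comp_linearIsometry (planeWaveBasis b).repr.toLinearIsometry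
  complete := by
    rw [Submodule.eq_bot_iff]
    intro x hx
    obtain ⟨f, rfl⟩ := (planeWaveBasis b).repr.surjective x
    have h1 : f ∈ (Submodule.span ℂ (range fun n => u n k))ᗮ := by
      rw [Submodule.mem_orthogonal]
      intro y hy
      rw [← (planeWaveBasis b).repr.inner_map_map]
      refine (Submodule.mem_orthogonal _ _).mp hx _ ?_
      have := Submodule.mem_map_of_mem (f := ((planeWaveBasis b).repr.toLinearEquiv :
        L2per b →ₗ[ℂ] Coef b)) hy
      rw [Submodule.map_span, ← range_comp] at this
      exact this
    rw [← Submodule.orthogonal_closure, hu.complete k, Submodule.top_orthogonal_eq_bot] at h1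
    rw [(Submodule.mem_bot ℂ).mp h1, map_zero]
  eigen n := by
    have h := hu.eigen n k
    rw [isBlochImage_iff hV, map_smul, bandEnergy_eq_bandE hV] at h
    exact h
  mono := by
    obtain ⟨x, hx⟩ := exists_bandE_eigensystem hd (potOp_inner hV) k
    exact hx.mono

section Bands

variable {A : Coef b →L[ℂ] Coef b}

theorem bandE_mono (hd : 1 ≤ d) (hA : ∀ x y, inner ℂ (A x) y = inner ℂ x (A y)) (k : E d) :
    Monotone fun n => bandE A n k := by
  obtain ⟨x, hx⟩ := exists_bandE_eigensystem hd hA k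
  exact hx.mono

/-- Min-max: the span of `n + 1` low eigenvectors at `k` contains a vector orthogonal to the first
`n` eigenvectors at `k'`, and on it the two forms are compared by `IsImage.form_le`. The error is
relative to the height of the band, which makes the estimate uniform in `n`. -/
theorem bandE_compare (hd : 1 ≤ d) (hA : ∀ x y, inner ℂ (A x) y = inner ℂ x (A y)) (n : ℕ)
    (k k' : E d) {θ : ℝ} (hθ : 0 < θ) :
    bandE A n k' + ‖A‖ ≤ (1 + θ) * (bandE A n k + ‖A‖) + (1 + 1 / θ) * (‖k' - k‖ ^ 2 / 2) := by
  obtain ⟨x, hx⟩ := exists_bandE_eigensystem hd hA k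
  obtain ⟨x', hx'⟩ := exists_bandE_eigensystem hd hA k'
  obtain ⟨v, hv, hl⟩ := (hx.isLeast hA n).1
  let φ : Coef b →ₗ[ℂ] (Fin n → ℂ) := LinearMap.pi fun j => (innerSL ℂ (x' j)).toLinearMap
  obtain ⟨c, hc0, hc⟩ := exists_combination (Nat.lt_succ_self n) hv φ
  obtain ⟨y, hy, hle⟩ := rayleigh_le hv hl c
  set z := ∑ i, c i • v i
  obtain ⟨a, ha, -⟩ := isImage_iff.mp hy
  have hy' := isImage_sobScale A k' a
  rw [ha] at hy'
  have h1 := hx'.le_rayleigh hA (n := n) hy' fun j hj => congrFun hc ⟨j, hj⟩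
  have h2 := hy.form_le hy' hθ
  have h3 : 0 < ‖z‖ ^ 2 := by positivity
  refine le_of_mul_le_mul_right ?_ h3
  nlinarith [mul_le_mul_of_nonneg_left hle (by linarith : 0 ≤ 1 + θ)]

theorem bandE_nonneg (hd : 1 ≤ d) (hA : ∀ x y, inner ℂ (A x) y = inner ℂ x (A y)) (n : ℕ)
    (k : E d) : 0 ≤ bandE A n k + ‖A‖ := by
  -- At `k' = k` the comparison reads `F ≤ 2 F`, that is `0 ≤ F`.
  have h := bandE_compare hd hA n k k (θ := 1) one_pos
  rw [sub_self, norm_zero] at h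
  linarith

theorem exists_bandE_gt (hd : 1 ≤ d) (hA : ∀ x y, inner ℂ (A x) y = inner ℂ x (A y)) (k : E d)
    (l : ℝ) : ∃ n₀ : ℕ, ∀ n, n₀ ≤ n → l < bandE A n k := by
  obtain ⟨x, hx⟩ := exists_bandE_eigensystem hd hA k
  obtain ⟨N, hN⟩ := exists_card_le A k l
  refine ⟨N, fun n hn => ?_⟩
  by_contra! hle
  have := hN (n + 1) (fun i => x i) (hx.orthonormal.comp _ Fin.val_injective) fun i =>
    ⟨bandE A i k, (hx.mono (Nat.lt_succ_iff.mp i.2)).trans hle, hx.eigen i⟩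
  omega

theorem continuous_bandE (hd : 1 ≤ d) (hA : ∀ x y, inner ℂ (A x) y = inner ℂ x (A y)) (n : ℕ) :
    Continuous (bandE A n) := by
  rw [continuous_iff_continuousAt]
  intro k
  have hE := bandE_nonneg hd hA n k
  set F := bandE A n k + ‖A‖ with hF
  -- two-sided bound with parameter equal to the distance
  have key : ∀ k' : E d, ‖k' - k‖ ≤ 1 →
      |bandE A n k' - bandE A n k| ≤ ‖k' - k‖ * (2 * F + 4) := by
    intro k' hk'
    rcases eq_or_ne k' k with rfl | hne
    · simp
    have hδ : 0 < ‖k' - k‖ := norm_pos_iff.mpr (sub_ne_zero.mpr hne)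
    set δ := ‖k' - k‖
    have h1 := bandE_compare hd hA n k k' hδ
    have h2 := bandE_compare hd hA n k' k hδ
    rw [norm_sub_rev] at h2
    have e : (1 + 1 / δ) * (δ ^ 2 / 2) = δ ^ 2 / 2 + δ / 2 := by field_simp
    rw [← hF] at h1 h2
    change _ ≤ _ + (1 + 1 / δ) * (δ ^ 2 / 2) at h1
    change _ ≤ _ + (1 + 1 / δ) * (δ ^ 2 / 2) at h2
    rw [e] at h1 h2
    have hsq : δ ^ 2 ≤ δ := by nlinarith
    have h0 := bandE_nonneg hd hA n k'
    have h3 : bandE A n k' + ‖A‖ ≤ F + δ * (F + 1) := by nlinarith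
    rw [abs_le]
    constructor
    · nlinarith [mul_le_mul_of_nonneg_left h3 hδ.le]
    · nlinarith
  rw [Metric.continuousAt_iff']
  intro ε hε
  have hpos : 0 < 2 * F + 4 := by linarith
  have hmem : Metric.ball k (min 1 (ε / (2 * F + 4))) ∈ 𝓝 k :=
    Metric.ball_mem_nhds _ (by positivity)
  filter_upwards [hmem] with k' hk'
  rw [mem_ball_iff_norm, lt_min_iff] at hk'
  rw [Real.dist_eq]
  refine (key k' hk'.1.le).trans_lt ?_
  rw [lt_div_iff₀ hpos] at hk'
  exact hk'.2

/-- Multiplication by `exp(-i K₀·r)` conjugates `H_k` into `H_{k + K₀}`; on coefficients it is the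
translation. The weights at `K` and `K + K₀` are comparable, so the domain is preserved. -/
theorem IsImage.shift (hA : ∀ K₀ x, A (shiftOp K₀ x) = shiftOp K₀ (A x)) {k : E d} {x y : Coef b}
    (h : IsImage A k x y) (K₀ : recipLattice b) :
    IsImage A (k + K₀) (shiftOp K₀ x) (shiftOp K₀ y) := by
  have hk : ∀ K : recipLattice b, (shiftOp K₀ y) K =
      (((1 / 2) * ‖k + K₀ + K‖ ^ 2 : ℝ) : ℂ) * shiftOp K₀ x K + A (shiftOp K₀ x) K := fun K => by
    rw [hA, shiftOp_apply, shiftOp_apply, shiftOp_apply, h.2]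
    have e : k + ((K + K₀ : recipLattice b) : E d) = k + K₀ + K := by push_cast; abel
    rw [e]
  refine ⟨?_, hk⟩
  have h1 : sobSq 2 (shiftOp K₀ x) ≤ ENNReal.ofReal (4 ^ 2 * (1 + sobWeight (K₀ : E d)) ^ 2) *
      sobSq 2 x := by
    have e : sobSq 2 x = ∑' K : recipLattice b,
        ENNReal.ofReal (sobWeight ((K + K₀ : recipLattice b) : E d) ^ (2 : ℝ) *
          ‖x (K + K₀)‖ ^ 2) :=
      ((Equiv.addRight K₀).tsum_eq fun K : recipLattice b =>
        ENNReal.ofReal (sobWeight (K : E d) ^ (2 : ℝ) * ‖x K‖ ^ 2)).symm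
    rw [e, sobSq, ← ENNReal.tsum_mul_left]
    refine ENNReal.tsum_le_tsum fun K => ?_
    rw [← ENNReal.ofReal_mul (by positivity)]
    refine ENNReal.ofReal_le_ofReal ?_
    have hw := sobWeight_rpow_add_le (t := 1) zero_le_one ((K + K₀ : recipLattice b) : E d)
      (-(K₀ : E d))
    have e2 : ((K + K₀ : recipLattice b) : E d) + -(K₀ : E d) = K := by push_cast; abel
    rw [e2, sobWeight_neg] at hw
    simp only [Real.rpow_one] at hw
    have h1 := one_le_sobWeight ((K + K₀ : recipLattice b) : E d)
    have h2 := one_le_sobWeight (K₀ : E d)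
    have h3 : sobWeight (K : E d) ≤ 4 * (1 + sobWeight (K₀ : E d)) *
        sobWeight ((K + K₀ : recipLattice b) : E d) := by nlinarith
    have h0 := (sobWeight_pos (K : E d)).le
    rw [shiftOp_apply, Real.rpow_two, Real.rpow_two]
    refine (mul_le_mul_of_nonneg_right (pow_le_pow_left₀ h0 h3 2)
      (sq_nonneg ‖x (K + K₀)‖)).trans_eq ?_
    ring
  exact ne_top_of_le_ne_top (ENNReal.mul_ne_top ENNReal.ofReal_ne_top h.1) h1

theorem bandE_add (hd : 1 ≤ d) (hA : ∀ x y, inner ℂ (A x) y = inner ℂ x (A y))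
    (hA' : ∀ K₀ x, A (shiftOp K₀ x) = shiftOp K₀ (A x)) (n : ℕ) (k : E d)
    (K : recipLattice b) : bandE A n (k + K) = bandE A n k := by
  have key : ∀ (k : E d) (K : recipLattice b), bandE A n (k + K) ≤ bandE A n k := fun k K => by
    obtain ⟨x, hx⟩ := exists_bandE_eigensystem hd hA k
    obtain ⟨x', hx'⟩ := exists_bandE_eigensystem hd hA (k + K)
    refine (hx'.isLeast hA n).2 ?_
    refine ⟨fun i => shiftOp K (x i), (hx.orthonormal.comp _ Fin.val_injective).comp_linearIsometry
      (shiftOp K), fun i => ⟨bandE A i k, hx.mono (Nat.lt_succ_iff.mp i.2), ?_⟩⟩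
    have := (hx.eigen i).shift hA' K
    rwa [map_smul] at this
  refine le_antisymm (key k K) ?_
  have := key (k + K) (-K)
  simpa using this

end Bands

end

section

variable {d : ℕ} {b : Module.Basis (Fin d) ℝ (E d)}

/-! ### Elliptic regularity -/

/-- Ellipticity: the quotient of `1 + |K|²` by `½|k + K|² + 1` is bounded, so control of the kinetic
part and of `x` in `H^t` controls `x` in `H^{t+2}`. -/
theorem sobSq_add_two_le (k : E d) : ∃ C : ℝ, ∀ (t : ℝ) (x : recipLattice b → ℂ),
    sobSq (t + 2) x ≤ ENNReal.ofReal (C ^ 2) * (2 * sobSq t (fun K : recipLattice b =>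
      (((1 / 2) * ‖k + K‖ ^ 2 : ℝ) : ℂ) * x K) + 2 * sobSq t x) := by
  refine ⟨8 + 4 * sobWeight k, fun t x => ?_⟩
  have hk := sobWeight_pos k
  have e : sobSq (t + 2) x =
      sobSq t (fun K : recipLattice b => ((sobWeight (K : E d) : ℝ) : ℂ) * x K) := by
    refine tsum_congr fun K => ?_
    have hw := sobWeight_pos (K : E d)
    rw [norm_mul, mul_pow, Complex.norm_real, Real.norm_of_nonneg hw.le, ← mul_assoc,
      Real.rpow_add hw, Real.rpow_two]
  rw [e]
  have h1 : ∀ K : recipLattice b, ∃ m : ℂ, ‖m‖ ≤ 8 + 4 * sobWeight k ∧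
      ((sobWeight (K : E d) : ℝ) : ℂ) * x K =
        m * ((((1 / 2) * ‖k + K‖ ^ 2 : ℝ) : ℂ) * x K + x K) := fun K => by
    have hw := sobWeight_pos (K : E d)
    have hpos : 0 < (1 / 2) * ‖k + K‖ ^ 2 + 1 := by positivity
    refine ⟨((sobWeight (K : E d) / ((1 / 2) * ‖k + K‖ ^ 2 + 1) : ℝ) : ℂ), ?_, ?_⟩
    · rw [Complex.norm_real, Real.norm_of_nonneg (by positivity), div_le_iff₀ hpos]
      have h := sobWeight_rpow_add_le (t := 1) zero_le_one (k + (K : E d)) (-k)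
      rw [add_neg_cancel_comm, sobWeight_neg] at h
      simp only [Real.rpow_one] at h
      have h2 : sobWeight (k + (K : E d)) = 1 + ‖k + (K : E d)‖ ^ 2 := rfl
      have h3 := sq_nonneg ‖k + (K : E d)‖
      have h4 := mul_nonneg hk.le h3
      nlinarith
    · have : (((1 / 2) * ‖k + K‖ ^ 2 + 1 : ℝ) : ℂ) ≠ 0 := by exact_mod_cast hpos.ne'
      rw [show (((1 / 2) * ‖k + K‖ ^ 2 : ℝ) : ℂ) * x K + x K =
        (((1 / 2) * ‖k + K‖ ^ 2 + 1 : ℝ) : ℂ) * x K by push_cast; ring, Complex.ofReal_div,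
        ← mul_assoc, div_mul_cancel₀ _ this]
  choose m hm hmx using h1
  have e2 : (fun K : recipLattice b => ((sobWeight (K : E d) : ℝ) : ℂ) * x K) =
      fun K : recipLattice b => m K * ((((1 / 2) * ‖k + K‖ ^ 2 : ℝ) : ℂ) * x K + x K) :=
    funext hmx
  rw [e2]
  refine (sobSq_smul_le t m hm _).trans ?_
  gcongr
  exact sobSq_add_le t _ _

theorem IsPotential.regularity {s : ℝ} {A : Coef b →L[ℂ] Coef b} (hA : IsPotential s A)
    {k : E d} {x y : Coef b} (h : IsImage A k x y) {l : ℂ} {f : Coef b}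
    (hs : 0 ≤ s) (hf : sobSq s f ≠ ⊤) (hy : y = f + l • x) : sobSq (s + 2) x ≠ ⊤ := by
  obtain ⟨C, hC⟩ := sobSq_add_two_le (b := b) k
  -- Bootstrap starting from the domain `H²`. One round spends `7/4` derivatives on the potential
  -- and recovers two from the kinetic part, so that `1/4` is gained each time until the regularity
  -- `s` of the data is reached.
  have key : ∀ m : ℕ, sobSq (min s (m / 4) + 2) x ≠ ⊤ := by
    intro m
    induction m with
    | zero => simpa [hs] using h.1
    | succ m ih =>
      set t := min s (((m + 1 : ℕ) : ℝ) / 4) with ht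
      have ht0 : 0 ≤ t := le_min hs (by positivity)
      have hts : t ≤ s := min_le_left _ _
      have hle : t + 7 / 4 ≤ min s (m / 4) + 2 := by
        have h1 : t ≤ ((m + 1 : ℕ) : ℝ) / 4 := min_le_right _ _
        push_cast at h1
        rcases le_total s ((m : ℝ) / 4) with h' | h'
        · rw [min_eq_left h']; linarith
        · rw [min_eq_right h']; linarith
      obtain ⟨C', hC', hreg⟩ := hA.regular t ht0 hts
      have h1 : sobSq t (A x) ≠ ⊤ := ne_top_of_le_ne_top
        (ENNReal.mul_ne_top hC' (ne_top_of_le_ne_top ih (sobSq_mono hle x))) (hreg x)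
      have h2 : sobSq t x ≠ ⊤ :=
        ne_top_of_le_ne_top ih (sobSq_mono (by linarith) x)
      have h3 : sobSq t f ≠ ⊤ := ne_top_of_le_ne_top hf (sobSq_mono hts _)
      have e : (fun K : recipLattice b => (((1 / 2) * ‖k + K‖ ^ 2 : ℝ) : ℂ) * x K) =
          fun K : recipLattice b => (f K + l * x K) + (-1 : ℂ) * A x K := by
        funext K
        have h4 : y K = f K + l * x K := by
          rw [hy, lp.coeFn_add, Pi.add_apply, lp.coeFn_smul, Pi.smul_apply, smul_eq_mul]
        rw [← h4, h.2 K]; ring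
      have h5 : sobSq t (fun K : recipLattice b => (((1 / 2) * ‖k + K‖ ^ 2 : ℝ) : ℂ) * x K) ≠ ⊤ := by
        rw [e]
        have h6 : sobSq (b := b) t (fun K => l * x K) ≠ ⊤ := ne_top_of_le_ne_top
          (ENNReal.mul_ne_top ENNReal.ofReal_ne_top h2)
          (sobSq_smul_le t (fun _ => l) (fun _ => le_rfl) _)
        have h7 : sobSq (b := b) t (fun K => (-1 : ℂ) * A x K) ≠ ⊤ := ne_top_of_le_ne_top
          (ENNReal.mul_ne_top ENNReal.ofReal_ne_top h1)
          (sobSq_smul_le t (fun _ => (-1 : ℂ)) (fun _ => le_rfl) _)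
        have h8 : sobSq (b := b) t (fun K => f K + l * x K) ≠ ⊤ := ne_top_of_le_ne_top
          (ENNReal.add_ne_top.mpr ⟨ENNReal.mul_ne_top (by norm_num) h3,
            ENNReal.mul_ne_top (by norm_num) h6⟩) (sobSq_add_le t _ _)
        exact ne_top_of_le_ne_top
          (ENNReal.add_ne_top.mpr ⟨ENNReal.mul_ne_top (by norm_num) h8,
            ENNReal.mul_ne_top (by norm_num) h7⟩) (sobSq_add_le t _ _)
      exact ne_top_of_le_ne_top (ENNReal.mul_ne_top ENNReal.ofReal_ne_top
        (ENNReal.add_ne_top.mpr ⟨ENNReal.mul_ne_top (by norm_num) h5,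
            ENNReal.mul_ne_top (by norm_num) h2⟩)) (hC t x)
  obtain ⟨m, hm⟩ := exists_nat_gt (4 * s)
  have := key m
  rwa [min_eq_left (by linarith)] at this

theorem IsPotential.exists_sobScale {s : ℝ} {A : Coef b →L[ℂ] Coef b} (hA : IsPotential s A)
    {k : E d} {x y : Coef b} (h : IsImage A k x y) {l : ℂ} {f : Coef b}
    (hs : 0 ≤ s) (hf : sobSq s f ≠ ⊤) (hy : y = f + l • x) :
    ∃ a, sobScale b (s + 2) a = x := by
  obtain ⟨a, ha⟩ := BlochBands.exists_sobScale (by linarith) (hA.regularity h hs hf hy)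
  exact ⟨a, by ext K; exact ha K⟩

theorem sobSq_zero (t : ℝ) : sobSq t ((0 : Coef b) : recipLattice b → ℂ) = 0 := by
  simp [sobSq]

theorem IsPotential.exists_sobScale_eigen {s : ℝ} {A : Coef b →L[ℂ] Coef b} (hA : IsPotential s A)
    {k : E d} {x : Coef b} {l : ℂ} (h : IsImage A k x (l • x)) (hs : 0 ≤ s) :
    ∃ a, sobScale b (s + 2) a = x :=
  hA.exists_sobScale h hs (f := 0) (by rw [sobSq_zero]; exact ENNReal.zero_ne_top) (zero_add _).symm

/-! ### The fiber Hamiltonian from `H^{s+2}` to `H^s` -/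

/-- `W` is the potential read from the coordinates of `H^{s+2}` to those of `H^s`. It allows the
eigenvalue equation to be treated as a smooth equation with unknowns in `H^{s+2}`. -/
theorem IsPotential.exists_lift {s : ℝ} {A : Coef b →L[ℂ] Coef b} (hA : IsPotential s A)
    (hs : 0 ≤ s) : ∃ W : Coef b →L[ℂ] Coef b,
      ∀ a, sobScale b s (W a) = A (sobScale b (s + 2) a) := by
  obtain ⟨C, hC, h⟩ := hA.regular s hs le_rfl
  refine exists_lift_linear hs (A ∘L sobScale b (s + 2)) hC fun a => ?_
  refine (h _).trans ?_
  gcongr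
  rw [← sobSq_sobScale_self (σ := s + 2) (by linarith)]
  exact sobSq_mono (by linarith) _

theorem sobScale_diagOp {s : ℝ} (hs : 0 ≤ s) {m : recipLattice b → ℂ} {C : ℝ}
    (hm : ∀ K, ‖m K‖ ≤ C) (x : Coef b) :
    sobScale b s (diagOp m x) = diagOp m (sobScale b s x) := by
  ext K
  rw [sobScale_apply hs, diagOp_apply hm, diagOp_apply hm, sobScale_apply hs]
  ring

theorem sobScale_kin_add {s : ℝ} (hs : 0 ≤ s) {A W : Coef b →L[ℂ] Coef b}
    (hW : ∀ a, sobScale b s (W a) = A (sobScale b (s + 2) a)) (k : E d) (a : Coef b) :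
    sobScale b s (diagOp (kinSymbol b k) a + W a) = hamOp A k (sobScale b s a) := by
  rw [map_add, sobScale_diagOp hs (norm_kinSymbol_le k), hW, add_comm s 2,
    sobScale_add (by norm_num) hs]
  rfl

/-- `½|k + K|² = ½|K|² + K·k + ½|k|²`, and each of `|K|²`, `K_i` and `1` is bounded relative to `1 +
|K|²`. The operator is thus a quadratic polynomial in `k` with bounded coefficients. -/
theorem contDiff_diagOp_kinSymbol :
    ContDiff ℝ ⊤ fun k : E d => (diagOp (kinSymbol b k) : Coef b →L[ℂ] Coef b) := by
  have e : (fun k : E d => (diagOp (kinSymbol b k) : Coef b →L[ℂ] Coef b)) = fun k =>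
      diagOp (kinSymbol b 0) +
        ((∑ i, ((k i : ℝ) : ℂ) • diagOp (fun K : recipLattice b =>
            (((K : E d) i * (sobWeight (K : E d))⁻¹ : ℝ) : ℂ))) +
          (((1 / 2) * ‖k‖ ^ 2 : ℝ) : ℂ) • sobScale b 2) := by
    funext k
    ext x K
    have h1 : ∀ i : Fin d, ∀ K : recipLattice b,
        ‖(((K : E d) i * (sobWeight (K : E d))⁻¹ : ℝ) : ℂ)‖ ≤ 1 := fun i K => by
      have hw := sobWeight_pos (K : E d)
      rw [Complex.norm_real, norm_mul, norm_inv, Real.norm_of_nonneg hw.le, ← div_eq_mul_inv,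
        div_le_one hw]
      refine (PiLp.norm_apply_le (K : E d) i).trans ?_
      rw [sobWeight]; nlinarith [sq_nonneg (‖(K : E d)‖ - 1)]
    have h2 : (∑ i, ((k i : ℝ) : ℂ) • diagOp (fun K : recipLattice b =>
            (((K : E d) i * (sobWeight (K : E d))⁻¹ : ℝ) : ℂ))) x K =
        ∑ i, ((k i : ℝ) : ℂ) * ((((K : E d) i * (sobWeight (K : E d))⁻¹ : ℝ) : ℂ) * x K) := by
      rw [sum_apply, lp.coeFn_sum, Finset.sum_apply]
      refine Finset.sum_congr rfl fun i _ => ?_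
      rw [← diagOp_apply (h1 i)]; rfl
    change _ = (diagOp (kinSymbol b 0) x) K + ((∑ i, ((k i : ℝ) : ℂ) • diagOp
      (fun K : recipLattice b => (((K : E d) i * (sobWeight (K : E d))⁻¹ : ℝ) : ℂ))) x K +
        (((1 / 2) * ‖k‖ ^ 2 : ℝ) : ℂ) * sobScale b 2 x K)
    rw [h2, diagOp_apply (norm_kinSymbol_le k), diagOp_apply (norm_kinSymbol_le 0),
      sobScale_apply (by norm_num), kinSymbol, kinSymbol, zero_add, norm_add_sq_real,
      PiLp.inner_apply]
    have e3 : -((2 : ℝ) / 2) = -1 := by norm_num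
    rw [e3, Real.rpow_neg_one]
    simp only [RCLike.inner_apply, conj_trivial]
    have e4 : ∑ i, ((k i : ℝ) : ℂ) * ((((K : E d) i * (sobWeight (K : E d))⁻¹ : ℝ) : ℂ) * x K) =
        (((∑ i, (K : E d) i * k i) * (sobWeight (K : E d))⁻¹ : ℝ) : ℂ) * x K := by
      rw [Finset.sum_mul, Complex.ofReal_sum, Finset.sum_mul]
      refine Finset.sum_congr rfl fun i _ => ?_
      push_cast; ring
    rw [e4]
    push_cast
    ring
  rw [e]
  have h1 : ∀ i : Fin d, ContDiff ℝ ⊤ fun k : E d => ((k i : ℝ) : ℂ) := fun i =>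
    Complex.ofRealCLM.contDiff.comp (EuclideanSpace.proj (𝕜 := ℝ) i).contDiff
  have h2 : ContDiff ℝ ⊤ fun k : E d => (((1 / 2) * ‖k‖ ^ 2 : ℝ) : ℂ) :=
    Complex.ofRealCLM.contDiff.comp (contDiff_const.mul (contDiff_norm_sq ℝ))
  exact contDiff_const.add ((ContDiff.sum fun i _ => (h1 i).smul contDiff_const).add
    (h2.smul contDiff_const))

/-! ### Solving the eigenvalue equation with a right-hand side -/

/-- The reduced resolvent at `l`: on the complement of the first `M` eigenvectors `H_k - l` is
bounded below by `e M - l > 0`, so dividing the coefficients of `f` by `e n - l` gives `y`. -/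
theorem IsEigensystem.exists_solution {A : Coef b →L[ℂ] Coef b} {k : E d} {e : ℕ → ℝ}
    {x : ℕ → Coef b} (hx : IsEigensystem A k e x) {M : ℕ} {l : ℝ} (hl : l < e M) {f : Coef b}
    (hf : ∀ n < M, inner ℂ (x n) f = 0) :
    ∃ y, IsImage A k y (f + (l : ℂ) • y) ∧ ∀ n < M, inner ℂ (x n) y = 0 := by
  let B := HilbertBasis.mkOfOrthogonalEqBot hx.orthonormal hx.complete
  have hB : ∀ j, B j = x j := fun j => by simp [B]
  obtain ⟨c, T, -, hT, hT'⟩ := exists_resolvent A k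
  have hpos : ∀ n, M ≤ n → 0 < e n - l := fun n hn => by linarith [hx.mono hn]
  have hcoef : ∀ n, B.repr f n = inner ℂ (x n) f := fun n => by
    rw [HilbertBasis.repr_apply_apply, hB]
  let m : ℕ → ℂ := fun n => if n < M then 0 else (((e n - l)⁻¹ : ℝ) : ℂ)
  have hm : ∀ n, ‖m n‖ ≤ (e M - l)⁻¹ := fun n => by
    by_cases h : n < M
    · simp only [m, if_pos h, norm_zero]; exact (inv_pos.mpr (hpos M le_rfl)).le
    · simp only [m, if_neg h, Complex.norm_real]
      have := hpos n (not_lt.mp h)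
      rw [Real.norm_of_nonneg (inv_pos.mpr this).le]
      exact inv_anti₀ (hpos M le_rfl) (by linarith [hx.mono (not_lt.mp h)])
  obtain ⟨z, hz⟩ : ∃ z : lp (fun _ : ℕ => ℂ) 2, ∀ n, z n = m n * B.repr f n := by
    have h0 : 0 ≤ (e M - l)⁻¹ := (inv_pos.mpr (hpos M le_rfl)).le
    refine ⟨lp.mapCLM 2 (fun n => m n • ContinuousLinearMap.id ℂ ℂ) h0 (fun n => by
      rw [norm_smul, ContinuousLinearMap.norm_id, mul_one]; exact hm n) (B.repr f), fun n => ?_⟩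
    rw [lp.mapCLM_apply_coe]
    simp
  set y := B.repr.symm z with hy
  have hyn : ∀ n, B.repr y n = m n * B.repr f n := fun n => by rw [hy]; simp [hz]
  have hfm : ∀ n, B.repr f n = ((e n - l : ℝ) : ℂ) * B.repr y n := fun n => by
    rw [hyn]
    by_cases h : n < M
    · rw [hcoef, hf n h]; simp
    · have : ((e n - l : ℝ) : ℂ) ≠ 0 := by exact_mod_cast (hpos n (not_lt.mp h)).ne'
      simp only [m, if_neg h, Complex.ofReal_inv]
      field_simp
  have hTx : ∀ n, T (((e n + c : ℝ) : ℂ) • x n) = x n := fun n => by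
    have := hT' _ _ (hx.eigen n)
    rwa [← add_smul, ← Complex.ofReal_add] at this
  -- The equation is checked in its resolvent form, since the bounded `T` can be applied termwise to
  -- the expansion; membership of `y` in the domain follows with it.
  have hTy : T (f + ((l + c : ℝ) : ℂ) • y) = y := by
    have h1 := ((B.hasSum_repr f).add ((B.hasSum_repr y).const_smul ((l + c : ℝ) : ℂ))).mapL T
    have h2 : ∀ n, T (B.repr f n • B n + ((l + c : ℝ) : ℂ) • B.repr y n • B n) =
        B.repr y n • B n := fun n => by
      rw [hfm, smul_smul, ← add_smul]
      rw [show ((e n - l : ℝ) : ℂ) * B.repr y n + ((l + c : ℝ) : ℂ) * B.repr y n =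
        B.repr y n * ((e n + c : ℝ) : ℂ) by push_cast; ring, mul_smul, map_smul, hB, hTx]
    simp only [h2] at h1
    exact h1.unique (B.hasSum_repr y)
  refine ⟨y, ?_, fun n hn => ?_⟩
  · have h := hT (f + ((l + c : ℝ) : ℂ) • y)
    rw [hTy] at h
    have e1 : f + ((l + c : ℝ) : ℂ) • y - (c : ℂ) • y = f + (l : ℂ) • y := by
      push_cast; rw [add_smul]; abel
    rwa [e1] at h
  · rw [← hB, ← HilbertBasis.repr_apply_apply, hyn]
    simp [m, hn]

end

section

variable {d : ℕ} {b : Module.Basis (Fin d) ℝ (E d)}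

/-! ### Smooth local frames of the low eigenspaces -/

/-- `G (k₀, ·)` is exactly quadratic along lines through `x₀`, so `D` is its partial derivative
there, and linearity and continuity of `D` come for free. A bijective bounded operator between
Banach spaces is invertible, as the implicit function theorem requires. -/
theorem exists_implicit {E₁ X Y : Type*} [NormedAddCommGroup E₁] [NormedSpace ℝ E₁]
    [CompleteSpace E₁] [NormedAddCommGroup X] [NormedSpace ℝ X] [CompleteSpace X]
    [NormedAddCommGroup Y] [NormedSpace ℝ Y] [CompleteSpace Y] {G : E₁ × X → Y} {k₀ : E₁} {x₀ : X}
    (hG : ContDiffAt ℝ ⊤ G (k₀, x₀)) (D Q : X → Y)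
    (hD : ∀ (v : X) (t : ℝ), G (k₀, x₀ + t • v) = G (k₀, x₀) + (t • D v + t ^ 2 • Q v))
    (hinj : ∀ v, D v = 0 → v = 0) (hsurj : ∀ y, ∃ v, D v = y) :
    ∃ ψ : E₁ → X, ContDiffAt ℝ ⊤ ψ k₀ ∧ ψ k₀ = x₀ ∧
      ∀ᶠ k in 𝓝 k₀, G (k, ψ k) = G (k₀, x₀) := by
  have hf := (hG.differentiableAt (by simp)).hasFDerivAt
  have hv : ∀ v, (fderiv ℝ G (k₀, x₀) ∘L .inr ℝ E₁ X) v = D v := fun v => by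
    have h1 : HasDerivAt (fun t : ℝ => (k₀, x₀ + t • v)) ((0 : E₁), v) 0 := by
      have h2 : HasDerivAt (fun t : ℝ => x₀ + t • v) v 0 := by
        simpa using ((hasDerivAt_id (0 : ℝ)).smul_const v).const_add x₀
      exact (hasDerivAt_const (0 : ℝ) k₀).prodMk h2
    have h3 := HasFDerivAt.comp_hasDerivAt_of_eq (0 : ℝ) hf h1 (by simp)
    have h4 : HasDerivAt (fun t : ℝ => G (k₀, x₀) + (t • D v + t ^ 2 • Q v)) (D v) 0 := by
      have h5 := ((hasDerivAt_id (0 : ℝ)).smul_const (D v)).add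
        (((hasDerivAt_id (0 : ℝ)).pow 2).smul_const (Q v))
      simpa using h5.const_add (G (k₀, x₀))
    have h6 : (G ∘ fun t : ℝ => (k₀, x₀ + t • v)) =
        fun t : ℝ => G (k₀, x₀) + (t • D v + t ^ 2 • Q v) := funext fun t => hD v t
    rw [h6] at h3
    exact h3.unique h4
  have hi : (fderiv ℝ G (k₀, x₀) ∘L .inr ℝ E₁ X).IsInvertible := by
    refine ⟨ContinuousLinearEquiv.ofBijective _ ?_ ?_,
      ContinuousLinearEquiv.coe_ofBijective _ _ _⟩
    · rw [LinearMap.ker_eq_bot']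
      exact fun v h => hinj v ((hv v).symm.trans h)
    · rw [LinearMap.range_eq_top]
      exact fun y => (hsurj y).imp fun v h => (hv v).trans h
  exact ⟨hG.implicitFunction (by simp) hi, hG.contDiffAt_implicitFunction (by simp) hi,
    hG.implicitFunction_apply_self (by simp) hi, hG.eventually_apply_implicitFunction (by simp) hi⟩

theorem isImage_sobScale_add {s : ℝ} (hs : 0 ≤ s) {A W : Coef b →L[ℂ] Coef b}
    (hW : ∀ a, sobScale b s (W a) = A (sobScale b (s + 2) a)) (k : E d) (a : Coef b) :
    IsImage A k (sobScale b (s + 2) a) (sobScale b s (diagOp (kinSymbol b k) a + W a)) := by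
  rw [sobScale_kin_add hs hW, add_comm s 2, sobScale_add (by norm_num) hs]
  exact isImage_sobScale A k _

theorem contDiff_kin_apply {F : Type*} [NormedAddCommGroup F] [NormedSpace ℝ F]
    {f : F → E d} {g : F → Coef b} (hf : ContDiff ℝ ⊤ f) (hg : ContDiff ℝ ⊤ g) :
    ContDiff ℝ ⊤ fun x => diagOp (kinSymbol b (f x)) (g x) :=
  (((ContinuousLinearMap.restrictScalarsL ℂ (Coef b) (Coef b) ℝ ℝ).contDiff.comp
    contDiff_diagOp_kinSymbol).comp hf).clm_apply hg

theorem contDiff_clm_apply {F : Type*} [NormedAddCommGroup F] [NormedSpace ℝ F]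
    {H : Type*} [NormedAddCommGroup H] [NormedSpace ℝ H] [NormedSpace ℂ H] [IsScalarTower ℝ ℂ H]
    (L : Coef b →L[ℂ] H) {g : F → Coef b} (hg : ContDiff ℝ ⊤ g) :
    ContDiff ℝ ⊤ fun x => L (g x) :=
  (L.restrictScalars ℝ).contDiff.comp hg

/-- The eigenvalue equation for frames of the low eigenspaces, normalised against a fixed frame. -/
def frameMap (W : Coef b →L[ℂ] Coef b) {M : ℕ} (ℓ : Fin M → Coef b →L[ℂ] ℂ)
    (z : E d × (Fin M → Coef b) × (Fin M → Fin M → ℂ)) :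
    (Fin M → Coef b) × (Fin M → Fin M → ℂ) :=
  (fun j => diagOp (kinSymbol b z.1) (z.2.1 j) + W (z.2.1 j) -
      ∑ i, z.2.2 i j • sobScale b 2 (z.2.1 i),
    fun i j => ℓ i (z.2.1 j))

theorem contDiff_frameMap (W : Coef b →L[ℂ] Coef b) {M : ℕ} (ℓ : Fin M → Coef b →L[ℂ] ℂ) :
    ContDiff ℝ ⊤ (frameMap W ℓ) := by
  have ha : ∀ j, ContDiff ℝ ⊤
      fun z : E d × (Fin M → Coef b) × (Fin M → Fin M → ℂ) => z.2.1 j := fun j =>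
    (contDiff_apply ℝ (Coef b) j).comp (contDiff_fst.comp contDiff_snd)
  have hΛ : ∀ i j, ContDiff ℝ ⊤
      fun z : E d × (Fin M → Coef b) × (Fin M → Fin M → ℂ) => z.2.2 i j := fun i j =>
    (contDiff_apply_apply ℝ ℂ i j).comp (contDiff_snd.comp contDiff_snd)
  refine ContDiff.prodMk (contDiff_pi.mpr fun j => ?_)
    (contDiff_pi.mpr fun i => contDiff_pi.mpr fun j => contDiff_clm_apply (ℓ i) (ha j))
  exact ((contDiff_kin_apply contDiff_fst (ha j)).add (contDiff_clm_apply W (ha j))).sub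
    (ContDiff.sum fun i _ => (hΛ i j).smul (contDiff_clm_apply (sobScale b 2) (ha i)))

set_option maxHeartbeats 1000000 in
-- Eigenvectors need not be smooth at crossings among the low bands, but an invariant frame is: the
-- unknowns are vectors `X_j` and a matrix `Λ` with `H_k X_j = ∑ Λ_ij X_i`, normalised by `⟨φ_i,
-- X_j⟩ = δ_ij`. The gap below band `M` makes the linearised problem at `k₀` bijective from
-- `H^{s+2}` to `H^s`.
theorem exists_frame {s : ℝ} (hs : 0 ≤ s) {A W : Coef b →L[ℂ] Coef b} (hA : IsPotential s A)
    (hW : ∀ a, sobScale b s (W a) = A (sobScale b (s + 2) a)) {k₀ : E d} {e : ℕ → ℝ}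
    {φ : ℕ → Coef b} (hφ : IsEigensystem A k₀ e φ) {M : ℕ} (hgap : ∀ j < M, e j < e M) :
    ∃ (a : E d → Fin M → Coef b) (Λ : E d → Fin M → Fin M → ℂ),
      ContDiffAt ℝ ⊤ a k₀ ∧ ContDiffAt ℝ ⊤ Λ k₀ ∧
      (∀ i j, Λ k₀ i j = if i = j then (e j : ℂ) else 0) ∧
      ∀ᶠ k in 𝓝 k₀, (∀ j, IsImage A k (sobScale b (s + 2) (a k j))
          (∑ i, Λ k i j • sobScale b (s + 2) (a k i))) ∧
        ∀ i j : Fin M, inner ℂ (φ i) (sobScale b (s + 2) (a k j)) = if i = j then 1 else 0 := by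
  have hs2 : 0 ≤ s + 2 := by linarith
  choose α hα using fun j => hA.exists_sobScale_eigen (hφ.eigen j) hs
  let ℓ : Fin M → Coef b →L[ℂ] ℂ := fun i => innerSL ℂ (φ i) ∘L sobScale b (s + 2)
  have hℓ : ∀ i x, ℓ i x = inner ℂ (φ i) (sobScale b (s + 2) x) := fun i x => rfl
  let x₀ : (Fin M → Coef b) × (Fin M → Fin M → ℂ) :=
    (fun j => α j, fun i j => if i = j then (e j : ℂ) else 0)
  have hM : ∀ x, sobScale b s (sobScale b 2 x) = sobScale b (s + 2) x := fun x =>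
    (sobScale_add hs (by norm_num) x).symm
  have hHα : ∀ j, diagOp (kinSymbol b k₀) (α j) + W (α j) = (e j : ℂ) • sobScale b 2 (α j) :=
    fun j => by
      refine sobScale_injective hs ?_
      rw [map_smul, hM, hα]
      have h1 := isImage_sobScale_add hs hW k₀ (α j)
      rw [hα] at h1
      exact h1.unique (hφ.eigen j)
  have hG0 : frameMap W ℓ (k₀, x₀) = (0, fun i j => if i = j then 1 else 0) := by
    refine Prod.ext (funext fun j => ?_) (funext fun i => funext fun j => ?_)
    · simp only [frameMap, x₀, hHα, ite_smul, zero_smul]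
      simp
    · simp only [frameMap, x₀, hℓ, hα]
      rw [orthonormal_iff_ite.mp hφ.orthonormal]
      simp [Fin.ext_iff]
  -- `D` is the linearisation of the equation at the eigenvectors; `Q` below is the remainder, due
  -- to the product of the variations of `Λ` and of the frame.
  let D : (Fin M → Coef b) × (Fin M → Fin M → ℂ) → (Fin M → Coef b) × (Fin M → Fin M → ℂ) :=
    fun v => (fun j => diagOp (kinSymbol b k₀) (v.1 j) + W (v.1 j) -
        (e j : ℂ) • sobScale b 2 (v.1 j) - ∑ i, v.2 i j • sobScale b 2 (α i),
      fun i j => ℓ i (v.1 j))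
  let Q : (Fin M → Coef b) × (Fin M → Fin M → ℂ) → (Fin M → Coef b) × (Fin M → Fin M → ℂ) :=
    fun v => (fun j => -∑ i, v.2 i j • sobScale b 2 (v.1 i), 0)
  have hD : ∀ v (t : ℝ), frameMap W ℓ (k₀, x₀ + t • v) =
      frameMap W ℓ (k₀, x₀) + (t • D v + t ^ 2 • Q v) := by
    intro v t
    rw [hG0]
    have ht : ∀ x : Coef b, t • x = (t : ℂ) • x := fun x => (Complex.coe_smul t x).symm
    have ht2 : ∀ x : Coef b, t ^ 2 • x = ((t : ℂ) ^ 2) • x := fun x => by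
      rw [← Complex.ofReal_pow]
      exact (Complex.coe_smul _ x).symm
    refine Prod.ext (funext fun j => ?_) (funext fun i => funext fun j => ?_)
    · have e1 : ∑ i, ((if i = j then (e j : ℂ) else 0) + (t : ℂ) * v.2 i j) •
          (sobScale b 2 (α i) + (t : ℂ) • sobScale b 2 (v.1 i)) =
          (e j : ℂ) • sobScale b 2 (α j) + (t : ℂ) • ((e j : ℂ) • sobScale b 2 (v.1 j)) +
          (t : ℂ) • (∑ i, v.2 i j • sobScale b 2 (α i)) +
          ((t : ℂ) ^ 2) • ∑ i, v.2 i j • sobScale b 2 (v.1 i) := by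
        have e2 : ∀ i : Fin M, ((if i = j then (e j : ℂ) else 0) + (t : ℂ) * v.2 i j) •
            (sobScale b 2 (α i) + (t : ℂ) • sobScale b 2 (v.1 i)) =
            (if i = j then (e j : ℂ) • sobScale b 2 (α i) else 0) +
            (if i = j then (t : ℂ) • ((e j : ℂ) • sobScale b 2 (v.1 i)) else 0) +
            (t : ℂ) • (v.2 i j • sobScale b 2 (α i)) +
            ((t : ℂ) ^ 2) • (v.2 i j • sobScale b 2 (v.1 i)) := fun i => by
          split_ifs <;> module
        rw [Finset.sum_congr rfl fun i _ => e2 i]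
        simp only [Finset.sum_add_distrib, Finset.sum_ite_eq', Finset.mem_univ, if_true,
          ← Finset.smul_sum]
      have e3 : (frameMap W ℓ (k₀, x₀ + t • v)).1 j =
          (diagOp (kinSymbol b k₀) (α j) + W (α j)) + (t : ℂ) • (diagOp (kinSymbol b k₀) (v.1 j) +
            W (v.1 j)) - ∑ i, ((if i = j then (e j : ℂ) else 0) + (t : ℂ) * v.2 i j) •
          (sobScale b 2 (α i) + (t : ℂ) • sobScale b 2 (v.1 i)) := by
        simp only [frameMap, x₀, Prod.fst_add, Prod.snd_add, Prod.smul_fst, Prod.smul_snd,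
          Pi.add_apply, Pi.smul_apply, ht, map_add, map_smul, Complex.real_smul]
        congr 1
        module
      have e4 : (((0 : Fin M → Coef b), fun i j => if i = j then (1 : ℂ) else 0) +
          (t • D v + t ^ 2 • Q v)).1 j = (t : ℂ) • (diagOp (kinSymbol b k₀) (v.1 j) + W (v.1 j) -
        (e j : ℂ) • sobScale b 2 (v.1 j) - ∑ i, v.2 i j • sobScale b 2 (α i)) +
        ((t : ℂ) ^ 2) • (-∑ i, v.2 i j • sobScale b 2 (v.1 i)) := by
        rw [← ht, ← ht2]
        exact zero_add _
      rw [e3, e4, e1, hHα]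
      module
    · have : (frameMap W ℓ (k₀, x₀ + t • v)).2 i j = ℓ i (α j) + (t : ℂ) * ℓ i (v.1 j) := by
        simp only [frameMap, x₀, Prod.fst_add, Prod.smul_fst, 
          Pi.add_apply, Pi.smul_apply, ht, map_add, map_smul, smul_eq_mul]
      rw [this, hℓ i (α j), hα, orthonormal_iff_ite.mp hφ.orthonormal]
      simp [D, Q, Fin.ext_iff]
  have hDs : ∀ v j, sobScale b s ((D v).1 j) =
      sobScale b s (diagOp (kinSymbol b k₀) (v.1 j) + W (v.1 j)) -
        (e j : ℂ) • sobScale b (s + 2) (v.1 j) - ∑ i, v.2 i j • φ i := fun v j => by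
    simp only [D, map_sub, map_smul, map_sum, hM, hα]
  have hinj : ∀ v, D v = 0 → v = 0 := by
    intro v hv
    have horth : ∀ i j : Fin M, inner ℂ (φ i) (sobScale b (s + 2) (v.1 j)) = 0 := fun i j =>
      congrFun (congrFun (congrArg Prod.snd hv) i) j
    have heq : ∀ j : Fin M, IsImage A k₀ (sobScale b (s + 2) (v.1 j))
        ((e j : ℂ) • sobScale b (s + 2) (v.1 j) + ∑ i, v.2 i j • φ i) := fun j => by
      have h1 := isImage_sobScale_add hs hW k₀ (v.1 j)
      have h2 := hDs v j
      rw [hv] at h2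
      have h3 : sobScale b s (diagOp (kinSymbol b k₀) (v.1 j) + W (v.1 j)) =
          (e j : ℂ) • sobScale b (s + 2) (v.1 j) + ∑ i, v.2 i j • φ i := by
        rw [Prod.fst_zero, Pi.zero_apply, map_zero] at h2
        rw [← sub_eq_zero, h2]; abel
      rwa [h3] at h1
    -- Pairing with `φ i` removes the terms in `v.1 j`, which is orthogonal to `φ i`, and leaves
    -- only the matrix coefficient.
    have hΘ : ∀ i j : Fin M, v.2 i j = 0 := fun i j => by
      have h1 := (hφ.eigen i).symm_inner hA.symm (heq j)
      rw [inner_smul_left, horth, inner_add_right, inner_smul_right, horth, inner_sum] at h1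
      simp only [inner_smul_right, orthonormal_iff_ite.mp hφ.orthonormal, Fin.val_inj] at h1
      simpa using h1.symm
    -- What remains satisfies the eigenvalue equation at `e j` but is orthogonal to the `M` lowest
    -- eigenvectors, where the form is at least `e M > e j`.
    have hv1 : ∀ j, v.1 j = 0 := fun j => by
      have h1 := heq j
      simp only [hΘ, zero_smul, Finset.sum_const_zero, add_zero] at h1
      have h2 := hφ.le_rayleigh hA.symm (n := M) h1 fun i hi => horth ⟨i, hi⟩ j
      rw [inner_smul_right, inner_self_eq_norm_sq_to_K] at h2
      have h3 : RCLike.re ((e j : ℂ) * ((‖sobScale b (s + 2) (v.1 j)‖ : ℝ) : ℂ) ^ 2) =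
          e j * ‖sobScale b (s + 2) (v.1 j)‖ ^ 2 := by
        rw [← Complex.ofReal_pow, ← Complex.ofReal_mul]; rfl
      have h4 : e M * ‖sobScale b (s + 2) (v.1 j)‖ ^ 2 ≤
          e j * ‖sobScale b (s + 2) (v.1 j)‖ ^ 2 := h2.trans_eq h3
      have h5 : ‖sobScale b (s + 2) (v.1 j)‖ ^ 2 ≤ 0 := by
        nlinarith [hgap j j.2, sq_nonneg ‖sobScale b (s + 2) (v.1 j)‖]
      have h6 : sobScale b (s + 2) (v.1 j) = 0 := by
        rw [← norm_eq_zero]; exact pow_eq_zero_iff two_ne_zero |>.mp (le_antisymm h5 (sq_nonneg _))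
      exact sobScale_injective hs2 (h6.trans (map_zero _).symm)
    exact Prod.ext (funext hv1) (funext fun i => funext fun j => hΘ i j)
  have hsurj : ∀ y, ∃ v, D v = y := by
    intro y
    -- The components of the data along the low eigenvectors. They are removed in `g` so that the
    -- reduced resolvent applies, and are accounted for by the matrix unknown.
    let c : Fin M → Fin M → ℂ := fun i j => inner ℂ (φ i) (sobScale b s (y.1 j))
    let g : Fin M → Coef b := fun j => y.1 j - ∑ i, c i j • sobScale b 2 (α i)
    have hg : ∀ j, sobScale b s (g j) = sobScale b s (y.1 j) - ∑ i, c i j • φ i := fun j => by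
      simp only [g, map_sub, map_sum, map_smul, hM, hα]
    have hsol : ∀ j : Fin M, ∃ h : Coef b,
        IsImage A k₀ (sobScale b (s + 2) h)
          (sobScale b s (g j) + (e j : ℂ) • sobScale b (s + 2) h) ∧
        ∀ i : Fin M, inner ℂ (φ i) (sobScale b (s + 2) h) = 0 := fun j => by
      obtain ⟨x, hx, hx'⟩ := hφ.exists_solution (M := M) (hgap j j.2) (f := sobScale b s (g j)) (by
        intro n hn
        rw [hg, inner_sub_right, inner_sum]
        simp only [inner_smul_right, orthonormal_iff_ite.mp hφ.orthonormal]
        rw [Finset.sum_eq_single ⟨n, hn⟩ (fun i _ hi => by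
          rw [if_neg (fun h => hi (Fin.ext h.symm)), mul_zero]) (by simp)]
        simp [c])
      obtain ⟨h, rfl⟩ := hA.exists_sobScale hx hs (f := sobScale b s (g j))
        (by rw [sobSq_sobScale_self hs]; exact ENNReal.ofReal_ne_top) rfl
      exact ⟨h, hx, fun i => hx' i i.2⟩
    choose h hh hh' using hsol
    -- The normalisation forces the component of `v.1 j` along `α i` to be `y.2 i j`. Applying `H -
    -- e j` to it produces the multiples `(e i - e j) y.2 i j`, which the matrix part cancels
    -- together with the removed components `c i j`.
    refine ⟨(fun j => h j + ∑ i, y.2 i j • α i,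
      fun i j => -c i j + ((e i : ℂ) - (e j : ℂ)) * y.2 i j), ?_⟩
    refine Prod.ext (funext fun j => sobScale_injective hs ?_)
      (funext fun i => funext fun j => ?_)
    · rw [hDs]
      dsimp only
      have h1 : sobScale b s (diagOp (kinSymbol b k₀) (h j) + W (h j)) =
          sobScale b s (g j) + (e j : ℂ) • sobScale b (s + 2) (h j) :=
        (isImage_sobScale_add hs hW k₀ (h j)).unique (hh j)
      have h2 : diagOp (kinSymbol b k₀) (h j + ∑ i, y.2 i j • α i) +
          W (h j + ∑ i, y.2 i j • α i) = (diagOp (kinSymbol b k₀) (h j) + W (h j)) +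
            ∑ i : Fin M, y.2 i j • ((e i : ℂ) • sobScale b 2 (α i)) := by
        simp only [map_add, map_sum, map_smul, ← hHα, smul_add, Finset.sum_add_distrib]
        abel
      rw [h2, map_add (sobScale b s), h1, hg]
      simp only [map_add, map_sum, map_smul, hM, hα, add_smul, neg_smul, mul_smul,
        sub_smul, Finset.sum_add_distrib, Finset.sum_neg_distrib, Finset.sum_sub_distrib, smul_add,
        Finset.smul_sum]
      have h3 : ∀ i : Fin M, y.2 i j • (e i : ℂ) • φ i = (e i : ℂ) • y.2 i j • φ i :=
        fun i => smul_comm _ _ _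
      simp only [h3]
      abel
    · change ℓ i (h j + ∑ i, y.2 i j • α i) = y.2 i j
      rw [map_add, hℓ, hh', zero_add, map_sum]
      have h4 : ∀ x : Fin M, ℓ i (α x) = if i = x then 1 else 0 := fun x => by
        rw [hℓ, hα, orthonormal_iff_ite.mp hφ.orthonormal]
        simp [Fin.ext_iff]
      simp only [map_smul, h4]
      simp
  obtain ⟨ψ, h1, h2, h3⟩ := exists_implicit (contDiff_frameMap W ℓ).contDiffAt D Q hD hinj hsurj
  refine ⟨fun k => (ψ k).1, fun k => (ψ k).2, h1.fst, h1.snd, fun i j => by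
    change (ψ k₀).2 i j = _
    rw [h2], ?_⟩
  filter_upwards [h3] with k hk
  rw [hG0] at hk
  refine ⟨fun j => ?_, fun i j => congrFun (congrFun (congrArg Prod.snd hk) i) j⟩
  have h4 := isImage_sobScale_add hs hW k ((ψ k).1 j)
  have h5 : diagOp (kinSymbol b k) ((ψ k).1 j) + W ((ψ k).1 j) -
      ∑ i, (ψ k).2 i j • sobScale b 2 ((ψ k).1 i) = 0 := congrFun (congrArg Prod.fst hk) j
  rw [sub_eq_zero.mp h5, map_sum] at h4
  simpa only [map_smul, hM] using h4

end

section

variable {d : ℕ} {b : Module.Basis (Fin d) ℝ (E d)}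

/-! ### Smoothness of sums over the low bands -/

theorem contDiffAt_det {F : Type*} [NormedAddCommGroup F] [NormedSpace ℝ F] {m : ℕ}
    {G : F → Matrix (Fin m) (Fin m) ℂ} {x : F} {n : WithTop ℕ∞}
    (hG : ∀ i j, ContDiffAt ℝ n (fun y => G y i j) x) : ContDiffAt ℝ n (fun y => (G y).det) x := by
  simp only [Matrix.det_apply']
  exact ContDiffAt.sum fun σ _ => contDiffAt_const.mul (contDiffAt_prod fun i _ => hG _ _)

theorem contDiffAt_matrix_inv {F : Type*} [NormedAddCommGroup F] [NormedSpace ℝ F] {m : ℕ}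
    {G : F → Matrix (Fin m) (Fin m) ℂ} {x : F} {n : WithTop ℕ∞}
    (hG : ∀ i j, ContDiffAt ℝ n (fun y => G y i j) x) (h0 : (G x).det ≠ 0) (i j : Fin m) :
    ContDiffAt ℝ n (fun y => (G y)⁻¹ i j) x := by
  simp only [Matrix.inv_def, Matrix.smul_apply, Ring.inverse_eq_inv', Matrix.adjugate_apply]
  refine ((contDiffAt_det hG).inv h0).smul (contDiffAt_det fun i' j' => ?_)
  simp only [Matrix.updateRow_apply]
  split_ifs
  · exact contDiffAt_const
  · exact hG _ _

/-- Diagonal dominance: `ε` lies `δ` above the diagonal model, so `δ ‖r j‖ ≤ η ∑ ‖r i‖`, and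
summation over `j` contradicts `M η < δ` unless `r = 0`. -/
theorem eq_zero_of_row_eigen {M : ℕ} {Λ : Fin M → Fin M → ℂ} {lam : Fin M → ℝ} {δ η ε : ℝ}
    (hη : (M : ℝ) * η < δ) (hε : ∀ j, δ ≤ ε - lam j)
    (hΛ : ∀ i j, ‖Λ i j - if i = j then (lam j : ℂ) else 0‖ ≤ η) {r : Fin M → ℂ}
    (hr : ∀ j, (ε : ℂ) * r j = ∑ i, Λ i j * r i) (j : Fin M) : r j = 0 := by
  have h1 : ∀ j, δ * ‖r j‖ ≤ ∑ i, η * ‖r i‖ := fun j => by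
    have h2 : ((ε - lam j : ℝ) : ℂ) * r j =
        ∑ i, (Λ i j - if i = j then (lam j : ℂ) else 0) * r i := by
      simp only [sub_mul, Finset.sum_sub_distrib, ← hr j, ite_mul, zero_mul, Finset.sum_ite_eq',
        Finset.mem_univ, if_true]
      push_cast; ring
    have h3 := congrArg norm h2
    rw [norm_mul, Complex.norm_real] at h3
    calc δ * ‖r j‖ ≤ ‖ε - lam j‖ * ‖r j‖ :=
          mul_le_mul_of_nonneg_right ((hε j).trans (le_abs_self _)) (norm_nonneg _)
      _ ≤ _ := by
        rw [h3]
        refine (norm_sum_le _ _).trans (Finset.sum_le_sum fun i _ => ?_)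
        rw [norm_mul]
        exact mul_le_mul_of_nonneg_right (hΛ i j) (norm_nonneg _)
  have h4 : δ * ∑ j, ‖r j‖ ≤ M * η * ∑ j, ‖r j‖ := by
    rw [Finset.mul_sum]
    refine (Finset.sum_le_sum fun j _ => h1 j).trans_eq ?_
    rw [Finset.sum_const, Finset.card_univ, Fintype.card_fin, nsmul_eq_mul, ← Finset.mul_sum]
    ring
  have h5 : 0 ≤ ∑ j, ‖r j‖ := Finset.sum_nonneg fun _ _ => norm_nonneg _
  have h6 : ∑ j, ‖r j‖ = 0 := by nlinarith
  exact norm_eq_zero.mp ((Finset.sum_eq_zero_iff_of_nonneg fun _ _ => norm_nonneg _).mp h6 j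
    (Finset.mem_univ _))

theorem IsEigensystem.eq_sum_of_inner_eq_zero {A : Coef b →L[ℂ] Coef b} {k : E d} {e : ℕ → ℝ}
    {x : ℕ → Coef b} (hx : IsEigensystem A k e x) {M : ℕ} {z : Coef b}
    (hz : ∀ n, M ≤ n → inner ℂ (x n) z = 0) :
    z = ∑ n : Fin M, (inner ℂ (x n) z : ℂ) • x n := by
  have h : z - ∑ n : Fin M, (inner ℂ (x n) z : ℂ) • x n ∈ (Submodule.span ℂ (range x))ᗮ := by
    rw [Submodule.mem_orthogonal]
    intro u hu
    induction hu using Submodule.span_induction with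
    | mem u hu =>
      obtain ⟨m, rfl⟩ := hu
      rw [inner_sub_right, inner_sum]
      simp only [inner_smul_right, orthonormal_iff_ite.mp hx.orthonormal]
      by_cases hm : m < M
      · rw [Finset.sum_eq_single ⟨m, hm⟩ (fun i _ hi => by
          rw [if_neg (fun h => hi (Fin.ext h.symm)), mul_zero]) (by simp)]
        simp
      · rw [hz m (not_lt.mp hm), Finset.sum_eq_zero fun i _ => by
          rw [if_neg (fun h : m = i => hm (h ▸ i.2)), mul_zero], sub_zero]
    | zero => simp
    | add u v _ _ hu hv => rw [inner_add_left, hu, hv, add_zero]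
    | smul c u _ hu => rw [inner_smul_left, hu, mul_zero]
  rw [hx.complete, Submodule.mem_bot, sub_eq_zero] at h
  exact h

/-- The low eigenspaces in terms of a frame `X`, with dual coefficients `P`. -/
theorem IsEigensystem.frame_change {A : Coef b →L[ℂ] Coef b}
    (hA : ∀ x y, inner ℂ (A x) y = inner ℂ x (A y)) {k : E d} {e : ℕ → ℝ}
    {x : ℕ → Coef b} (hx : IsEigensystem A k e x) {M : ℕ} {X φ : Fin M → Coef b}
    {Λ : Fin M → Fin M → ℂ} (hX : ∀ j, IsImage A k (X j) (∑ i, Λ i j • X i))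
    (hφ : ∀ i j, inner ℂ (φ i) (X j) = if i = j then (1 : ℂ) else 0)
    {lam : Fin M → ℝ} {δ η : ℝ} (hη : (M : ℝ) * η < δ) (hε : ∀ n, M ≤ n → ∀ j, δ ≤ e n - lam j)
    (hΛ : ∀ i j, ‖Λ i j - if i = j then (lam j : ℂ) else 0‖ ≤ η) :
    ∃ P : Matrix (Fin M) (Fin M) ℂ, (∀ n : Fin M, x n = ∑ j, P j n • X j) ∧
      Matrix.of (fun i j => (inner ℂ (X i) (X j) : ℂ)) * (P * P.conjTranspose) = 1 ∧
      ∑ j, Λ j j = ∑ n : Fin M, (e n : ℂ) := by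
  have hrow : ∀ n j, (e n : ℂ) * inner ℂ (x n) (X j) = ∑ i, Λ i j * inner ℂ (x n) (X i) :=
    fun n j => by
      have h := (hx.eigen n).symm_inner hA (hX j)
      rw [inner_smul_left, Complex.conj_ofReal, inner_sum] at h
      simpa only [inner_smul_right] using h
  -- The inner products of a high eigenvector with the frame form a left eigenvector of `Λ` at an
  -- energy which `Λ`, close to the low energies, does not have. Hence the frame spans exactly the
  -- low eigenspaces.
  have hzero : ∀ n, M ≤ n → ∀ j, inner ℂ (x n) (X j) = (0 : ℂ) := fun n hn =>
    eq_zero_of_row_eigen hη (hε n hn) hΛ (hrow n)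
  let C : Matrix (Fin M) (Fin M) ℂ := Matrix.of fun n j => inner ℂ (x n) (X j)
  let P : Matrix (Fin M) (Fin M) ℂ := Matrix.of fun i n => inner ℂ (φ i) (x n)
  have hXC : ∀ j, X j = ∑ n : Fin M, C n j • x n := fun j =>
    hx.eq_sum_of_inner_eq_zero fun n hn => hzero n hn j
  -- The normalisation against `φ` says that `P` is a left inverse of `C`; for square matrices it is
  -- a two-sided one.
  have hPC : P * C = 1 := by
    ext i j
    rw [Matrix.mul_apply, Matrix.one_apply, ← hφ i j]
    conv_rhs => rw [hXC j, inner_sum]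
    refine Finset.sum_congr rfl fun n _ => ?_
    rw [inner_smul_right, mul_comm]; rfl
  have hCP : C * P = 1 := mul_eq_one_comm.mp hPC
  refine ⟨P, fun n => ?_, ?_, ?_⟩
  · have h1 : ∑ j, P j n • X j = ∑ m : Fin M, (C * P) m n • x m := by
      simp only [Matrix.mul_apply, Finset.sum_smul]
      rw [Finset.sum_comm]
      refine Finset.sum_congr rfl fun j _ => ?_
      conv_lhs => rw [hXC j, Finset.smul_sum]
      refine Finset.sum_congr rfl fun m _ => ?_
      rw [smul_smul, mul_comm]
    rw [h1, hCP]
    simp [Matrix.one_apply, ite_smul]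
  · have hG : Matrix.of (fun i j => (inner ℂ (X i) (X j) : ℂ)) = C.conjTranspose * C := by
      ext i j
      rw [Matrix.of_apply, Matrix.mul_apply]
      conv_lhs => rw [hXC j, inner_sum]
      refine Finset.sum_congr rfl fun n _ => ?_
      rw [inner_smul_right, Matrix.conjTranspose_apply, mul_comm]
      congr 1
      exact (inner_conj_symm _ _).symm
    rw [hG, Matrix.mul_assoc, ← Matrix.mul_assoc C, hCP, Matrix.one_mul,
      ← Matrix.conjTranspose_mul, hPC, Matrix.conjTranspose_one]
  · have h1 : Matrix.diagonal (fun n : Fin M => (e n : ℂ)) * C = C * Matrix.of Λ := by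
      ext n j
      rw [Matrix.diagonal_mul, Matrix.mul_apply]
      exact (hrow n j).trans (Finset.sum_congr rfl fun i _ => mul_comm _ _)
    have h2 : Matrix.of Λ = P * (Matrix.diagonal (fun n : Fin M => (e n : ℂ)) * C) := by
      rw [h1, ← Matrix.mul_assoc, hPC, Matrix.one_mul]
    have h3 := congrArg Matrix.trace h2
    rw [← Matrix.mul_assoc, Matrix.trace_mul_comm, ← Matrix.mul_assoc, hCP, Matrix.one_mul,
      Matrix.trace_diagonal] at h3
    exact h3

theorem exists_gap {e : ℕ → ℝ} (he : Monotone e) {M : ℕ} (h : ∀ j < M, e j < e M) :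
    ∃ γ, γ < e M ∧ ∀ j < M, e j < γ := by
  cases M with
  | zero => exact ⟨e 0 - 1, by linarith, by simp⟩
  | succ M =>
    obtain ⟨γ, h1, h2⟩ := exists_between (h M M.lt_succ_self)
    exact ⟨γ, h2, fun j hj => (he (Nat.lt_succ_iff.mp hj)).trans_lt h1⟩

/-- In terms of the smooth frame, the sum of the low eigenvalues is the trace of `Λ`, and the sum of
`B (α n) (α n)` is the contraction of `B` with the inverse Gram matrix of the frame. Neither sees
which eigenbasis is used, so the formulas hold for every eigensystem at every nearby `k`. -/
theorem exists_smooth_sums (hd : 1 ≤ d) {s : ℝ} (hs : 0 ≤ s) {A : Coef b →L[ℂ] Coef b}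
    (hA : IsPotential s A) (B : Coef b →L[ℝ] Coef b →L[ℝ] Coef b)
    (hB : ∀ (c c' : ℂ) (a a' : Coef b), B (c • a) (c' • a') = (c * conj c') • B a a') {k₀ : E d}
    {M : ℕ} (hgap : ∀ j < M, bandE A j k₀ < bandE A M k₀) :
    ∃ (S : E d → ℝ) (D : E d → Coef b), ContDiffAt ℝ ⊤ S k₀ ∧ ContDiffAt ℝ ⊤ D k₀ ∧
      ∀ᶠ k in 𝓝 k₀, ∀ x α : ℕ → Coef b, IsEigensystem A k (fun n => bandE A n k) x →
        (∀ n, sobScale b (s + 2) (α n) = x n) →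
        S k = ∑ n ∈ Finset.range M, bandE A n k ∧ D k = ∑ n ∈ Finset.range M, B (α n) (α n) := by
  have hs2 : 0 ≤ s + 2 := by linarith
  obtain ⟨W, hW⟩ := hA.exists_lift hs
  obtain ⟨φ, hφ⟩ := exists_bandE_eigensystem hd hA.symm k₀
  obtain ⟨a, Λ, ha, hΛ, hΛ0, hev⟩ := exists_frame hs hA hW hφ hgap
  obtain ⟨γ, hγ, hγ'⟩ := exists_gap (bandE_mono hd hA.symm k₀) hgap
  obtain ⟨γ₂, h12, h2⟩ := exists_between hγ
  set X : E d → Fin M → Coef b := fun k j => sobScale b (s + 2) (a k j) with hX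
  let Gm : E d → Matrix (Fin M) (Fin M) ℂ := fun k => Matrix.of fun i j => inner ℂ (X k i) (X k j)
  have haj : ∀ j, ContDiffAt ℝ ⊤ (fun k => a k j) k₀ := fun j => contDiffAt_pi.mp ha j
  have hΛij : ∀ i j, ContDiffAt ℝ ⊤ (fun k => Λ k i j) k₀ := fun i j =>
    contDiffAt_pi.mp (contDiffAt_pi.mp hΛ i) j
  have hXj : ∀ j, ContDiffAt ℝ ⊤ (fun k => X k j) k₀ := fun j =>
    ((sobScale b (s + 2)).restrictScalars ℝ).contDiff.contDiffAt.comp k₀ (haj j)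
  -- At `k₀` the low bands are below `γ`, and near `k₀` band `M` stays above `γ₂`. An entrywise
  -- tolerance of this size for `Λ` keeps the total perturbation below the width `γ₂ - γ`.
  have hη : (M : ℝ) * ((γ₂ - γ) / (2 * (M + 1))) < γ₂ - γ := by
    have h3 : 0 < γ₂ - γ := by linarith
    have hM : (0 : ℝ) ≤ M := M.cast_nonneg
    rw [← mul_div_assoc, div_lt_iff₀ (by positivity)]
    nlinarith
  have hηpos : 0 < (γ₂ - γ) / (2 * ((M : ℝ) + 1)) := div_pos (by linarith) (by positivity)
  have hevΛ : ∀ᶠ k in 𝓝 k₀, ∀ i j, ‖Λ k i j - if i = j then (bandE A j k₀ : ℂ) else 0‖ ≤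
      (γ₂ - γ) / (2 * ((M : ℝ) + 1)) := by
    simp only [eventually_all]
    intro i j
    have h3 := (hΛij i j).continuousAt.tendsto
    simp only [hΛ0] at h3
    filter_upwards [Metric.tendsto_nhds.mp h3 _ hηpos] with k hk
    rw [dist_eq_norm] at hk
    exact hk.le
  have hevM : ∀ᶠ k in 𝓝 k₀, γ₂ < bandE A M k :=
    (continuous_bandE hd hA.symm M).continuousAt.eventually (lt_mem_nhds h2)
  have key : ∀ᶠ k in 𝓝 k₀, ∀ x : ℕ → Coef b, IsEigensystem A k (fun n => bandE A n k) x →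
      ∃ P : Matrix (Fin M) (Fin M) ℂ, (∀ n : Fin M, x n = ∑ j, P j n • X k j) ∧
      Gm k * (P * P.conjTranspose) = 1 ∧
      ∑ j, Λ k j j = ∑ n : Fin M, (bandE A n k : ℂ) := by
    filter_upwards [hev, hevΛ, hevM] with k h1 h2 h3 x hx
    refine hx.frame_change hA.symm h1.1 h1.2 (lam := fun j => bandE A j k₀) hη
      (fun n hn j => ?_) h2
    have h4 : bandE A M k ≤ bandE A n k := hx.mono hn
    have h5 := hγ' j j.2
    linarith
  have hdet : (Gm k₀).det ≠ 0 := by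
    obtain ⟨P, -, h4, -⟩ := key.self_of_nhds φ hφ
    intro h0
    have := congrArg Matrix.det h4
    rw [Matrix.det_mul, h0] at this
    simp at this
  have hGij : ∀ i j, ContDiffAt ℝ ⊤ (fun k => Gm k i j) k₀ := fun i j => (hXj i).inner ℂ (hXj j)
  refine ⟨fun k => (∑ j, Λ k j j).re, fun k => ∑ j, ∑ l, (Gm k)⁻¹ j l • B (a k j) (a k l),
    ?_, ?_, ?_⟩
  · exact Complex.reCLM.contDiff.contDiffAt.comp k₀ (ContDiffAt.sum fun j _ => hΛij j j)
  · refine ContDiffAt.sum fun j _ => ContDiffAt.sum fun l _ => ?_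
    exact (contDiffAt_matrix_inv hGij hdet j l).smul
      ((B.contDiff.contDiffAt.comp k₀ (haj j)).clm_apply (haj l))
  filter_upwards [key] with k hk x α hx hα
  obtain ⟨P, hP, hGP, hS⟩ := hk x hx
  constructor
  · simp only [hS, Complex.re_sum, Complex.ofReal_re]
    exact Fin.sum_univ_eq_sum_range (fun n => bandE A n k) M
  · have hinv : (Gm k)⁻¹ = P * P.conjTranspose := Matrix.inv_eq_right_inv hGP
    have hαn : ∀ n : Fin M, α n = ∑ j, P j n • a k j := fun n => by
      refine sobScale_injective hs2 ?_
      rw [hα, hP n, map_sum]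
      exact Finset.sum_congr rfl fun j _ => (map_smul _ _ _).symm
    rw [← Fin.sum_univ_eq_sum_range (fun n => B (α n) (α n)) M]
    have h1 : ∀ n : Fin M, B (α n) (α n) =
        ∑ j, ∑ l, (P j n * conj (P l n)) • B (a k j) (a k l) := fun n => by
      rw [hαn n]
      simp only [map_sum, sum_apply, hB]
      exact Finset.sum_comm
    simp only [h1, hinv, Matrix.mul_apply, Finset.sum_smul, Matrix.conjTranspose_apply]
    exact (Finset.sum_congr rfl fun j _ => Finset.sum_comm).trans Finset.sum_comm

end

section

variable {d : ℕ} {b : Module.Basis (Fin d) ℝ (E d)}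

/-! ### Fourier synthesis and the density form -/

theorem summable_norm_sobScale_two (hd : d ≤ 3) (a : Coef b) :
    Summable (fun K : recipLattice b => ‖sobScale b 2 a K‖) ∧
      ∑' K : recipLattice b, ‖sobScale b 2 a K‖ ≤ √(weightSum b).toReal * ‖a‖ := by
  have h1 := sq_tsum_weight_le 0 (sobScale b 2 a : recipLattice b → ℂ)
  simp only [Real.rpow_zero, ENNReal.ofReal_one, one_mul, mul_zero, zero_add] at h1
  have h2 : (∑' K : recipLattice b, ‖sobScale b 2 a K‖ₑ) ^ 2 ≤
      weightSum b * ENNReal.ofReal (‖a‖ ^ 2) := by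
    refine h1.trans ?_
    gcongr
    rw [← sobSq_sobScale_self (σ := 2) (by norm_num)]
    exact sobSq_mono (by norm_num) _
  have hW := weightSum_ne_top b hd
  have h3 : ∑' K : recipLattice b, ‖sobScale b 2 a K‖ₑ ≠ ⊤ := fun h => by
    rw [h, ENNReal.top_pow two_ne_zero, top_le_iff] at h2
    exact ENNReal.mul_ne_top hW ENNReal.ofReal_ne_top h2
  have h4 : Summable (fun K : recipLattice b => ‖sobScale b 2 a K‖) := by
    simpa using ENNReal.summable_toReal h3
  refine ⟨h4, ?_⟩
  have h5 : (∑' K : recipLattice b, ‖sobScale b 2 a K‖ₑ) =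
      ENNReal.ofReal (∑' K : recipLattice b, ‖sobScale b 2 a K‖) := by
    rw [ENNReal.ofReal_tsum_of_nonneg (fun _ => norm_nonneg _) h4]
    simp only [ofReal_norm]
  have h6 : 0 ≤ ∑' K : recipLattice b, ‖sobScale b 2 a K‖ := tsum_nonneg fun _ => norm_nonneg _
  rw [h5, ← ENNReal.ofReal_toReal hW, ← ENNReal.ofReal_mul ENNReal.toReal_nonneg,
    ← ENNReal.ofReal_pow h6, ENNReal.ofReal_le_ofReal_iff (by positivity)] at h2
  refine (pow_le_pow_iff_left₀ h6 (by positivity) two_ne_zero).mp ?_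
  rw [mul_pow, Real.sq_sqrt ENNReal.toReal_nonneg]
  exact h2

theorem norm_planeWave_le (K : E d) : ‖planeWave b K‖ ≤ cellNorm b :=
  (BoundedContinuousFunction.norm_le (cellNorm_pos b).le).mpr fun r =>
    (norm_planeWave_apply b K r).le

theorem summable_synth (hd : d ≤ 3) (a : Coef b) :
    Summable fun K : recipLattice b => ‖sobScale b 2 a K • planeWave b K‖ := by
  refine Summable.of_nonneg_of_le (fun _ => norm_nonneg _) (fun K => ?_)
    ((summable_norm_sobScale_two hd a).1.mul_right (cellNorm b))
  rw [norm_smul]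
  exact mul_le_mul_of_nonneg_left (norm_planeWave_le _) (norm_nonneg _)

/-- The continuous periodic function with given `H²`-coordinates. -/
def synth (b : Module.Basis (Fin d) ℝ (E d)) (hd : d ≤ 3) : Coef b →L[ℂ] (E d →ᵇ ℂ) :=
  LinearMap.mkContinuous
    { toFun := fun a => ∑' K : recipLattice b, sobScale b 2 a K • planeWave b K
      map_add' := fun a a' => by
        rw [← (summable_synth hd a).of_norm.tsum_add (summable_synth hd a').of_norm]
        refine tsum_congr fun K => ?_
        rw [map_add, lp.coeFn_add, Pi.add_apply, add_smul]
      map_smul' := fun c a => by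
        rw [RingHom.id_apply, ← (summable_synth hd a).of_norm.tsum_const_smul c]
        refine tsum_congr fun K => ?_
        rw [map_smul, lp.coeFn_smul, Pi.smul_apply, smul_assoc] }
    (√(weightSum b).toReal * cellNorm b) (fun a => by
      refine (norm_tsum_le_tsum_norm (summable_synth hd a)).trans ?_
      have h := summable_norm_sobScale_two hd a
      calc ∑' K : recipLattice b, ‖sobScale b 2 a K • planeWave b K‖
          ≤ ∑' K : recipLattice b, ‖sobScale b 2 a K‖ * cellNorm b := by
            refine (summable_synth hd a).tsum_le_tsum (fun K => ?_) (h.1.mul_right _)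
            rw [norm_smul]
            exact mul_le_mul_of_nonneg_left (norm_planeWave_le _) (norm_nonneg _)
        _ ≤ √(weightSum b).toReal * ‖a‖ * cellNorm b := by
            rw [tsum_mul_right]
            exact mul_le_mul_of_nonneg_right h.2 (cellNorm_pos b).le
        _ = _ := by ring)

theorem synth_apply (hd : d ≤ 3) (a : Coef b) :
    synth b hd a = ∑' K : recipLattice b, sobScale b 2 a K • planeWave b K := rfl

theorem synth_toLp (hd : d ≤ 3) (a : Coef b) :
    BoundedContinuousFunction.toLp 2 (cellMeasure b) ℂ (synth b hd a) =
      (planeWaveBasis b).repr.symm (sobScale b 2 a) := by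
  have h1 := ((summable_synth hd a).of_norm.hasSum).mapL
    (BoundedContinuousFunction.toLp 2 (cellMeasure b) ℂ)
  have h2 := (planeWaveBasis b).hasSum_repr_symm (sobScale b 2 a)
  rw [← synth_apply] at h1
  refine h1.unique ?_
  simp only [planeWaveBasis_apply] at h2
  simp only [map_smul]
  exact h2

theorem synth_coe_ae (hd : d ≤ 3) {a : Coef b} {u : L2per b}
    (h : (planeWaveBasis b).repr u = sobScale b 2 a) :
    u =ᵐ[cellMeasure b] synth b hd a := by
  have h1 : u = BoundedContinuousFunction.toLp 2 (cellMeasure b) ℂ (synth b hd a) := by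
    rw [synth_toLp, ← h, LinearIsometryEquiv.symm_apply_apply]
  rw [h1]
  exact BoundedContinuousFunction.coeFn_toLp 2 (cellMeasure b) ℂ _

theorem fourierCoeffPer_synth (hd : d ≤ 3) (a : Coef b) (K : recipLattice b) :
    fourierCoeffPer b (synth b hd a) K = sobScale b 2 a K := by
  have h := synth_coe_ae hd (u := (planeWaveBasis b).repr.symm (sobScale b 2 a)) (a := a) (by simp)
  rw [← fourierCoeffPer_congr h, ← planeWaveBasis_repr]
  simp

theorem fourierCoeffPer_synth_neg (hd : d ≤ 3) (a : Coef b) (K : recipLattice b) :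
    fourierCoeffPer b (synth b hd a) (-(K : E d)) = sobScale b 2 a (-K) := by
  rw [← fourierCoeffPer_synth hd a (-K), NegMemClass.coe_neg]

theorem fourierCoeffPer_conj (f : E d → ℂ) (K : E d) :
    fourierCoeffPer b (fun r => conj (f r)) K = conj (fourierCoeffPer b f (-K)) := by
  rw [fourierCoeffPer_eq, fourierCoeffPer_eq, ← integral_conj]
  refine integral_congr_ae (Eventually.of_forall fun r => ?_)
  simp only [conj_planeWave_eq_neg, map_mul, neg_neg]

/-- Fourier coefficients of `u v̄`, in terms of `H²`-coordinates of `u` and `v`. -/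
def densityForm (b : Module.Basis (Fin d) ℝ (E d)) (hd : d ≤ 3) :
    Coef b →L[ℝ] Coef b →L[ℝ] Coef b :=
  ContinuousLinearMap.compL ℝ (Coef b) (E d →ᵇ ℂ) (Coef b)
    (((planeWaveBasis b).repr.toContinuousLinearEquiv.toContinuousLinearMap ∘L
      BoundedContinuousFunction.toLp 2 (cellMeasure b) ℂ).restrictScalars ℝ) ∘L
    (ContinuousLinearMap.mul ℝ (E d →ᵇ ℂ)).bilinearComp ((synth b hd).restrictScalars ℝ)
      ((Complex.conjCLE : ℂ →L[ℝ] ℂ).compLeftContinuousBounded (E d) ∘L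
        (synth b hd).restrictScalars ℝ)

theorem densityForm_apply (hd : d ≤ 3) (a a' : Coef b) (K : recipLattice b) :
    densityForm b hd a a' K =
      fourierCoeffPer b (fun r => synth b hd a r * conj (synth b hd a' r)) K := by
  change (planeWaveBasis b).repr (BoundedContinuousFunction.toLp 2 (cellMeasure b) ℂ
    (synth b hd a * (Complex.conjCLE : ℂ →L[ℝ] ℂ).compLeftContinuousBounded (E d)
      (synth b hd a'))) K = _
  rw [planeWaveBasis_repr]
  exact fourierCoeffPer_congr (BoundedContinuousFunction.coeFn_toLp 2 (cellMeasure b) ℂ _) K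

theorem memLp_boundedContinuous {p : ℝ≥0∞} (f : E d →ᵇ ℂ) : MemLp f p (cellMeasure b) :=
  MemLp.of_bound f.continuous.aestronglyMeasurable ‖f‖ (Eventually.of_forall f.norm_coe_le_norm)

theorem hasSum_densityForm (hd : d ≤ 3) (a a' : Coef b) (K : recipLattice b) :
    HasSum (fun K' : recipLattice b => (cellNorm b : ℂ) * sobScale b 2 a (K - K') *
      starRingEnd ℂ (sobScale b 2 a' (-K'))) (densityForm b hd a a' K) := by
  let g : E d →ᵇ ℂ :=
    (Complex.conjCLE : ℂ →L[ℝ] ℂ).compLeftContinuousBounded (E d) (synth b hd a')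
  let u : L2per b := BoundedContinuousFunction.toLp 2 (cellMeasure b) ℂ g
  have hu : u =ᵐ[cellMeasure b] fun r => conj (synth b hd a' r) :=
    BoundedContinuousFunction.coeFn_toLp 2 (cellMeasure b) ℂ g
  have h := hasSum_fourierCoeffPer_mul b (memLp_boundedContinuous (synth b hd a)) u K
  have e : fourierCoeffPer b (fun r => synth b hd a r * u r) K = densityForm b hd a a' K := by
    have hae : (fun r => synth b hd a r * u r) =ᵐ[cellMeasure b]
        fun r => synth b hd a r * conj (synth b hd a' r) := by
      filter_upwards [hu] with r hr
      rw [hr]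
    rw [densityForm_apply]
    exact fourierCoeffPer_congr hae (K : E d)
  rw [e] at h
  have h2 : ∀ K' : recipLattice b, (cellNorm b : ℂ) * fourierCoeffPer b (synth b hd a)
      ((K - K' : recipLattice b) : E d) * fourierCoeffPer b u K' =
      (cellNorm b : ℂ) * sobScale b 2 a (K - K') * starRingEnd ℂ (sobScale b 2 a' (-K')) := fun K' => by
    rw [fourierCoeffPer_synth, fourierCoeffPer_congr hu, fourierCoeffPer_conj,
      fourierCoeffPer_synth_neg]
  simpa only [h2] using h

/-- The coefficients of `u v̄` are a convolution, and `H^{s+2}` is an algebra because `s + 2 ≥ 2`.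
The density is therefore no less regular than the eigenvectors. -/
theorem exists_densityForm (hd : d ≤ 3) {s : ℝ} (hs : 0 ≤ s) :
    ∃ B : Coef b →L[ℝ] Coef b →L[ℝ] Coef b, ∀ a a',
      sobScale b (s + 2) (B a a') = densityForm b hd (sobScale b s a) (sobScale b s a') := by
  have hM : ∀ a, sobScale b 2 (sobScale b s a) = sobScale b (s + 2) a := fun a => by
    rw [add_comm, sobScale_add (by norm_num) hs]
  have hs2 : 0 ≤ s + 2 := by linarith
  let C : ℝ≥0∞ := 4 * ENNReal.ofReal (4 ^ ((s + 2) / 2)) ^ 2 * weightSum b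
  have hC : C ≠ ⊤ := ENNReal.mul_ne_top (ENNReal.mul_ne_top (by norm_num)
    (ENNReal.pow_ne_top ENNReal.ofReal_ne_top)) (weightSum_ne_top b hd)
  refine exists_lift_bilinear hs2 ((densityForm b hd).bilinearComp
    ((sobScale b s).restrictScalars ℝ) ((sobScale b s).restrictScalars ℝ))
    (C := C * ENNReal.ofReal (cellNorm b ^ 2))
    (ENNReal.mul_ne_top hC ENNReal.ofReal_ne_top) fun a a' => ?_
  change sobSq (s + 2) (densityForm b hd (sobScale b s a) (sobScale b s a')) ≤ _
  have h := sobSq_conv_le_algebra (b := b) (t := s + 2) (by linarith)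
    (y := densityForm b hd (sobScale b s a) (sobScale b s a'))
    (v := fun K => (cellNorm b : ℂ) * sobScale b (s + 2) a K)
    (x := fun K => starRingEnd ℂ (sobScale b (s + 2) a' (-K))) (fun K => by
      have h1 := hasSum_densityForm hd (sobScale b s a) (sobScale b s a') K
      rw [← h1.tsum_eq]
      refine enorm_tsum_le_tsum_enorm.trans_eq (tsum_congr fun K' => ?_)
      rw [enorm_mul, hM, hM])
  refine h.trans ?_
  have h1 : sobSq (b := b) (s + 2) (fun K => (cellNorm b : ℂ) * sobScale b (s + 2) a K) ≤
      ENNReal.ofReal (cellNorm b ^ 2) * ENNReal.ofReal (‖a‖ ^ 2) := by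
    refine (sobSq_smul_le (C := cellNorm b) _ (fun _ => (cellNorm b : ℂ)) (fun _ => ?_) _).trans_eq ?_
    · rw [Complex.norm_real, Real.norm_of_nonneg (cellNorm_pos b).le]
    · rw [sobSq_sobScale_self hs2]
  have h2 : sobSq (b := b) (s + 2) (fun K => starRingEnd ℂ (sobScale b (s + 2) a' (-K))) =
      ENNReal.ofReal (‖a'‖ ^ 2) := by
    rw [← sobSq_sobScale_self hs2]
    refine ((Equiv.neg (recipLattice b)).tsum_eq _).symm.trans (tsum_congr fun K => ?_)
    simp only [Equiv.neg_apply, neg_neg, RCLike.norm_conj, NegMemClass.coe_neg, sobWeight_neg]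
  rw [h2]
  calc C * (sobSq (b := b) (s + 2) (fun K => (cellNorm b : ℂ) * sobScale b (s + 2) a K) *
        ENNReal.ofReal (‖a'‖ ^ 2))
      ≤ C * (ENNReal.ofReal (cellNorm b ^ 2) * ENNReal.ofReal (‖a‖ ^ 2) *
        ENNReal.ofReal (‖a'‖ ^ 2)) := by gcongr
    _ = _ := by rw [ENNReal.ofReal_mul (sq_nonneg _)]; ring

theorem densityForm_smul (hd : d ≤ 3) (c c' : ℂ) (a a' : Coef b) :
    densityForm b hd (c • a) (c' • a') = (c * conj c') • densityForm b hd a a' := by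
  ext K
  have h1 := hasSum_densityForm hd (c • a) (c' • a') K
  have h2 := (hasSum_densityForm hd a a' K).mul_left (c * conj c')
  rw [lp.coeFn_smul, Pi.smul_apply, smul_eq_mul]
  refine h1.unique ?_
  have e : ∀ K' : recipLattice b, (cellNorm b : ℂ) * sobScale b 2 (c • a) (K - K') *
      starRingEnd ℂ (sobScale b 2 (c' • a') (-K')) = c * conj c' * ((cellNorm b : ℂ) *
        sobScale b 2 a (K - K') * starRingEnd ℂ (sobScale b 2 a' (-K'))) := fun K' => by
    simp only [map_smul, lp.coeFn_smul, Pi.smul_apply, smul_eq_mul, map_mul]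
    ring
  simpa only [e] using h2

/-- Translation of the coefficients multiplies `u` by a phase, which `|u|²` does not see. -/
theorem densityForm_shift (hd : d ≤ 3) {a a' : Coef b} (K₀ : recipLattice b)
    (h : sobScale b 2 a' = shiftOp K₀ (sobScale b 2 a)) :
    densityForm b hd a' a' = densityForm b hd a a := by
  ext K
  have h1 := hasSum_densityForm hd a' a' K
  have h2 := (Equiv.subRight K₀).hasSum_iff.mpr (hasSum_densityForm hd a a K)
  refine h1.unique ?_
  have e : ∀ K' : recipLattice b, (cellNorm b : ℂ) * sobScale b 2 a' (K - K') *
      starRingEnd ℂ (sobScale b 2 a' (-K')) = (cellNorm b : ℂ) *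
        sobScale b 2 a (K - (K' - K₀)) * starRingEnd ℂ (sobScale b 2 a (-(K' - K₀))) := fun K' => by
    rw [h, shiftOp_apply, shiftOp_apply, show K - K' + K₀ = K - (K' - K₀) by abel,
      show -K' + K₀ = -(K' - K₀) by abel]
  simp only [e]
  exact h2

/-- The real `L¹` function with given `H^{s+2}`-coordinates. -/
def toDensity (b : Module.Basis (Fin d) ℝ (E d)) (hd : d ≤ 3) (s : ℝ) : Coef b →L[ℝ] L1per b :=
  BoundedContinuousFunction.toLp 1 (cellMeasure b) ℝ ∘L
    (Complex.reCLM.compLeftContinuousBounded (E d) ∘L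
      (synth b hd ∘L sobScale b s).restrictScalars ℝ)

theorem toDensity_coe_ae (hd : d ≤ 3) (s : ℝ) (g : Coef b) :
    toDensity b hd s g =ᵐ[cellMeasure b] fun r => (synth b hd (sobScale b s g) r).re :=
  BoundedContinuousFunction.coeFn_toLp 1 (cellMeasure b) ℝ _

theorem toDensity_eq_absSq (hd : d ≤ 3) {s : ℝ} (hs : 0 ≤ s) {g a : Coef b} {u : L2per b}
    (hu : (planeWaveBasis b).repr u = sobScale b (s + 2) a)
    (hg : sobScale b (s + 2) g = densityForm b hd (sobScale b s a) (sobScale b s a)) :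
    toDensity b hd s g = absSq b u := by
  have hM : ∀ a, sobScale b 2 (sobScale b s a) = sobScale b (s + 2) a := fun a => by
    rw [add_comm, sobScale_add (by norm_num) hs]
  rw [← hM] at hu hg
  have h1 := synth_coe_ae hd hu
  let w : E d →ᵇ ℂ := synth b hd (sobScale b s a) *
    (Complex.conjCLE : ℂ →L[ℝ] ℂ).compLeftContinuousBounded (E d) (synth b hd (sobScale b s a))
  let v : L2per b := BoundedContinuousFunction.toLp 2 (cellMeasure b) ℂ w
  have hv : (planeWaveBasis b).repr v = sobScale b 2 (sobScale b s g) := by rw [hg]; rfl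
  have h2 := synth_coe_ae hd hv
  have h3 : v =ᵐ[cellMeasure b] w := BoundedContinuousFunction.coeFn_toLp 2 (cellMeasure b) ℂ w
  refine Lp.ext ?_
  filter_upwards [toDensity_coe_ae hd s g, (integrable_absSq b u).coeFn_toL1, h1, h2, h3]
    with r e1 e2 e3 e4 e5
  rw [e1, absSq, e2, ← e4, e5, e3]
  change (synth b hd (sobScale b s a) r * conj (synth b hd (sobScale b s a) r)).re = _
  rw [Complex.mul_conj, Complex.normSq_eq_norm_sq, Complex.ofReal_re]

/-- The real part is half the sum of the function and its conjugate. Conjugation reflects the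
coefficients and preserves the weights, so nothing is lost: the constants add up to `2/4 + 2/4 = 1`.
-/
theorem sobolevENorm_toDensity_le (hd : d ≤ 3) {s : ℝ} (hs : 0 ≤ s) (g : Coef b) :
    sobolevENorm b (s + 2) (fun r => ((toDensity b hd s g r : ℝ) : ℂ)) ≤ ENNReal.ofReal ‖g‖ := by
  have hM : ∀ a, sobScale b 2 (sobScale b s a) = sobScale b (s + 2) a := fun a => by
    rw [add_comm, sobScale_add (by norm_num) hs]
  have hs2 : 0 ≤ s + 2 := by linarith
  have hcoef : ∀ K : recipLattice b, fourierCoeffPer b (fun r => ((toDensity b hd s g r : ℝ) : ℂ)) K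
      = (1 / 2 : ℂ) * sobScale b (s + 2) g K + (1 / 2 : ℂ) * starRingEnd ℂ (sobScale b (s + 2) g (-K)) :=
    fun K => by
      set F := synth b hd (sobScale b s g)
      have h1 : fourierCoeffPer b (fun r => ((toDensity b hd s g r : ℝ) : ℂ)) K =
          fourierCoeffPer b (fun r => (1 / 2 : ℂ) * F r + (1 / 2 : ℂ) * conj (F r)) K := by
        have hae : (fun r => ((toDensity b hd s g r : ℝ) : ℂ)) =ᵐ[cellMeasure b]
            fun r => (1 / 2 : ℂ) * F r + (1 / 2 : ℂ) * conj (F r) := by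
          filter_upwards [toDensity_coe_ae hd s g] with r hr
          rw [hr, Complex.re_eq_add_conj]
          ring
        exact fourierCoeffPer_congr hae (K : E d)
      have hi : ∀ f : E d →ᵇ ℂ, Integrable f (cellMeasure b) := fun f =>
        memLp_one_iff_integrable.mp (memLp_boundedContinuous f)
      have h2 : fourierCoeffPer b (fun r => (1 / 2 : ℂ) * F r + (1 / 2 : ℂ) * conj (F r)) K =
          (1 / 2 : ℂ) * fourierCoeffPer b F K +
            (1 / 2 : ℂ) * fourierCoeffPer b (fun r => conj (F r)) K := by
        simp only [fourierCoeffPer_eq]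
        rw [← integral_const_mul, ← integral_const_mul, ← integral_add]
        · refine integral_congr_ae (Eventually.of_forall fun r => ?_)
          simp only
          ring
        · refine Integrable.const_mul ?_ _
          have := hi ((Complex.conjCLE : ℂ →L[ℝ] ℂ).compLeftContinuousBounded (E d)
            (planeWave b K) * F)
          exact this
        · refine Integrable.const_mul ?_ _
          have := hi ((Complex.conjCLE : ℂ →L[ℝ] ℂ).compLeftContinuousBounded (E d)
            (planeWave b K) * (Complex.conjCLE : ℂ →L[ℝ] ℂ).compLeftContinuousBounded (E d) F)
          exact this
      rw [h1, h2, fourierCoeffPer_conj, fourierCoeffPer_synth, fourierCoeffPer_synth_neg, hM]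
  have h3 : sobSq (b := b) (s + 2) (fun K => starRingEnd ℂ (sobScale b (s + 2) g (-K))) =
      ENNReal.ofReal (‖g‖ ^ 2) := by
    rw [← sobSq_sobScale_self hs2]
    refine ((Equiv.neg (recipLattice b)).tsum_eq _).symm.trans (tsum_congr fun K => ?_)
    simp only [Equiv.neg_apply, neg_neg, RCLike.norm_conj, NegMemClass.coe_neg, sobWeight_neg]
  rw [sobolevENorm_eq]
  simp only [hcoef]
  have hhalf : ∀ K : recipLattice b, ‖(1 / 2 : ℂ)‖ ≤ 1 / 2 := fun _ => by norm_num
  have h4 : sobSq (b := b) (s + 2) (fun K => (1 / 2 : ℂ) * sobScale b (s + 2) g K +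
      (1 / 2 : ℂ) * starRingEnd ℂ (sobScale b (s + 2) g (-K))) ≤ ENNReal.ofReal (‖g‖ ^ 2) := by
    refine (sobSq_add_le _ _ _).trans ?_
    have h5 := sobSq_smul_le (b := b) (s + 2) (fun _ => (1 / 2 : ℂ)) hhalf
      (fun K => sobScale b (s + 2) g K)
    have h6 := sobSq_smul_le (b := b) (s + 2) (fun _ => (1 / 2 : ℂ)) hhalf
      (fun K => starRingEnd ℂ (sobScale b (s + 2) g (-K)))
    rw [sobSq_sobScale_self hs2] at h5
    rw [h3] at h6
    refine (add_le_add (mul_le_mul_right h5 2) (mul_le_mul_right h6 2)).trans_eq ?_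
    rw [← mul_assoc, ← add_mul]
    have : (2 : ℝ≥0∞) * ENNReal.ofReal ((1 / 2) ^ 2) + 2 * ENNReal.ofReal ((1 / 2) ^ 2) = 1 := by
      rw [← add_mul, ← ENNReal.ofReal_ofNat, ← ENNReal.ofReal_add (by norm_num) (by norm_num),
        ← ENNReal.ofReal_mul (by norm_num)]
      norm_num
    rw [this, one_mul]
  refine (ENNReal.rpow_le_rpow h4 (by norm_num)).trans_eq ?_
  rw [ENNReal.ofReal_pow (norm_nonneg _), ← ENNReal.rpow_natCast, ← ENNReal.rpow_mul]
  norm_num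

end

section

variable {d : ℕ} {b : Module.Basis (Fin d) ℝ (E d)}

/-! ### Periodic functions and interpolation operators -/

theorem exists_fract (b : Module.Basis (Fin d) ℝ (E d)) (k : E d) :
    ∃ K ∈ recipLattice b, k + K ∈ brillouinZone b := by
  refine ⟨-(ZSpan.floor (recipBasis b) k : E d), neg_mem (ZSpan.floor (recipBasis b) k).2, ?_⟩
  rw [← sub_eq_add_neg]
  exact ZSpan.fract_mem_fundamentalDomain (recipBasis b) k

theorem brillouinZone_isBounded (b : Module.Basis (Fin d) ℝ (E d)) :
    Bornology.IsBounded (brillouinZone b) :=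
  ZSpan.fundamentalDomain_isBounded (recipBasis b)

theorem brillouinZone_measurableSet (b : Module.Basis (Fin d) ℝ (E d)) :
    MeasurableSet (brillouinZone b) :=
  ZSpan.fundamentalDomain_measurableSet (recipBasis b)

theorem brillouinZone_isCompact_closure (b : Module.Basis (Fin d) ℝ (E d)) :
    IsCompact (closure (brillouinZone b)) :=
  (brillouinZone_isBounded b).isCompact_closure

theorem RecipPeriodic.exists_bound {f : E d → ℝ} (hf : Continuous f) (hp : RecipPeriodic b f) :
    ∃ M : ℝ, 0 ≤ M ∧ ∀ k, |f k| ≤ M := by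
  obtain ⟨M, hM⟩ := (brillouinZone_isCompact_closure b).exists_bound_of_continuousOn hf.continuousOn
  refine ⟨max M 0, le_max_right _ _, fun k => ?_⟩
  obtain ⟨K, hK, hk⟩ := exists_fract b k
  rw [← hp K hK k]
  exact (hM _ (subset_closure hk)).trans (le_max_left _ _)

/-- The bounded continuous periodic functions. -/
def periodicBCF (b : Module.Basis (Fin d) ℝ (E d)) : Submodule ℝ (E d →ᵇ ℝ) where
  carrier := {f | RecipPeriodic b f}
  add_mem' := fun hf hg K hK k => by
    exact congrArg₂ (· + ·) (hf K hK k) (hg K hK k)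
  zero_mem' := fun K hK k => rfl
  smul_mem' := fun c f hf K hK k => by
    exact congrArg (c • ·) (hf K hK k)

theorem periodicBCF_isClosed (b : Module.Basis (Fin d) ℝ (E d)) :
    IsClosed (periodicBCF b : Set (E d →ᵇ ℝ)) := by
  have : (periodicBCF b : Set (E d →ᵇ ℝ)) =
      ⋂ K ∈ recipLattice b, ⋂ k, {f : E d →ᵇ ℝ | f (k + K) = f k} := by
    ext f
    simp only [mem_iInter]
    rfl
  rw [this]
  refine isClosed_biInter fun K _ => isClosed_iInter fun k => isClosed_eq ?_ ?_
  · exact continuous_eval_const _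
  · exact continuous_eval_const _

theorem exists_uniform_bound_of_pointwise {X Y : Type*} [NormedAddCommGroup X] [NormedSpace ℝ X]
    [CompleteSpace X] [NormedAddCommGroup Y] [NormedSpace ℝ Y] (T : ℕ → X →ₗ[ℝ] Y)
    (hT : ∀ L, ∃ C : ℝ, ∀ x, ‖T L x‖ ≤ C * ‖x‖) (hpt : ∀ x, ∃ C, ∀ L, ‖T L x‖ ≤ C) :
    ∃ B : ℝ, ∀ L x, ‖T L x‖ ≤ B * ‖x‖ := by
  choose C hC using hT
  obtain ⟨B, hB⟩ := banach_steinhaus (g := fun L => (T L).mkContinuous (C L) (hC L)) hpt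
  exact ⟨B, fun L x => (((T L).mkContinuous (C L) (hC L)).le_opNorm x).trans
    (mul_le_mul_of_nonneg_right (hB L) (norm_nonneg _))⟩

theorem BZOperator.abs_toLin_le (P : BZOperator b) (f : periodicBCF b) (k : E d) :
    |P.toLin f k| ≤ P.bounded.choose * ‖f.1‖ :=
  P.bounded.choose_spec f f.1.continuous f.2 ‖f.1‖ (fun k => f.1.norm_coe_le_norm k) k

/-- A Brillouin zone operator on the Banach space of periodic functions. -/
def BZOperator.toBCF (P : BZOperator b) : periodicBCF b →ₗ[ℝ] (E d →ᵇ ℝ) where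
  toFun f := BoundedContinuousFunction.ofNormedAddCommGroup
    (P.toLin f) (P.continuous_map f f.1.continuous f.2) (P.bounded.choose * ‖f.1‖)
    (P.abs_toLin_le f)
  map_add' f g := by
    ext k
    exact congrFun (P.toLin.map_add f g) k
  map_smul' c f := by
    ext k
    exact congrFun (P.toLin.map_smul c f) k

theorem BZOperator.toBCF_apply (P : BZOperator b) (f : periodicBCF b) (k : E d) :
    P.toBCF f k = P.toLin f k := rfl

theorem BZOperator.exists_norm_toBCF_le (P : BZOperator b) :
    ∃ C : ℝ, ∀ f : periodicBCF b, ‖P.toBCF f‖ ≤ C * ‖f‖ := by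
  refine ⟨|P.bounded.choose|, fun f => ?_⟩
  change _ ≤ _ * ‖f.1‖
  refine (BoundedContinuousFunction.norm_le (by positivity)).mpr fun k => ?_
  exact (P.abs_toLin_le f k).trans (mul_le_mul_of_nonneg_right (le_abs_self _) (norm_nonneg _))

theorem IsInterpolationOfOrder.exists_norm_toBCF_le {P : ℕ → BZOperator b} {p : ℕ}
    (hP : IsInterpolationOfOrder b P p) (f : periodicBCF b) :
    ∃ C : ℝ, ∀ L, ‖(P L).toBCF f‖ ≤ C := by
  have h1 := Metric.tendstoUniformly_iff.mp (hP.strong f f.1.continuous f.2) 1 one_pos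
  obtain ⟨L₀, hL₀⟩ := eventually_atTop.mp h1
  refine ⟨‖f.1‖ + 1 + ∑ L ∈ Finset.range L₀, ‖(P L).toBCF f‖, fun L => ?_⟩
  have h2 : 0 ≤ ∑ L ∈ Finset.range L₀, ‖(P L).toBCF f‖ := Finset.sum_nonneg fun _ _ => norm_nonneg _
  rcases lt_or_ge L L₀ with h | h
  · have h3 := Finset.single_le_sum (f := fun L => ‖(P L).toBCF f‖) (fun _ _ => norm_nonneg _)
      (Finset.mem_range.mpr h)
    have h4 := norm_nonneg f.1
    linarith
  · refine (BoundedContinuousFunction.norm_le (by positivity)).mpr fun k => ?_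
    rw [BZOperator.toBCF_apply]
    have h3 := (hL₀ L h k).le
    rw [dist_comm, dist_eq_norm] at h3
    have h4 := f.1.norm_coe_le_norm k
    have h5 : ‖(P L).toLin f k‖ ≤ ‖(P L).toLin f k - f.1 k‖ + ‖f.1 k‖ := by
      simpa using norm_add_le ((P L).toLin f k - f.1 k) (f.1 k)
    linarith

/-- Banach-Steinhaus: strong convergence bounds every orbit, and the periodic functions form a
Banach space, being closed among the bounded continuous ones. -/
theorem IsInterpolationOfOrder.exists_toBCF_bound {P : ℕ → BZOperator b} {p : ℕ}
    (hP : IsInterpolationOfOrder b P p) :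
    ∃ B : ℝ, ∀ L (f : periodicBCF b), ‖(P L).toBCF f‖ ≤ B * ‖f‖ := by
  have : CompleteSpace (periodicBCF b) := (periodicBCF_isClosed b).completeSpace_coe
  have h1 := @exists_uniform_bound_of_pointwise (periodicBCF b) (E d →ᵇ ℝ) _ _ this _ _
  have h2 := h1 (fun L => (P L).toBCF)
  have h3 := h2 (fun L => (P L).exists_norm_toBCF_le)
  exact h3 hP.exists_norm_toBCF_le

/-- Strongly convergent interpolation operators are uniformly bounded. -/
theorem IsInterpolationOfOrder.exists_uniform_bound {P : ℕ → BZOperator b} {p : ℕ}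
    (hP : IsInterpolationOfOrder b P p) :
    ∃ B : ℝ, 1 ≤ B ∧ ∀ (L : ℕ) (f : E d → ℝ), Continuous f → RecipPeriodic b f →
      ∀ M : ℝ, (∀ k, |f k| ≤ M) → ∀ k, |(P L).toLin f k| ≤ B * M := by
  obtain ⟨B, hB⟩ := hP.exists_toBCF_bound
  refine ⟨max B 1, le_max_right _ _, fun L f hf hp M hM k => ?_⟩
  have hM0 : 0 ≤ M := (abs_nonneg _).trans (hM 0)
  let f' : periodicBCF b := ⟨BoundedContinuousFunction.ofNormedAddCommGroup f hf M hM, hp⟩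
  have h1 : ‖f'.1‖ ≤ M := BoundedContinuousFunction.norm_ofNormedAddCommGroup_le hf hM0 hM
  calc |(P L).toLin f k| = ‖(P L).toBCF f' k‖ := rfl
    _ ≤ ‖(P L).toBCF f'‖ := BoundedContinuousFunction.norm_coe_le_norm _ _
    _ ≤ B * ‖f'.1‖ := hB L f'
    _ ≤ max B 1 * M := mul_le_mul (le_max_left _ _) h1 (norm_nonneg _)
        (zero_le_one.trans (le_max_right _ _))

/-! ### Distance to a translate of the reciprocal lattice -/

/-- The distance from `k` to `x + ℛ*`. -/
def latDist (b : Module.Basis (Fin d) ℝ (E d)) (x k : E d) : ℝ :=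
  Metric.infDist (k - x) (recipLattice b : Set (E d))

theorem latDist_lt_iff {x k : E d} {r : ℝ} :
    latDist b x k < r ↔ ∃ K ∈ recipLattice b, ‖k + K - x‖ < r := by
  rw [latDist, Metric.infDist_lt_iff ⟨0, zero_mem _⟩]
  constructor
  · rintro ⟨K, hK, h⟩
    refine ⟨-K, neg_mem hK, ?_⟩
    rwa [dist_eq_norm, show k - x - K = k + -K - x by abel] at h
  · rintro ⟨K, hK, h⟩
    refine ⟨-K, neg_mem hK, ?_⟩
    rwa [dist_eq_norm, show k - x - -K = k + K - x by abel]

theorem latDist_le_norm (x k : E d) : latDist b x k ≤ ‖k - x‖ := by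
  have := Metric.infDist_le_dist_of_mem (x := k - x) (zero_mem (recipLattice b) : (0 : E d) ∈ _)
  simpa [latDist] using this

theorem continuous_latDist (x : E d) : Continuous (latDist b x) :=
  (Metric.continuous_infDist_pt _).comp (continuous_id.sub continuous_const)

theorem latDist_periodic (x : E d) : RecipPeriodic b (latDist b x) := by
  have key : ∀ K ∈ recipLattice b, ∀ k r, latDist b x k < r → latDist b x (k + K) < r := by
    intro K hK k r h
    obtain ⟨K', hK', h'⟩ := latDist_lt_iff.mp h
    refine latDist_lt_iff.mpr ⟨K' - K, sub_mem hK' hK, ?_⟩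
    rwa [show k + K + (K' - K) - x = k + K' - x by abel]
  intro K hK k
  refine le_antisymm (le_of_forall_gt fun r hr => key K hK k r hr) (le_of_forall_gt fun r hr => ?_)
  have := key (-K) (neg_mem hK) (k + K) r hr
  rwa [add_neg_cancel_right] at this

theorem latDist_pos {x k : E d} (h : k - x ∉ recipLattice b) : 0 < latDist b x k := by
  have : DiscreteTopology (recipLattice b).toAddSubgroup := recipLattice_discreteTopology b
  have hc : IsClosed ((recipLattice b).toAddSubgroup : Set (E d)) :=
    AddSubgroup.isClosed_of_discrete
  exact (hc.notMem_iff_infDist_pos ⟨0, zero_mem _⟩).mp h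

theorem latDist_comm (x k : E d) : latDist b x k = latDist b k x := by
  have key : ∀ x k r, latDist b x k < r → latDist b k x < r := by
    intro x k r h
    obtain ⟨K, hK, h'⟩ := latDist_lt_iff.mp h
    refine latDist_lt_iff.mpr ⟨-K, neg_mem hK, ?_⟩
    rwa [← norm_neg, show -(x + -K - k) = k + K - x by abel]
  exact le_antisymm (le_of_forall_gt fun r hr => key k x r hr)
    (le_of_forall_gt fun r hr => key x k r hr)

theorem latDist_triangle (x y z : E d) : latDist b x z ≤ latDist b x y + latDist b y z := by
  refine le_of_forall_pos_le_add fun ε hε => ?_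
  obtain ⟨K, hK, h⟩ := latDist_lt_iff.mp (lt_add_of_pos_right (latDist b x y) (half_pos hε))
  obtain ⟨K', hK', h'⟩ := latDist_lt_iff.mp (lt_add_of_pos_right (latDist b y z) (half_pos hε))
  refine (latDist_lt_iff.mpr ⟨K + K', add_mem hK hK', ?_⟩).le
  have h2 := norm_add_le (z + K' - y) (y + K - x)
  rw [show z + K' - y + (y + K - x) = z + (K + K') - x by abel] at h2
  linarith

/-- A continuous periodic cutoff around `x + ℛ*`. -/
def latCutoff (b : Module.Basis (Fin d) ℝ (E d)) (x : E d) (r r' : ℝ) (k : E d) : ℝ :=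
  max 0 (min 1 ((r' - latDist b x k) / (r' - r)))

theorem continuous_latCutoff (x : E d) (r r' : ℝ) : Continuous (latCutoff b x r r') :=
  continuous_const.max (continuous_const.min
    ((continuous_const.sub (continuous_latDist x)).div_const _))

theorem latCutoff_periodic (x : E d) (r r' : ℝ) : RecipPeriodic b (latCutoff b x r r') :=
  fun K hK k => by rw [latCutoff, latDist_periodic x K hK k]; rfl

theorem latCutoff_eq_one {x k : E d} {r r' : ℝ} (hr : r < r') (h : latDist b x k ≤ r) :
    latCutoff b x r r' k = 1 := by
  have : 1 ≤ (r' - latDist b x k) / (r' - r) := by rw [one_le_div (by linarith)]; linarith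
  rw [latCutoff, min_eq_left this, max_eq_right zero_le_one]

theorem latCutoff_eq_zero {x k : E d} {r r' : ℝ} (hr : r < r') (h : r' ≤ latDist b x k) :
    latCutoff b x r r' k = 0 := by
  have : (r' - latDist b x k) / (r' - r) ≤ 0 :=
    div_nonpos_of_nonpos_of_nonneg (by linarith) (by linarith)
  rw [latCutoff, max_eq_left ((min_le_right _ _).trans this)]

/-! ### Local error estimates for nodal rules -/

/-- Apply the operator to a bump that is one at the node `k_j` and zero at the other nodes: the
result is the weight `φ_j`. The bump vanishes near the ball, so the error estimate there has
right-hand side zero, and `φ_j` vanishes on the ball. The threshold in `L` does not depend on the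
node. -/
theorem NodalRule.weight_eq_zero {P : ℕ → BZOperator b} {p : ℕ}
    (hP : IsInterpolationOfOrder b P p) {R : ℕ → NodalRule b}
    (hR : ∀ L, 1 ≤ L → (R L).Represents (P L)) (k₀ : E d) {r : ℝ} (hr : 0 < r) :
    ∃ L₀ : ℕ, ∀ L, 1 ≤ L → L₀ ≤ L → ∀ j, 2 * r ≤ latDist b k₀ ((R L).node j) →
      ∀ k ∈ Metric.ball k₀ r, (R L).weight j k = 0 := by
  obtain ⟨C, L₀, hC⟩ := hP.order (r / 2) (by positivity)
  refine ⟨L₀, fun L hL1 hL j hj k hk => ?_⟩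
  -- The radius of the bump may depend on `L` and on the node without harm, because the error bound
  -- is multiplied by a derivative that is identically zero.
  obtain ⟨ρ, hρ, hρr, hρn⟩ : ∃ ρ : ℝ, 0 < ρ ∧ ρ ≤ r / 2 ∧
      ∀ i, i ≠ j → ρ ≤ latDist b ((R L).node j) ((R L).node i) := by
    have h1 : ∀ i, ∃ ρ : ℝ, 0 < ρ ∧ (i ≠ j → ρ ≤ latDist b ((R L).node j) ((R L).node i)) := by
      intro i
      by_cases h : i = j
      · exact ⟨1, one_pos, fun h' => absurd h h'⟩
      · exact ⟨_, latDist_pos fun h' => h ((R L).node_distinct i j h'), fun _ => le_rfl⟩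
    choose ρ hρ hρ' using h1
    obtain ⟨ρ₀, h2, h3⟩ : ∃ ρ₀ : ℝ, 0 < ρ₀ ∧ ∀ i, ρ₀ ≤ ρ i := by
      have hne : Nonempty (Fin (R L).m) := ⟨j⟩
      obtain ⟨i₀, hi₀⟩ := Finite.exists_min ρ
      exact ⟨ρ i₀, hρ i₀, hi₀⟩
    exact ⟨min (r / 2) ρ₀, lt_min (by positivity) h2, min_le_left _ _,
      fun i hi => (min_le_right _ _).trans ((h3 i).trans (hρ' i hi))⟩
  set f := latCutoff b ((R L).node j) 0 ρ with hf
  have hfc : Continuous f := continuous_latCutoff _ _ _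
  have hfp : RecipPeriodic b f := latCutoff_periodic _ _ _
  have hf0 : ∀ k' ∈ Metric.thickening (r / 2) (Metric.ball k₀ r), f k' = 0 := fun k' hk' => by
    refine latCutoff_eq_zero hρ ?_
    obtain ⟨z, hz, hz'⟩ := Metric.mem_thickening_iff.mp hk'
    have h1 := latDist_triangle (b := b) k₀ k' ((R L).node j)
    rw [Metric.mem_ball, dist_eq_norm] at hz
    rw [dist_eq_norm] at hz'
    have h2 : latDist b k₀ k' < 3 / 2 * r := by
      refine (latDist_le_norm k₀ k').trans_lt ?_
      have := norm_add_le (k' - z) (z - k₀)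
      rw [sub_add_sub_cancel] at this
      linarith
    rw [latDist_comm]
    linarith
  have hfd : ContDiffOn ℝ ((0 + 1 : ℕ) : WithTop ℕ∞) f
      (Metric.thickening (r / 2) (Metric.ball k₀ r)) :=
    contDiffOn_const (c := (0 : ℝ)).congr hf0
  have hder : ∀ k' ∈ Metric.thickening (r / 2) (Metric.ball k₀ r),
      ‖iteratedFDeriv ℝ (0 + 1) f k'‖ ≤ 0 := fun k' hk' => by
    have h1 : f =ᶠ[𝓝 k'] fun _ => 0 :=
      eventually_of_mem (Metric.isOpen_thickening.mem_nhds hk') hf0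
    rw [(h1.iteratedFDeriv ℝ (0 + 1)).self_of_nhds]
    simp
  have h1 := hC L hL1 hL 0 (Nat.zero_le _) (Metric.ball k₀ r) Metric.isOpen_ball f hfc hfp hfd 0
    hder k hk
  rw [mul_zero, hf0 k (Metric.self_subset_thickening (by positivity) _ hk), zero_sub, abs_neg] at h1
  have h2 : (P L).toLin f k = 0 := abs_eq_zero.mp (le_antisymm h1 (abs_nonneg _))
  rw [hR L hL1 f hfc hfp, NodalRule.apply, Finset.sum_eq_single j] at h2
  · rwa [hf, latCutoff_eq_one hρ, smul_eq_mul, mul_one] at h2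
    have := latDist_le_norm (b := b) ((R L).node j) ((R L).node j)
    simpa using this
  · intro i _ hi
    rw [hf, latCutoff_eq_zero hρ (hρn i hi), smul_zero]
  · simp

end

/-! ### Localised interpolation errors, and uniform growth of the bands -/

section

variable {d : ℕ} {b : Module.Basis (Fin d) ℝ (E d)}

theorem thickening_ball_subset (k₀ : E d) (r η : ℝ) :
    Metric.thickening η (Metric.ball k₀ r) ⊆ Metric.ball k₀ (r + η) := by
  intro k hk
  obtain ⟨z, hz, hz'⟩ := Metric.mem_thickening_iff.mp hk
  rw [Metric.mem_ball] at hz ⊢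
  have := dist_triangle k z k₀
  linarith

theorem continuous_cutoff_smul {F : Type*} [NormedAddCommGroup F] [NormedSpace ℝ F]
    {D : E d → F} {k₀ : E d} {r : ℝ} (hr : 0 < r) (hD : ContinuousOn D (Metric.ball k₀ (4 * r)))
    (hper : ∀ k ∈ Metric.ball k₀ (4 * r), ∀ K ∈ recipLattice b, D (k + K) = D k) :
    Continuous fun k => latCutoff b k₀ (2 * r) (3 * r) k • D k := by
  rw [continuous_iff_continuousAt]
  intro k
  rcases lt_or_ge (latDist b k₀ k) (4 * r) with h | h
  · obtain ⟨K, hK, hk⟩ := latDist_lt_iff.mp h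
    refine (continuous_latCutoff _ _ _).continuousAt.smul ?_
    have hmem : k + K ∈ Metric.ball k₀ (4 * r) := mem_ball_iff_norm.mpr hk
    have h1 : ContinuousAt (fun k' => D (k' + K)) k :=
      ContinuousAt.comp (f := fun k' => k' + K) (g := D)
        (hD.continuousAt (Metric.isOpen_ball.mem_nhds hmem)) (by fun_prop)
    refine h1.congr ?_
    have h2 : ∀ᶠ k' in 𝓝 k, k' + K ∈ Metric.ball k₀ (4 * r) :=
      (continuous_id.add continuous_const).continuousAt.eventually
        (Metric.isOpen_ball.mem_nhds hmem)
    filter_upwards [h2] with k' hk'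
    have h3 := hper _ hk' (-K) (neg_mem hK)
    rw [add_neg_cancel_right] at h3
    exact h3.symm
  · have h1 : (fun k => latCutoff b k₀ (2 * r) (3 * r) k • D k) =ᶠ[𝓝 k] fun _ => 0 := by
      have h2 : ∀ᶠ k' in 𝓝 k, 3 * r < latDist b k₀ k' :=
        (continuous_latDist k₀).continuousAt.eventually (lt_mem_nhds (by linarith))
      filter_upwards [h2] with k' hk'
      rw [latCutoff_eq_zero (by linarith) hk'.le, zero_smul]
    exact continuousAt_const.congr h1.symm

/-- `D` is only controlled around `k₀ + ℛ*`, so the estimate is applied to the globally continuous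
`χ D`, where the cutoff `χ` is one within distance `2r`. Nodes farther away have zero weight on the
ball of radius `r`, so the rule does not distinguish `χ D` from `D` there. -/
theorem NodalRule.local_error {F : Type*} [NormedAddCommGroup F] [NormedSpace ℝ F]
    {P : ℕ → BZOperator b} {p : ℕ}
    (hP : IsInterpolationOfOrder b P p) {R : ℕ → NodalRule b}
    (hR : ∀ L, 1 ≤ L → (R L).Represents (P L)) {D : E d → F} {k₀ : E d} {r : ℝ} (hr : 0 < r)
    (hD : ContDiffOn ℝ ((p + 1 : ℕ) : WithTop ℕ∞) D (Metric.ball k₀ (4 * r))) {M : ℝ}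
    (hM : ∀ k ∈ Metric.ball k₀ (2 * r), ‖iteratedFDeriv ℝ (p + 1) D k‖ ≤ M)
    (hper : ∀ k ∈ Metric.ball k₀ (4 * r), ∀ K ∈ recipLattice b, D (k + K) = D k) :
    ∃ (C : ℝ) (L₀ : ℕ), 0 ≤ C ∧ ∀ L : ℕ, 1 ≤ L → L₀ ≤ L → ∀ k ∈ Metric.ball k₀ r,
      ‖D k - (R L).apply D k‖ ≤ C / (L : ℝ) ^ (p + 1) := by
  obtain ⟨C, L₁, hC⟩ := hP.order r hr
  obtain ⟨L₂, hw⟩ := NodalRule.weight_eq_zero hP hR k₀ hr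
  have hM0 : 0 ≤ M := (norm_nonneg _).trans (hM k₀ (Metric.mem_ball_self (by linarith)))
  refine ⟨|C| * M, max L₁ L₂, by positivity, fun L hL hL' k hk => ?_⟩
  have hLpos : (0 : ℝ) < L := by exact_mod_cast hL
  -- The hypothesis concerns real functions; a vector-valued error is bounded by testing with
  -- continuous functionals, with a constant proportional to `‖ℓ‖`.
  refine NormedSpace.norm_le_dual_bound ℝ _ (by positivity) fun ℓ => ?_
  set χ := latCutoff b k₀ (2 * r) (3 * r) with hχ
  let f : E d → ℝ := fun k => ℓ (χ k • D k)
  have hfc : Continuous f := ℓ.continuous.comp (continuous_cutoff_smul hr hD.continuousOn hper)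
  have hfp : RecipPeriodic b f := by
    intro K hK k
    rcases lt_or_ge (latDist b k₀ k) (4 * r) with h | h
    · obtain ⟨K', hK', hk'⟩ := latDist_lt_iff.mp h
      have hmem : k + K' ∈ Metric.ball k₀ (4 * r) := mem_ball_iff_norm.mpr hk'
      have h1 := hper _ hmem (K - K') (sub_mem hK hK')
      have h2 := hper _ hmem (-K') (neg_mem hK')
      rw [show k + K' + (K - K') = k + K by abel] at h1
      rw [add_neg_cancel_right] at h2
      simp only [f, hχ]
      rw [latCutoff_periodic _ _ _ K hK k, h1, h2]
    · have h0 : χ k = 0 := latCutoff_eq_zero (by linarith) (by linarith)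
      simp only [f]
      rw [hχ, latCutoff_periodic _ _ _ K hK k, ← hχ, h0, zero_smul, zero_smul]
  have hχ1 : ∀ k, latDist b k₀ k < 2 * r → χ k = 1 := fun k h =>
    latCutoff_eq_one (by linarith) h.le
  have hsub : Metric.thickening r (Metric.ball k₀ r) ⊆ Metric.ball k₀ (2 * r) := by
    rw [two_mul]; exact thickening_ball_subset k₀ r r
  have hfD : ∀ k ∈ Metric.ball k₀ (2 * r), f k = ℓ (D k) := fun k hk => by
    simp only [f]
    rw [hχ1 k ((latDist_le_norm k₀ k).trans_lt (mem_ball_iff_norm.mp hk)), one_smul]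
  have h42 : Metric.ball k₀ (2 * r) ⊆ Metric.ball k₀ (4 * r) :=
    Metric.ball_subset_ball (by linarith)
  have hfd : ContDiffOn ℝ ((p + 1 : ℕ) : WithTop ℕ∞) f (Metric.thickening r (Metric.ball k₀ r)) :=
    (ℓ.contDiff.comp_contDiffOn (hD.mono (hsub.trans h42))).congr fun k hk => hfD k (hsub hk)
  have hder : ∀ k ∈ Metric.thickening r (Metric.ball k₀ r),
      ‖iteratedFDeriv ℝ (p + 1) f k‖ ≤ ‖ℓ‖ * M := fun k hk => by
    have h1 : f =ᶠ[𝓝 k] ℓ ∘ D :=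
      eventually_of_mem (Metric.isOpen_ball.mem_nhds (hsub hk)) hfD
    have h2 : ContDiffAt ℝ ((p + 1 : ℕ) : WithTop ℕ∞) D k :=
      hD.contDiffAt (Metric.isOpen_ball.mem_nhds (h42 (hsub hk)))
    rw [(h1.iteratedFDeriv ℝ (p + 1)).self_of_nhds, ℓ.iteratedFDeriv_comp_left h2 le_rfl]
    exact (ℓ.norm_compContinuousMultilinearMap_le _).trans
      (mul_le_mul_of_nonneg_left (hM k (hsub hk)) (norm_nonneg _))
  have h1 := hC L hL ((le_max_left _ _).trans hL') p le_rfl (Metric.ball k₀ r) Metric.isOpen_ball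
    f hfc hfp hfd _ hder k hk
  have h2 : (P L).toLin f k = ℓ ((R L).apply D k) := by
    rw [hR L hL f hfc hfp, NodalRule.apply, NodalRule.apply, map_sum]
    refine Finset.sum_congr rfl fun j _ => ?_
    rw [map_smul]
    rcases lt_or_ge (latDist b k₀ ((R L).node j)) (2 * r) with h | h
    · simp only [f]
      rw [hχ1 _ h, one_smul]
    · rw [hw L hL ((le_max_right _ _).trans hL') j h k hk, zero_smul, zero_smul]
  rw [hfD k (Metric.ball_subset_ball (by linarith) hk), h2, ← map_sub] at h1
  refine h1.trans ?_
  calc C / (L : ℝ) ^ (p + 1) * (‖ℓ‖ * M) ≤ |C| / (L : ℝ) ^ (p + 1) * (‖ℓ‖ * M) := by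
        gcongr
        exact le_abs_self C
    _ = _ := by ring

theorem BZOperator.local_error {P : ℕ → BZOperator b} {p : ℕ}
    (hP : IsInterpolationOfOrder b P p) {f : E d → ℝ} (hf : Continuous f) (hper : RecipPeriodic b f)
    {k₀ : E d} {r : ℝ} (hr : 0 < r)
    (hD : ContDiffOn ℝ ((p + 1 : ℕ) : WithTop ℕ∞) f (Metric.ball k₀ (4 * r))) {M : ℝ}
    (hM : ∀ k ∈ Metric.ball k₀ (2 * r), ‖iteratedFDeriv ℝ (p + 1) f k‖ ≤ M) :
    ∃ (C : ℝ) (L₀ : ℕ), 0 ≤ C ∧ ∀ L : ℕ, 1 ≤ L → L₀ ≤ L → ∀ k ∈ Metric.ball k₀ r,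
      |f k - (P L).toLin f k| ≤ C / (L : ℝ) ^ (p + 1) := by
  obtain ⟨C, L₁, hC⟩ := hP.order r hr
  have hM0 : 0 ≤ M := (norm_nonneg _).trans (hM k₀ (Metric.mem_ball_self (by linarith)))
  have hsub : Metric.thickening r (Metric.ball k₀ r) ⊆ Metric.ball k₀ (2 * r) := by
    rw [two_mul]; exact thickening_ball_subset k₀ r r
  refine ⟨|C| * M, L₁, by positivity, fun L hL hL' k hk => ?_⟩
  have hLpos : (0 : ℝ) < L := by exact_mod_cast hL
  refine (hC L hL hL' p le_rfl (Metric.ball k₀ r) Metric.isOpen_ball f hf hper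
    (hD.mono (hsub.trans (Metric.ball_subset_ball (by linarith)))) M
    (fun k hk => hM k (hsub hk)) k hk).trans ?_
  calc C / (L : ℝ) ^ (p + 1) * M ≤ |C| / (L : ℝ) ^ (p + 1) * M := by
        gcongr
        exact le_abs_self C
    _ = _ := by ring

/-! ### Families of bands -/

/-- The properties of the energy bands on which the analysis of the Brillouin zone integrals is
based. -/
structure IsBandFamily (b : Module.Basis (Fin d) ℝ (E d)) (e : ℕ → E d → ℝ) : Prop where
  mono : ∀ k, Monotone fun n => e n k
  cont : ∀ n, Continuous (e n)
  per : ∀ n, RecipPeriodic b (e n)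
  compare : ∃ c : ℝ, (∀ n k, 0 ≤ e n k + c) ∧ ∀ n k k', ∀ θ : ℝ, 0 < θ →
    e n k' + c ≤ (1 + θ) * (e n k + c) + (1 + 1 / θ) * (‖k' - k‖ ^ 2 / 2)
  unbounded : ∀ l, ∃ n₀, ∀ n, n₀ ≤ n → l < e n 0

/-- By periodicity `k` may be taken in the Brillouin zone, at bounded distance from `0`; the
comparison in both directions then bounds the oscillation by an arbitrarily small fraction of the
height of the band, up to a constant independent of `n`. -/
theorem IsBandFamily.exists_oscillation {e : ℕ → E d → ℝ} (he : IsBandFamily b e) :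
    ∃ c : ℝ, (∀ n k, 0 ≤ e n k + c) ∧ ∀ θ : ℝ, 0 < θ → ∃ C : ℝ, ∀ n k,
      |e n k - e n 0| ≤ θ * (e n 0 + c) + C := by
  obtain ⟨c, hc, h⟩ := he.compare
  obtain ⟨ρ, hρ⟩ := (brillouinZone_isBounded b).exists_norm_le
  refine ⟨c, hc, fun θ hθ => ⟨(1 + 1 / θ) * (ρ ^ 2 / 2), fun n k => ?_⟩⟩
  obtain ⟨K, hK, hk⟩ := exists_fract b k
  rw [← he.per n K hK k]
  have h1 := h n 0 (k + K) θ hθ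
  have h2 := h n (k + K) 0 θ hθ
  rw [sub_zero] at h1
  rw [zero_sub, norm_neg] at h2
  have h3 : ‖k + K‖ ^ 2 ≤ ρ ^ 2 := pow_le_pow_left₀ (norm_nonneg _) (hρ _ hk) 2
  have h4 : (1 + 1 / θ) * (‖k + K‖ ^ 2 / 2) ≤ (1 + 1 / θ) * (ρ ^ 2 / 2) := by gcongr
  have h5 := hc n (k + K)
  have h6 := hc n 0
  have h7 : 0 ≤ (1 + 1 / θ) * (ρ ^ 2 / 2) := by positivity
  rw [abs_le]
  constructor
  · by_contra! h8
    have h9 : (1 + θ) * (e n (k + K) + c) <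
        (1 + θ) * ((1 - θ) * (e n 0 + c) - (1 + 1 / θ) * (ρ ^ 2 / 2)) := by
      refine mul_lt_mul_of_pos_left ?_ (by linarith)
      linarith
    nlinarith [mul_nonneg (sq_nonneg θ) h6, mul_nonneg hθ.le h7]
  · linarith

theorem BZOperator.map_sub_const (P : BZOperator b) (f : E d → ℝ) (c : ℝ) (k : E d) :
    P.toLin (fun k => f k - c) k = P.toLin f k - c := by
  have h := congrFun (P.toLin.map_sub f (fun _ => c)) k
  rw [P.map_const] at h
  exact h

/-- Constants are reproduced, so interpolating `e n` amounts to interpolating its deviation from `e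
n 0`, which costs the uniform norm `B` times the oscillation. High bands therefore remain high for
all `L` simultaneously. -/
theorem IsBandFamily.exists_lt_interp {e : ℕ → E d → ℝ} (he : IsBandFamily b e)
    {P : ℕ → BZOperator b} {p : ℕ} (hP : IsInterpolationOfOrder b P p) (l : ℝ) :
    ∃ n₀ : ℕ, ∀ n, n₀ ≤ n → ∀ k, l < e n k ∧ ∀ L, l < (P L).toLin (e n) k := by
  obtain ⟨B, hB1, hB⟩ := hP.exists_uniform_bound
  obtain ⟨c, hc, hosc⟩ := he.exists_oscillation
  have hBpos : 0 < B := by linarith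
  -- With this fraction the deviation, even amplified by `B`, uses at most half of the height of the
  -- band.
  obtain ⟨C, hC⟩ := hosc (1 / (2 * B)) (by positivity)
  obtain ⟨n₀, hn₀⟩ := he.unbounded (2 * (|l| + |c| + B * |C|) + |c|)
  refine ⟨n₀, fun n hn k => ?_⟩
  have h1 := hn₀ n hn
  have h2 : B * (1 / (2 * B) * (e n 0 + c) + C) = (e n 0 + c) / 2 + B * C := by field_simp
  have h3 : B * C ≤ B * |C| := by gcongr; exact le_abs_self C
  have h4 := le_abs_self l
  have h5 := neg_abs_le c
  have h5' := le_abs_self c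
  have h6 : 0 ≤ 1 / (2 * B) * (e n 0 + c) + C := (abs_nonneg _).trans (hC n k)
  constructor
  · have h7 := (abs_le.mp (hC n k)).1
    have h8 : 1 / (2 * B) * (e n 0 + c) + C ≤ B * (1 / (2 * B) * (e n 0 + c) + C) :=
      le_mul_of_one_le_left h6 hB1
    linarith
  · intro L
    have h7 := hB L (fun k => e n k - e n 0) ((he.cont n).sub continuous_const)
      (fun K hK k => by simp only [he.per n K hK k]) _ (hC n) k
    rw [BZOperator.map_sub_const] at h7
    have h8 := (abs_le.mp h7).1
    linarith

end

section

variable {d : ℕ} {b : Module.Basis (Fin d) ℝ (E d)}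

/-! ### Local estimates around a quasi-momentum -/

theorem exists_ball_of_contDiffAt {F : Type*} [NormedAddCommGroup F] [NormedSpace ℝ F]
    {D : E d → F} {k₀ : E d} (hD : ContDiffAt ℝ ⊤ D k₀) (m : ℕ) {U : Set (E d)} (hU : U ∈ 𝓝 k₀) :
    ∃ r : ℝ, 0 < r ∧ Metric.ball k₀ (4 * r) ⊆ U ∧
      ContDiffOn ℝ (m : WithTop ℕ∞) D (Metric.ball k₀ (4 * r)) ∧
      ∃ M : ℝ, ∀ k ∈ Metric.ball k₀ (4 * r), ‖iteratedFDeriv ℝ m D k‖ ≤ M ∧ ‖D k‖ ≤ M := by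
  have h1 : ∀ᶠ k in 𝓝 k₀, ContDiffAt ℝ (m : WithTop ℕ∞) D k :=
    (hD.of_le le_top).eventually (by simp)
  have h2 : ContinuousAt (iteratedFDeriv ℝ m D) k₀ :=
    (hD.iteratedFDeriv_right (m := 0) (i := m) le_top).continuousAt
  have h3 := h2.norm.eventually (gt_mem_nhds (lt_add_one _))
  have h4 := hD.continuousAt.norm.eventually (gt_mem_nhds (lt_add_one _))
  obtain ⟨ρ, hρ, h5⟩ := Metric.eventually_nhds_iff_ball.mp
    (h1.and (h3.and (h4.and (eventually_mem_set.mpr hU))))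
  refine ⟨ρ / 4, by positivity, ?_⟩
  rw [show 4 * (ρ / 4) = ρ by ring]
  exact ⟨fun k hk => (h5 k hk).2.2.2, fun k hk => (h5 k hk).1.contDiffWithinAt,
    max (‖iteratedFDeriv ℝ m D k₀‖ + 1) (‖D k₀‖ + 1), fun k hk =>
    ⟨(h5 k hk).2.1.le.trans (le_max_left _ _), (h5 k hk).2.2.1.le.trans (le_max_right _ _)⟩⟩

theorem NodalRule.exists_nhds_error {F : Type*} [NormedAddCommGroup F] [NormedSpace ℝ F]
    {P : ℕ → BZOperator b} {p : ℕ}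
    (hP : IsInterpolationOfOrder b P p) {R : ℕ → NodalRule b}
    (hR : ∀ L, 1 ≤ L → (R L).Represents (P L)) {D : E d → F} {k₀ : E d}
    (hD : ContDiffAt ℝ ⊤ D k₀)
    (hper : ∀ᶠ k in 𝓝 k₀, ∀ K ∈ recipLattice b, D (k + K) = D k) :
    ∃ U ∈ 𝓝 k₀, ∃ (C : ℝ) (L₀ : ℕ), 0 ≤ C ∧ ∀ k ∈ U, ‖D k‖ ≤ C ∧
      ∀ L : ℕ, 1 ≤ L → L₀ ≤ L → ‖D k - (R L).apply D k‖ ≤ C / (L : ℝ) ^ (p + 1) := by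
  obtain ⟨r, hr, hsub, h1, M, hM⟩ := exists_ball_of_contDiffAt hD (p + 1) hper
  obtain ⟨C, L₀, hC, h2⟩ := NodalRule.local_error hP hR hr h1
    (fun k hk => (hM k (Metric.ball_subset_ball (by linarith) hk)).1) (fun k hk => hsub hk)
  have hM0 : 0 ≤ M := (norm_nonneg _).trans (hM k₀ (Metric.mem_ball_self (by linarith))).1
  refine ⟨Metric.ball k₀ r, Metric.ball_mem_nhds _ hr, C + M, L₀, by positivity, fun k hk =>
    ⟨(hM k (Metric.ball_subset_ball (by linarith) hk)).2.trans (by linarith),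
      fun L hL hL' => (h2 L hL hL' k hk).trans ?_⟩⟩
  gcongr
  linarith

theorem BZOperator.exists_nhds_error {P : ℕ → BZOperator b} {p : ℕ}
    (hP : IsInterpolationOfOrder b P p) {f : E d → ℝ} (hf : Continuous f) (hper : RecipPeriodic b f)
    {k₀ : E d} (hD : ContDiffAt ℝ ⊤ f k₀) :
    ∃ U ∈ 𝓝 k₀, ∃ (C : ℝ) (L₀ : ℕ), 0 ≤ C ∧ ∀ k ∈ U, ‖f k‖ ≤ C ∧
      ∀ L : ℕ, 1 ≤ L → L₀ ≤ L → ‖f k - (P L).toLin f k‖ ≤ C / (L : ℝ) ^ (p + 1) := by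
  obtain ⟨r, hr, -, h1, M, hM⟩ := exists_ball_of_contDiffAt hD (p + 1) univ_mem
  obtain ⟨C, L₀, hC, h2⟩ := BZOperator.local_error hP hf hper hr h1
    (fun k hk => (hM k (Metric.ball_subset_ball (by linarith) hk)).1)
  have hM0 : 0 ≤ M := (norm_nonneg _).trans (hM k₀ (Metric.mem_ball_self (by linarith))).1
  refine ⟨Metric.ball k₀ r, Metric.ball_mem_nhds _ hr, C + M, L₀, by positivity, fun k hk =>
    ⟨(hM k (Metric.ball_subset_ball (by linarith) hk)).2.trans (by linarith),
      fun L hL hL' => (h2 L hL hL' k hk).trans ?_⟩⟩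
  gcongr
  linarith

/-- Around a point where the differential does not vanish, thin level shells have small measure. -/
theorem exists_volume_shell_le {f : E d → ℝ} (hf : Continuous f) {f' : E d →L[ℝ] ℝ} {k₀ : E d}
    (hf' : HasStrictFDerivAt f f' k₀) (h0 : f' ≠ 0) :
    ∃ U ∈ 𝓝 k₀, ∃ C : ℝ, 0 ≤ C ∧ ∀ ε t : ℝ, 0 < t →
      volume (U ∩ {k | |f k - ε| ≤ t}) ≤ ENNReal.ofReal (C * t) := by
  obtain ⟨v, hv⟩ : ∃ v, 0 < f' v := by
    by_contra! h
    refine h0 (ContinuousLinearMap.ext fun v => le_antisymm (h v) ?_)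
    have := h (-v)
    rw [map_neg] at this
    change 0 ≤ f' v
    linarith
  have hv0 : 0 < ‖v‖ := norm_pos_iff.mpr fun h => by simp [h] at hv
  set a := f' v with ha
  -- This tolerance leaves at least half of the slope `a` of `f` along `v`, throughout the ball.
  have h1 := (hasStrictFDerivAt_iff_isLittleO.mp hf').def (c := a / (2 * ‖v‖)) (by positivity)
  obtain ⟨ρ, hρ, h2⟩ := Metric.eventually_nhds_iff_ball.mp h1
  have key : ∀ k ∈ Metric.ball k₀ ρ, ∀ τ : ℝ, 0 ≤ τ → k + τ • v ∈ Metric.ball k₀ ρ →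
      f k + a / 2 * τ ≤ f (k + τ • v) := by
    intro k hk τ hτ hk'
    have h3 := h2 (k + τ • v, k) (by
      rw [← ball_prod_same]; exact ⟨hk', hk⟩)
    simp only [add_sub_cancel_left, map_smul, smul_eq_mul, norm_smul] at h3
    rw [Real.norm_eq_abs, Real.norm_of_nonneg hτ] at h3
    have h4 : a / (2 * ‖v‖) * (τ * ‖v‖) = a / 2 * τ := by field_simp
    rw [h4] at h3
    have h5 := (abs_le.mp h3).1
    rw [← ha] at h5
    nlinarith
  set V := volume.real (Metric.ball k₀ ρ) with hV
  have hVt : volume (Metric.ball k₀ ρ) = ENNReal.ofReal V :=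
    (ENNReal.ofReal_toReal Metric.isBounded_ball.measure_lt_top.ne).symm
  set σ := ρ / (2 * ‖v‖) with hσ
  have hσpos : 0 < σ := by positivity
  refine ⟨Metric.ball k₀ (ρ / 2), Metric.ball_mem_nhds _ (by positivity), 6 * V / (a * σ),
    by positivity, fun ε t ht => ?_⟩
  set A := Metric.ball k₀ (ρ / 2) ∩ {k | |f k - ε| ≤ t} with hA
  have hAm : MeasurableSet A := Metric.isOpen_ball.measurableSet.inter
    (isClosed_le (by fun_prop) continuous_const).measurableSet
  -- Packing argument: a translation by `(6t/a) v` raises `f` by at least `3t`, more than the width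
  -- `2t` of the shell. The `J + 1` translates of `A` are therefore disjoint, and they stay in the
  -- ball of radius `ρ` since the total displacement is at most `σ ‖v‖ = ρ / 2`.
  set J := ⌊σ * a / (6 * t)⌋₊ with hJ
  have hJ1 : (J : ℝ) * (6 * t / a) ≤ σ := by
    have := Nat.floor_le (a := σ * a / (6 * t)) (by positivity)
    rw [← hJ, le_div_iff₀ (by positivity)] at this
    rw [← mul_div_assoc, div_le_iff₀ hv]
    exact this
  have hJ2 : σ * a / (6 * t) ≤ J + 1 := (Nat.lt_floor_add_one _).le
  let τ : ℕ → ℝ := fun j => j * (6 * t / a)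
  let T : ℕ → Set (E d) := fun j => (fun k => k + (-(τ j • v))) ⁻¹' A
  have hτ0 : ∀ j, 0 ≤ τ j := fun j => by positivity
  have hball : ∀ j ≤ J, ∀ k ∈ A, k + τ j • v ∈ Metric.ball k₀ ρ := by
    intro j hj k hk
    have h3 : τ j ≤ σ := by
      refine le_trans ?_ hJ1
      simp only [τ]
      gcongr
    have h4 : ‖τ j • v‖ ≤ ρ / 2 := by
      rw [norm_smul, Real.norm_of_nonneg (hτ0 j)]
      calc τ j * ‖v‖ ≤ σ * ‖v‖ := by gcongr
        _ = ρ / 2 := by rw [hσ]; field_simp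
    have h5 := mem_ball_iff_norm.mp hk.1
    rw [mem_ball_iff_norm, add_sub_right_comm]
    exact (norm_add_le _ _).trans_lt (by linarith)
  have hT : ∀ j ≤ J, T j ⊆ Metric.ball k₀ ρ := fun j hj k hk => by
    have := hball j hj _ hk
    rwa [neg_add_cancel_right] at this
  have hdisj : ∀ i ≤ J, ∀ j ≤ J, i < j → Disjoint (T i) (T j) := by
    intro i hi j hj hij
    rw [Set.disjoint_left]
    intro k hki hkj
    have hki' : k + -(τ i • v) ∈ A := hki
    have hkj' : k + -(τ j • v) ∈ A := hkj
    have h3 := key (k + -(τ j • v)) (Metric.ball_subset_ball (by linarith) hkj'.1) (τ j - τ i)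
      (by
        simp only [τ, sub_nonneg]
        gcongr)
      (by
        rw [sub_smul, show k + -(τ j • v) + (τ j • v - τ i • v) = k + -(τ i • v) by abel]
        exact Metric.ball_subset_ball (by linarith) hki'.1)
    rw [sub_smul, show k + -(τ j • v) + (τ j • v - τ i • v) = k + -(τ i • v) by abel] at h3
    have hki2 : |f (k + -(τ i • v)) - ε| ≤ t := hki'.2
    have hkj2 : |f (k + -(τ j • v)) - ε| ≤ t := hkj'.2
    have h4 := (abs_le.mp hki2).2
    have h5 := (abs_le.mp hkj2).1
    have h6 : 6 * t / a ≤ τ j - τ i := by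
      have h7 : (i : ℝ) + 1 ≤ j := by exact_mod_cast hij
      simp only [τ]
      rw [← sub_mul]
      exact le_mul_of_one_le_left (by positivity) (by linarith)
    have h8 : a / 2 * (6 * t / a) = 3 * t := by field_simp; norm_num
    have h9 : a / 2 * (6 * t / a) ≤ a / 2 * (τ j - τ i) := by gcongr
    linarith
  have hvol : ∀ j, volume (T j) = volume A := fun j =>
    measure_preimage_add_right volume (-(τ j • v)) A
  have hsum : ∑ j ∈ Finset.range (J + 1), volume (T j) ≤ volume (Metric.ball k₀ ρ) := by
    rw [← measure_biUnion_finset]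
    · refine measure_mono (iUnion₂_subset fun j hj => hT j ?_)
      exact Nat.lt_succ_iff.mp (Finset.mem_range.mp hj)
    · intro i hi j hj hij
      have hi' := Nat.lt_succ_iff.mp (Finset.mem_range.mp hi)
      have hj' := Nat.lt_succ_iff.mp (Finset.mem_range.mp hj)
      rcases lt_or_gt_of_ne hij with h | h
      · exact hdisj i hi' j hj' h
      · exact (hdisj j hj' i hi' h).symm
    · intro j _
      exact (measurable_id.add_const _) hAm
  simp only [hvol, Finset.sum_const, Finset.card_range, nsmul_eq_mul] at hsum
  have hAfin : volume A ≠ ⊤ :=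
    ((measure_mono inter_subset_left).trans_lt Metric.isBounded_ball.measure_lt_top).ne
  rw [hVt, ← ENNReal.ofReal_toReal hAfin, ← ENNReal.ofReal_natCast, ← ENNReal.ofReal_mul
    (Nat.cast_nonneg _), ENNReal.ofReal_le_ofReal_iff measureReal_nonneg] at hsum
  rw [← ENNReal.ofReal_toReal hAfin]
  refine ENNReal.ofReal_le_ofReal ?_
  push_cast at hsum
  set α := (volume A).toReal
  have hα : 0 ≤ α := ENNReal.toReal_nonneg
  have h10 : σ * a / (6 * t) * α ≤ V := (mul_le_mul_of_nonneg_right hJ2 hα).trans hsum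
  rw [div_mul_eq_mul_div, div_le_iff₀ (by positivity)] at h10
  rw [div_mul_eq_mul_div, le_div_iff₀ (by positivity)]
  linarith

end

section

variable {d : ℕ} {b : Module.Basis (Fin d) ℝ (E d)}

/-! ### Uniform estimates near a regular Fermi surface -/

/-- The bands are smooth, isolated and without critical points at the level `εF`. -/
structure HasRegularFermiSurface (e : ℕ → E d → ℝ) (εF : ℝ) : Prop where
  isolated : ∀ n m k, n ≠ m → e n k = εF → e m k ≠ εF
  smooth : ∀ n k, e n k = εF → ContDiffAt ℝ ⊤ (e n) k
  noncritical : ∀ n k, e n k = εF → fderiv ℝ (e n) k ≠ 0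

/-- One integer `m` serves at once as error constant, as threshold for `L` and, through `1 / (m +
1)`, as distance to the Fermi level. All estimates weaken as `m` grows, so local values combine into
a global one by compactness. -/
theorem _root_.IsCompact.exists_nat_of_locally {X : Type*} [TopologicalSpace X] {s : Set X}
    (hs : IsCompact s) {Pr : ℕ → X → Prop} (hmono : ∀ m m' x, m ≤ m' → Pr m x → Pr m' x)
    (hloc : ∀ x ∈ s, ∃ U ∈ 𝓝 x, ∃ m, ∀ y ∈ U, Pr m y) : ∃ m, ∀ x ∈ s, Pr m x := by
  refine hs.induction_on (p := fun t => ∃ m, ∀ x ∈ t, Pr m x) ⟨0, by simp⟩ ?_ ?_ ?_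
  · rintro t t' htt' ⟨m, hm⟩
    exact ⟨m, fun x hx => hm x (htt' hx)⟩
  · rintro t t' ⟨m, hm⟩ ⟨m', hm'⟩
    refine ⟨max m m', fun x hx => ?_⟩
    rcases hx with hx | hx
    · exact hmono _ _ _ (le_max_left _ _) (hm x hx)
    · exact hmono _ _ _ (le_max_right _ _) (hm' x hx)
  · intro x hx
    obtain ⟨U, hU, m, hm⟩ := hloc x hx
    exact ⟨U, mem_nhdsWithin_of_mem_nhds hU, m, hm⟩

theorem exists_nat_of_finite {Pr : ℕ → ℕ → Prop} (hmono : ∀ m m' n, m ≤ m' → Pr m n → Pr m' n)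
    {n₀ : ℕ} (h : ∀ n < n₀, ∃ m, Pr m n) : ∃ m, ∀ n < n₀, Pr m n := by
  choose! f hf using h
  exact ⟨(Finset.range n₀).sup f, fun n hn =>
    hmono _ _ _ (Finset.le_sup (Finset.mem_range.mpr hn)) (hf n hn)⟩

theorem exists_nat_parameters (C : ℝ) (L₀ : ℕ) {δ : ℝ} (hδ : 0 < δ) :
    ∃ m : ℕ, C ≤ m ∧ L₀ ≤ m ∧ 1 / ((m : ℝ) + 1) ≤ δ := by
  obtain ⟨m₁, h₁⟩ := exists_nat_ge C
  obtain ⟨m₂, h₂⟩ := exists_nat_one_div_lt hδ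
  refine ⟨max m₁ (max L₀ m₂), h₁.trans ?_, ?_, le_trans ?_ h₂.le⟩
  · exact_mod_cast le_max_left _ _
  · exact (le_max_left _ _).trans (le_max_right _ _)
  · have : (m₂ : ℝ) ≤ (max m₁ (max L₀ m₂) : ℕ) := by
      exact_mod_cast (le_max_right _ _).trans (le_max_right _ _)
    gcongr

theorem one_div_nat_add_one_anti {m m' : ℕ} (h : m ≤ m') :
    1 / ((m' : ℝ) + 1) ≤ 1 / ((m : ℝ) + 1) := by
  have : (m : ℝ) ≤ m' := by exact_mod_cast h
  gcongr

/-- A value `x` and an approximation `y` are on the same side of `ε`, away from it, or `y` is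
`h`-close to `x`. -/
def IsTracked (ε δ h x y : ℝ) : Prop :=
  (x ≤ ε - δ ∧ y ≤ ε - δ / 2) ∨ (ε + δ ≤ x ∧ ε + δ / 2 ≤ y) ∨ |y - x| ≤ h

theorem IsTracked.mono {ε δ δ' h h' x y : ℝ} (H : IsTracked ε δ h x y) (hδ : δ' ≤ δ)
    (hh : h ≤ h') : IsTracked ε δ' h' x y := by
  rcases H with H | H | H
  · exact Or.inl ⟨by linarith [H.1], by linarith [H.2]⟩
  · exact Or.inr (Or.inl ⟨by linarith [H.1], by linarith [H.2]⟩)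
  · exact Or.inr (Or.inr (H.trans hh))

/-- On the Fermi surface the band is smooth, and the full order `q + 1` is available. Away from it,
uniform convergence suffices to keep the interpolated band on the same side, even if the band is not
smooth there. -/
theorem IsBandFamily.exists_isTracked_nhds {e : ℕ → E d → ℝ} (he : IsBandFamily b e) {εF : ℝ}
    (hF : HasRegularFermiSurface e εF) {Q : ℕ → BZOperator b} {q : ℕ}
    (hQ : IsInterpolationOfOrder b Q q) (n : ℕ) (k₀ : E d) :
    ∃ U ∈ 𝓝 k₀, ∃ m : ℕ, ∀ k ∈ U, ∀ L : ℕ, 1 ≤ L → m ≤ L →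
      IsTracked εF (1 / ((m : ℝ) + 1)) (m / (L : ℝ) ^ (q + 1)) (e n k) ((Q L).toLin (e n) k) := by
  by_cases h0 : e n k₀ = εF
  · obtain ⟨U, hU, C, L₀, -, h1⟩ :=
      BZOperator.exists_nhds_error hQ (he.cont n) (he.per n) (hF.smooth n k₀ h0)
    obtain ⟨m, hm1, hm2, -⟩ := exists_nat_parameters C L₀ one_pos
    refine ⟨U, hU, m, fun k hk L hL hL' => Or.inr (Or.inr ?_)⟩
    have h2 := (h1 k hk).2 L hL (hm2.trans hL')
    rw [Real.norm_eq_abs, abs_sub_comm] at h2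
    exact h2.trans (by gcongr)
  · set η := |e n k₀ - εF| / 2 with hη
    have hηpos : 0 < η := by
      have := abs_pos.mpr (sub_ne_zero.mpr h0)
      positivity
    have h1 : ∀ᶠ k in 𝓝 k₀, |e n k - e n k₀| < η := by
      have := Metric.continuousAt_iff'.mp ((he.cont n).continuousAt (x := k₀)) η hηpos
      exact this
    obtain ⟨L₀, h2⟩ := eventually_atTop.mp
      (Metric.tendstoUniformly_iff.mp (hQ.strong _ (he.cont n) (he.per n)) (η / 2) (by positivity))
    obtain ⟨m, -, hm2, hm3⟩ := exists_nat_parameters 0 L₀ hηpos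
    refine ⟨_, h1, m, fun k hk L hL hL' => ?_⟩
    have h3 := h2 L (hm2.trans hL') k
    rw [dist_comm, Real.dist_eq] at h3
    have h4 : |e n k - e n k₀| < η := hk
    have h5 := abs_lt.mp h3
    have h6 := abs_lt.mp h4
    rcases abs_cases (e n k₀ - εF) with ⟨h7, h8⟩ | ⟨h7, h8⟩
    · exact Or.inr (Or.inl ⟨by linarith, by linarith⟩)
    · exact Or.inl ⟨by linarith, by linarith⟩

/-- The interpolated bands track the exact ones, with the full order near the Fermi surface. -/
theorem IsBandFamily.exists_isTracked {e : ℕ → E d → ℝ} (he : IsBandFamily b e) {εF : ℝ}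
    (hF : HasRegularFermiSurface e εF) {Q : ℕ → BZOperator b} {q : ℕ}
    (hQ : IsInterpolationOfOrder b Q q) :
    ∃ m : ℕ, ∀ k ∈ closure (brillouinZone b), ∀ n, ∀ L : ℕ, 1 ≤ L → m ≤ L →
      IsTracked εF (1 / ((m : ℝ) + 1)) (m / (L : ℝ) ^ (q + 1)) (e n k) ((Q L).toLin (e n) k) := by
  have hmono : ∀ (m m' n : ℕ) (k : E d), m ≤ m' → (∀ L : ℕ, 1 ≤ L → m ≤ L →
      IsTracked εF (1 / ((m : ℝ) + 1)) (m / (L : ℝ) ^ (q + 1)) (e n k) ((Q L).toLin (e n) k)) →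
      (∀ L : ℕ, 1 ≤ L → m' ≤ L →
      IsTracked εF (1 / ((m' : ℝ) + 1)) (m' / (L : ℝ) ^ (q + 1)) (e n k) ((Q L).toLin (e n) k)) :=
    fun m m' n k hmm h L hL hL' => (h L hL (hmm.trans hL')).mono (one_div_nat_add_one_anti hmm)
      (by gcongr)
  obtain ⟨n₀, hn₀⟩ := he.exists_lt_interp hQ (εF + 1)
  obtain ⟨m, hm⟩ := exists_nat_of_finite (n₀ := n₀) (Pr := fun m n => ∀ k ∈ closure (brillouinZone b),
      ∀ L : ℕ, 1 ≤ L → m ≤ L →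
      IsTracked εF (1 / ((m : ℝ) + 1)) (m / (L : ℝ) ^ (q + 1)) (e n k) ((Q L).toLin (e n) k))
    (fun m m' n hmm h k hk => hmono m m' n k hmm (h k hk)) (fun n _ =>
      (brillouinZone_isCompact_closure b).exists_nat_of_locally (fun m m' k => hmono m m' n k)
        fun k _ => he.exists_isTracked_nhds hF hQ n k)
  refine ⟨m, fun k hk n L hL hL' => ?_⟩
  rcases lt_or_ge n n₀ with h | h
  · exact hm n h k hk L hL hL'
  · have h1 := hn₀ n h k
    have h2 : 1 / ((m : ℝ) + 1) ≤ 1 := by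
      rw [div_le_one (by positivity)]
      linarith [(Nat.cast_nonneg m : (0 : ℝ) ≤ m)]
    have h3 : 0 < 1 / ((m : ℝ) + 1) := by positivity
    exact Or.inr (Or.inl ⟨by linarith [h1.1], by linarith [h1.2 L]⟩)

theorem exists_volume_band_shell_nhds {e : E d → ℝ} (he : Continuous e) {εF : ℝ} (k₀ : E d)
    (hs : e k₀ = εF → ContDiffAt ℝ ⊤ e k₀) (hc : e k₀ = εF → fderiv ℝ e k₀ ≠ 0) :
    ∃ U ∈ 𝓝 k₀, ∃ m : ℕ, ∀ t : ℝ, 0 < t → t < 1 / ((m : ℝ) + 1) →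
      volume (U ∩ {k | |e k - εF| ≤ t}) ≤ ENNReal.ofReal (m * t) := by
  by_cases h0 : e k₀ = εF
  · have h1 : HasStrictFDerivAt e (fderiv ℝ e k₀) k₀ := (hs h0).hasStrictFDerivAt (by simp)
    obtain ⟨U, hU, C, -, h2⟩ := exists_volume_shell_le he h1 (hc h0)
    obtain ⟨m, hm⟩ := exists_nat_ge C
    exact ⟨U, hU, m, fun t ht _ => (h2 εF t ht).trans (ENNReal.ofReal_le_ofReal (by gcongr))⟩
  · have hη : 0 < |e k₀ - εF| := abs_pos.mpr (sub_ne_zero.mpr h0)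
    obtain ⟨m, hm⟩ := exists_nat_one_div_lt hη
    have h1 : ∀ᶠ k in 𝓝 k₀, 1 / ((m : ℝ) + 1) < |e k - εF| :=
      (he.sub continuous_const).abs.continuousAt.eventually (lt_mem_nhds hm)
    refine ⟨_, h1, m, fun t _ ht => ?_⟩
    have h2 : {k | 1 / ((m : ℝ) + 1) < |e k - εF|} ∩ {k | |e k - εF| ≤ t} = ∅ := by
      ext k
      simp only [mem_inter_iff, mem_ofPred_eq, mem_empty_iff_false, iff_false, not_and, not_le]
      intro h
      linarith
    rw [h2]
    simp

theorem volume_union_shell_le {s s' : Set (E d)} {m m' : ℕ} {a : Set (E d)} {t : ℝ} (ht : 0 < t)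
    (h : volume (s ∩ a) ≤ ENNReal.ofReal (m * t)) (h' : volume (s' ∩ a) ≤ ENNReal.ofReal (m' * t)) :
    volume ((s ∪ s') ∩ a) ≤ ENNReal.ofReal ((m + m' : ℕ) * t) := by
  rw [union_inter_distrib_right]
  refine (measure_union_le _ _).trans ((add_le_add h h').trans ?_)
  rw [← ENNReal.ofReal_add (by positivity) (by positivity)]
  push_cast
  rw [add_mul]

theorem exists_volume_band_shell {e : E d → ℝ} (he : Continuous e) {εF : ℝ}
    (hs : ∀ k, e k = εF → ContDiffAt ℝ ⊤ e k) (hc : ∀ k, e k = εF → fderiv ℝ e k ≠ 0)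
    {s : Set (E d)} (hcomp : IsCompact s) :
    ∃ m : ℕ, ∀ t : ℝ, 0 < t → t < 1 / ((m : ℝ) + 1) →
      volume (s ∩ {k | |e k - εF| ≤ t}) ≤ ENNReal.ofReal (m * t) := by
  refine hcomp.induction_on (p := fun s => ∃ m : ℕ, ∀ t : ℝ, 0 < t → t < 1 / ((m : ℝ) + 1) →
      volume (s ∩ {k | |e k - εF| ≤ t}) ≤ ENNReal.ofReal (m * t)) ⟨0, by simp⟩ ?_ ?_ ?_
  · rintro s s' hss ⟨m, hm⟩
    exact ⟨m, fun t h1 h2 => (measure_mono (inter_subset_inter_left _ hss)).trans (hm t h1 h2)⟩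
  · rintro s s' ⟨m, hm⟩ ⟨m', hm'⟩
    refine ⟨m + m', fun t h1 h2 => ?_⟩
    exact volume_union_shell_le h1 (hm t h1 (h2.trans_le (one_div_nat_add_one_anti (by omega))))
      (hm' t h1 (h2.trans_le (one_div_nat_add_one_anti (by omega))))
  · intro k _
    obtain ⟨U, hU, m, hm⟩ := exists_volume_band_shell_nhds he k (hs k) (hc k)
    exact ⟨U, mem_nhdsWithin_of_mem_nhds hU, m, hm⟩

/-- The energy shells around a regular Fermi surface have a measure proportional to their width. -/
theorem IsBandFamily.exists_volume_shell {e : ℕ → E d → ℝ} (he : IsBandFamily b e) {εF : ℝ}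
    (hF : HasRegularFermiSurface e εF) {n₀ : ℕ} (hn₀ : ∀ n, n₀ ≤ n → ∀ k, εF + 1 < e n k) :
    ∃ m : ℕ, ∀ t : ℝ, 0 < t → t < 1 / ((m : ℝ) + 1) →
      volume (brillouinZone b ∩ {k | ∃ n, |e n k - εF| ≤ t}) ≤ ENNReal.ofReal (m * t) := by
  have h1 := fun n => exists_volume_band_shell (he.cont n) (hF.smooth n) (hF.noncritical n)
    (brillouinZone_isCompact_closure b)
  choose m hm using h1
  refine ⟨∑ n ∈ Finset.range n₀, m n, fun t ht ht' => ?_⟩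
  have h2 : brillouinZone b ∩ {k | ∃ n, |e n k - εF| ≤ t} ⊆
      ⋃ n ∈ Finset.range n₀, (closure (brillouinZone b) ∩ {k | |e n k - εF| ≤ t}) := by
    rintro k ⟨hk, n, hn⟩
    refine mem_biUnion (x := n) ?_ ⟨subset_closure hk, hn⟩
    by_contra h
    have h3 := hn₀ n (by simpa using h) k
    have h4 := (abs_le.mp hn).2
    have h5 : 1 / (((∑ n ∈ Finset.range n₀, m n : ℕ) : ℝ) + 1) ≤ 1 := by
      rw [div_le_one (by positivity)]
      exact le_add_of_nonneg_left (Nat.cast_nonneg _)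
    linarith
  refine (measure_mono h2).trans ((measure_biUnion_finset_le _ _).trans ?_)
  push_cast
  rw [Finset.sum_mul, ENNReal.ofReal_sum_of_nonneg (fun _ _ => by positivity)]
  refine Finset.sum_le_sum fun n hn => hm n t ht (ht'.trans_le (one_div_nat_add_one_anti ?_))
  exact Finset.single_le_sum (f := m) (fun _ _ => Nat.zero_le _) hn

theorem exists_threshold {f : ℕ → ℝ} (hf : Monotone f) {l : ℝ} {n₀ : ℕ} (hn₀ : l < f n₀) :
    ∃ M : ℕ, ∀ n, f n ≤ l ↔ n < M := by
  classical
  have h : ∃ n, l < f n := ⟨n₀, hn₀⟩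
  refine ⟨Nat.find h, fun n => ⟨fun hn => ?_, fun hn => ?_⟩⟩
  · by_contra! h1
    exact absurd (hf h1) (not_le.mpr (hn.trans_lt (Nat.find_spec h)))
  · exact not_lt.mp (Nat.find_min h hn)

theorem exists_threshold_lt {f : ℕ → ℝ} (hf : Monotone f) {l : ℝ} {n₀ : ℕ} (hn₀ : l < f n₀) :
    ∃ M : ℕ, ∀ n, f n < l ↔ n < M := by
  classical
  have h : ∃ n, l ≤ f n := ⟨n₀, hn₀.le⟩
  refine ⟨Nat.find h, fun n => ⟨fun hn => ?_, fun hn => ?_⟩⟩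
  · by_contra! h1
    exact absurd (hf h1) (not_le.mpr (hn.trans_le (Nat.find_spec h)))
  · exact not_le.mp (Nat.find_min h hn)

/-- At `k` the number of occupied bands is `M₁` or `M₂ ≤ M₁ + 1`, the other bands are at a distance
at least `δ` of `εF`, and the partial sums `G M`, `M ∈ {M₁, M₂}`, have approximations `T L M`. -/
def IsLocalCount {F : Type*} [NormedAddCommGroup F] (e : ℕ → E d → ℝ) (εF : ℝ) (G : ℕ → E d → F)
    (T : ℕ → ℕ → E d → F) (p m : ℕ) (k : E d) : Prop :=
  ∃ M₁ M₂ : ℕ, M₁ ≤ M₂ ∧ M₂ ≤ M₁ + 1 ∧ (∀ n < M₁, e n k ≤ εF - 1 / ((m : ℝ) + 1)) ∧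
    (∀ n, M₂ ≤ n → εF + 1 / ((m : ℝ) + 1) ≤ e n k) ∧ ∀ M, M = M₁ ∨ M = M₂ →
      ‖G M k‖ ≤ m ∧ ∀ L : ℕ, 1 ≤ L → m ≤ L → ‖G M k - T L M k‖ ≤ m / (L : ℝ) ^ (p + 1)

theorem IsLocalCount.mono {F : Type*} [NormedAddCommGroup F] {e : ℕ → E d → ℝ} {εF : ℝ}
    {G : ℕ → E d → F} {T : ℕ → ℕ → E d → F} {p m m' : ℕ} {k : E d} (hm : m ≤ m')
    (h : IsLocalCount e εF G T p m k) : IsLocalCount e εF G T p m' k := by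
  obtain ⟨M₁, M₂, h1, h2, h3, h4, h5⟩ := h
  have h6 := one_div_nat_add_one_anti hm
  have h7 : (m : ℝ) ≤ m' := by exact_mod_cast hm
  refine ⟨M₁, M₂, h1, h2, fun n hn => (h3 n hn).trans (by linarith),
    fun n hn => le_trans (by linarith) (h4 n hn), fun M hM => ⟨(h5 M hM).1.trans h7,
    fun L hL hL' => ((h5 M hM).2 L hL (hm.trans hL')).trans (by gcongr)⟩⟩

/-- `M₁` counts the bands strictly below `εF` at `k₀` and `M₂` those at most `εF`. They differ by at
most one since no two bands meet at `εF`, and by definition there is a gap above each count. The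
strict inequalities persist nearby by continuity, for the high bands also by monotonicity in `n`. -/
theorem IsBandFamily.exists_isLocalCount_nhds {e : ℕ → E d → ℝ} (he : IsBandFamily b e) {εF : ℝ}
    (hF : HasRegularFermiSurface e εF) {n₀ : ℕ} (hn₀ : ∀ n, n₀ ≤ n → ∀ k, εF + 1 < e n k)
    {F : Type*} [NormedAddCommGroup F] {G : ℕ → E d → F} {T : ℕ → ℕ → E d → F} {p : ℕ}
    (hG : ∀ M k₀, (∀ j < M, e j k₀ < e M k₀) → ∃ U ∈ 𝓝 k₀, ∃ (C : ℝ) (L₀ : ℕ), 0 ≤ C ∧ ∀ k ∈ U,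
      ‖G M k‖ ≤ C ∧ ∀ L : ℕ, 1 ≤ L → L₀ ≤ L → ‖G M k - T L M k‖ ≤ C / (L : ℝ) ^ (p + 1))
    (k₀ : E d) :
    ∃ U ∈ 𝓝 k₀, ∃ m : ℕ, ∀ k ∈ U, IsLocalCount e εF G T p m k := by
  have h0 : εF < e n₀ k₀ := (lt_add_one _).trans (hn₀ n₀ le_rfl k₀)
  obtain ⟨M₁, hM₁⟩ := exists_threshold_lt (he.mono k₀) h0
  obtain ⟨M₂, hM₂⟩ := exists_threshold (he.mono k₀) h0
  have h12 : M₁ ≤ M₂ := by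
    by_contra! h
    exact lt_irrefl M₂ ((hM₂ M₂).mp ((hM₁ M₂).mpr h).le)
  have h21 : M₂ ≤ M₁ + 1 := by
    by_contra! h
    have key : ∀ n, M₁ ≤ n → n < M₂ → e n k₀ = εF := fun n h h' =>
      le_antisymm ((hM₂ n).mpr h') (not_lt.mp fun h'' => absurd ((hM₁ n).mp h'') (by omega))
    exact hF.isolated M₁ (M₁ + 1) k₀ (by omega) (key _ le_rfl (by omega)) (key _ (by omega) h)
  have hM₂' : εF < e M₂ k₀ := not_le.mp fun h => lt_irrefl _ ((hM₂ M₂).mp h)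
  have hg₁ : ∀ j < M₁, e j k₀ < e M₁ k₀ := fun j hj =>
    ((hM₁ j).mpr hj).trans_le (not_lt.mp fun h => lt_irrefl _ ((hM₁ M₁).mp h))
  have hg₂ : ∀ j < M₂, e j k₀ < e M₂ k₀ := fun j hj => ((hM₂ j).mpr hj).trans_lt hM₂'
  obtain ⟨U₁, hU₁, C₁, L₁, -, h₁⟩ := hG M₁ k₀ hg₁
  obtain ⟨U₂, hU₂, C₂, L₂, -, h₂⟩ := hG M₂ k₀ hg₂
  obtain ⟨δ₂, hδ₂, hδ₂'⟩ : ∃ δ, 0 < δ ∧ εF + δ < e M₂ k₀ :=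
    ⟨(e M₂ k₀ - εF) / 2, by linarith, by linarith⟩
  obtain ⟨δ₁, hδ₁, hδ₁'⟩ : ∃ δ, 0 < δ ∧ (∀ n < M₁, e n k₀ < εF - δ) := by
    rcases Nat.eq_zero_or_pos M₁ with h | h
    · exact ⟨1, one_pos, fun n hn => by omega⟩
    · have h3 := (hM₁ (M₁ - 1)).mpr (by omega)
      refine ⟨(εF - e (M₁ - 1) k₀) / 2, by linarith, fun n hn => ?_⟩
      have := he.mono k₀ (show n ≤ M₁ - 1 by omega)
      simp only at this
      linarith
  have hU₃ : ∀ᶠ k in 𝓝 k₀, εF + δ₂ < e M₂ k :=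
    (he.cont M₂).continuousAt.eventually (lt_mem_nhds hδ₂')
  have hU₄ : ∀ᶠ k in 𝓝 k₀, ∀ n ∈ Finset.range M₁, e n k < εF - δ₁ :=
    (Finset.eventually_all _).mpr fun n hn => (he.cont n).continuousAt.eventually
      (gt_mem_nhds (hδ₁' n (Finset.mem_range.mp hn)))
  obtain ⟨m, hm1, hm2, hm3⟩ := exists_nat_parameters (max C₁ C₂) (max L₁ L₂) (lt_min hδ₁ hδ₂)
  refine ⟨_, inter_mem (inter_mem hU₁ hU₂) (hU₃.and hU₄), m, ?_⟩
  rintro k ⟨⟨hk1, hk2⟩, hk3⟩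
  have hk4 : εF + δ₂ < e M₂ k := hk3.1
  have hk5 : ∀ n ∈ Finset.range M₁, e n k < εF - δ₁ := hk3.2
  have hC₁ := (le_max_left _ _).trans hm1
  have hC₂ := (le_max_right _ _).trans hm1
  have hL₁ := (le_max_left _ _).trans hm2
  have hL₂ := (le_max_right _ _).trans hm2
  have hd₁ := hm3.trans (min_le_left _ _)
  have hd₂ := hm3.trans (min_le_right _ _)
  refine ⟨M₁, M₂, h12, h21, fun n hn => ?_, fun n hn => ?_, ?_⟩
  · have := hk5 n (Finset.mem_range.mpr hn)
    linarith
  · have := he.mono k hn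
    simp only at this
    linarith
  · rintro M (rfl | rfl)
    · exact ⟨(h₁ k hk1).1.trans hC₁, fun L hL hL' =>
        ((h₁ k hk1).2 L hL (hL₁.trans hL')).trans (by gcongr)⟩
    · exact ⟨(h₂ k hk2).1.trans hC₂, fun L hL hL' =>
        ((h₂ k hk2).2 L hL (hL₂.trans hL')).trans (by gcongr)⟩

theorem IsBandFamily.exists_isLocalCount {e : ℕ → E d → ℝ} (he : IsBandFamily b e) {εF : ℝ}
    (hF : HasRegularFermiSurface e εF) {n₀ : ℕ} (hn₀ : ∀ n, n₀ ≤ n → ∀ k, εF + 1 < e n k)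
    {F : Type*} [NormedAddCommGroup F] {G : ℕ → E d → F} {T : ℕ → ℕ → E d → F} {p : ℕ}
    (hG : ∀ M k₀, (∀ j < M, e j k₀ < e M k₀) → ∃ U ∈ 𝓝 k₀, ∃ (C : ℝ) (L₀ : ℕ), 0 ≤ C ∧ ∀ k ∈ U,
      ‖G M k‖ ≤ C ∧ ∀ L : ℕ, 1 ≤ L → L₀ ≤ L → ‖G M k - T L M k‖ ≤ C / (L : ℝ) ^ (p + 1)) :
    ∃ m : ℕ, ∀ k ∈ closure (brillouinZone b), IsLocalCount e εF G T p m k :=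
  (brillouinZone_isCompact_closure b).exists_nat_of_locally (fun _ _ _ hm h => h.mono hm)
    fun k _ => he.exists_isLocalCount_nhds hF hn₀ hG k

end

section

variable {d : ℕ} {b : Module.Basis (Fin d) ℝ (E d)}

/-! ### Averages over the Brillouin zone -/

theorem volume_brillouinZone_lt_top (b : Module.Basis (Fin d) ℝ (E d)) :
    volume (brillouinZone b) < ⊤ := (brillouinZone_isBounded b).measure_lt_top

theorem volume_real_brillouinZone_pos (b : Module.Basis (Fin d) ℝ (E d)) :
    0 < volume.real (brillouinZone b) :=
  ENNReal.toReal_pos (ZSpan.measure_fundamentalDomain_ne_zero (recipBasis b))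
    (volume_brillouinZone_lt_top b).ne

theorem _root_.Continuous.integrableOn_brillouinZone {F : Type*} [NormedAddCommGroup F]
    {f : E d → F} (hf : Continuous f) : IntegrableOn f (brillouinZone b) :=
  (hf.continuousOn.integrableOn_compact (brillouinZone_isCompact_closure b)).mono_set subset_closure

theorem integrableOn_indicator_le {F : Type*} [NormedAddCommGroup F] {f : E d → ℝ}
    (hf : Continuous f) {g : E d → F} (hg : Continuous g) (ε : ℝ) :
    IntegrableOn ({k | f k ≤ ε}.indicator g) (brillouinZone b) :=
  Integrable.indicator hg.integrableOn_brillouinZone (isClosed_le hf continuous_const).measurableSet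

theorem average_le_average {f g : E d → ℝ} (hf : IntegrableOn f (brillouinZone b))
    (hg : IntegrableOn g (brillouinZone b)) (h : ∀ k ∈ brillouinZone b, f k ≤ g k) :
    ⨍ k in brillouinZone b, f k ≤ ⨍ k in brillouinZone b, g k := by
  rw [setAverage_eq, setAverage_eq]
  exact smul_le_smul_of_nonneg_left
    (setIntegral_mono_on hf hg (brillouinZone_measurableSet b) h) (by positivity)

theorem norm_average_le {F : Type*} [NormedAddCommGroup F] [NormedSpace ℝ F] {D : E d → F}
    {A : Set (E d)} (hA : MeasurableSet A) {a κ v : ℝ} (hκ : 0 ≤ κ) (hv : 0 ≤ v)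
    (hD : ∀ k ∈ brillouinZone b, ‖D k‖ ≤ a + A.indicator (fun _ => κ) k)
    (hvol : volume (brillouinZone b ∩ A) ≤ ENNReal.ofReal v) :
    ‖⨍ k in brillouinZone b, D k‖ ≤ a + κ * v / volume.real (brillouinZone b) := by
  have hpos := volume_real_brillouinZone_pos b
  have hκi : IntegrableOn (A.indicator fun _ => κ) (brillouinZone b) :=
    (continuous_const.integrableOn_brillouinZone).indicator hA
  have hai : IntegrableOn (fun _ : E d => a) (brillouinZone b) :=
    continuous_const.integrableOn_brillouinZone
  have h1 : ‖∫ k in brillouinZone b, D k‖ ≤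
      ∫ k in brillouinZone b, (a + A.indicator (fun _ => κ) k) :=
    norm_integral_le_of_norm_le (hai.add hκi)
      ((ae_restrict_iff' (brillouinZone_measurableSet b)).mpr (Eventually.of_forall hD))
  have h2 : volume.real (brillouinZone b ∩ A) ≤ v := ENNReal.toReal_le_of_le_ofReal hv hvol
  have h3 : ∫ k in brillouinZone b, (a + A.indicator (fun _ => κ) k) =
      volume.real (brillouinZone b) * a + volume.real (brillouinZone b ∩ A) * κ := by
    rw [integral_add hai hκi, setIntegral_indicator hA, setIntegral_const, setIntegral_const,
      smul_eq_mul, smul_eq_mul]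
  rw [h3] at h1
  rw [setAverage_eq, norm_smul, Real.norm_of_nonneg (by positivity)]
  calc (volume.real (brillouinZone b))⁻¹ * ‖∫ k in brillouinZone b, D k‖
      ≤ (volume.real (brillouinZone b))⁻¹ * (volume.real (brillouinZone b) * a + v * κ) := by
        gcongr
        exact h1.trans (by gcongr)
    _ = _ := by field_simp

theorem average_sub {F : Type*} [NormedAddCommGroup F] [NormedSpace ℝ F]
    {f g : E d → F} (hf : IntegrableOn f (brillouinZone b)) (hg : IntegrableOn g (brillouinZone b)) :
    ⨍ k in brillouinZone b, (f k - g k) =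
      (⨍ k in brillouinZone b, f k) - ⨍ k in brillouinZone b, g k := by
  rw [setAverage_eq, setAverage_eq, setAverage_eq, integral_sub hf hg, smul_sub]

theorem average_sum {F : Type*} [NormedAddCommGroup F] [NormedSpace ℝ F]
    {f : ℕ → E d → F} (s : Finset ℕ) (hf : ∀ n ∈ s, IntegrableOn (f n) (brillouinZone b)) :
    ∑ n ∈ s, ⨍ k in brillouinZone b, f n k = ⨍ k in brillouinZone b, ∑ n ∈ s, f n k := by
  simp only [setAverage_eq]
  rw [integral_finsetSum _ hf, Finset.smul_sum]

/-- A family of functions which are eventually larger than any given level. -/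
def IsUnbounded (f : ℕ → E d → ℝ) : Prop := ∀ l : ℝ, ∃ n₀ : ℕ, ∀ n, n₀ ≤ n → ∀ k, l < f n k

theorem tsum_average_indicator {F : Type*} [NormedAddCommGroup F] [NormedSpace ℝ F]
    {f : ℕ → E d → ℝ} (hf : ∀ n, Continuous (f n)) {g : ℕ → E d → F} (hg : ∀ n, Continuous (g n))
    {ε : ℝ} {n₀ : ℕ} (hn₀ : ∀ n, n₀ ≤ n → ∀ k, ε < f n k) :
    ∑' n, ⨍ k in brillouinZone b, {k | f n k ≤ ε}.indicator (g n) k =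
      ⨍ k in brillouinZone b, ∑ n ∈ Finset.range n₀, {k | f n k ≤ ε}.indicator (g n) k := by
  rw [tsum_eq_sum (s := Finset.range n₀), average_sum _
    (fun n _ => integrableOn_indicator_le (hf n) (hg n) ε)]
  intro n hn
  have h1 : {k | f n k ≤ ε} = ∅ := by
    ext k
    simpa using hn₀ n (by simpa using hn) k
  simp [h1]

theorem sum_indicator_eq {F : Type*} [AddCommGroup F] {f : ℕ → E d → ℝ} (g : ℕ → E d → F)
    {ε : ℝ} {n₀ M : ℕ} {k : E d} (hn₀ : ∀ n, n₀ ≤ n → ε < f n k) (hM : ∀ n, f n k ≤ ε ↔ n < M) :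
    ∑ n ∈ Finset.range n₀, {k | f n k ≤ ε}.indicator (g n) k = ∑ n ∈ Finset.range M, g n k := by
  have hMn : M ≤ n₀ := by
    by_contra! h
    exact absurd ((hM n₀).mpr h) (not_le.mpr (hn₀ n₀ le_rfl))
  symm
  refine (Finset.sum_congr rfl fun n hn => ?_).trans
    (Finset.sum_subset (Finset.range_subset_range.mpr hMn) fun n _ hn => ?_)
  · exact (indicator_of_mem (by exact (hM n).mpr (Finset.mem_range.mp hn)) _).symm
  · have h : k ∉ {k | f n k ≤ ε} := fun h => hn (Finset.mem_range.mpr ((hM n).mp h))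
    exact indicator_of_notMem h _

theorem integratedDOS_mono {f f' : ℕ → E d → ℝ} (hf : ∀ n, Continuous (f n))
    (hf' : ∀ n, Continuous (f' n)) (hu : IsUnbounded f) (hu' : IsUnbounded f') {ε ε' : ℝ}
    (h : ∀ k ∈ brillouinZone b, ∀ n, f n k ≤ ε → f' n k ≤ ε') :
    integratedDOS b f ε ≤ integratedDOS b f' ε' := by
  obtain ⟨n₁, h₁⟩ := hu ε
  obtain ⟨n₂, h₂⟩ := hu' ε'
  rw [integratedDOS, integratedDOS,
    tsum_average_indicator hf (fun _ => continuous_const) (n₀ := max n₁ n₂)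
      (fun n hn => h₁ n ((le_max_left _ _).trans hn)),
    tsum_average_indicator hf' (fun _ => continuous_const) (n₀ := max n₁ n₂)
      (fun n hn => h₂ n ((le_max_right _ _).trans hn))]
  refine average_le_average
    (integrable_finsetSum _ fun n _ => integrableOn_indicator_le (hf n) continuous_const ε)
    (integrable_finsetSum _ fun n _ => integrableOn_indicator_le (hf' n) continuous_const ε') ?_
  intro k hk
  refine Finset.sum_le_sum fun n _ => ?_
  by_cases h3 : f n k ≤ ε
  · rw [indicator_of_mem (by exact h3), indicator_of_mem (by exact h k hk n h3)]
  · rw [indicator_of_notMem (by exact h3)]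
    exact indicator_nonneg (fun _ _ => zero_le_one) _

/-- At a level where the integrated density of states is `N`, measuring energies from `c` subtracts
`c N`. With `c = εF` the same number is removed from the exact and from the interpolated energy,
while the integrand becomes small on the Fermi surface. -/
theorem integratedEnergy_sub {f : ℕ → E d → ℝ} (hf : ∀ n, Continuous (f n)) {g : ℕ → E d → ℝ}
    (hg : ∀ n, Continuous (g n)) {ε c : ℝ} {n₀ : ℕ} (hn₀ : ∀ n, n₀ ≤ n → ∀ k, ε < f n k) :
    integratedEnergy b g f ε - c * integratedDOS b f ε =
      ⨍ k in brillouinZone b, ∑ n ∈ Finset.range n₀,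
        {k | f n k ≤ ε}.indicator (fun k => g n k - c) k := by
  rw [integratedEnergy, integratedDOS, tsum_average_indicator hf hg hn₀,
    tsum_average_indicator hf (fun _ => continuous_const) hn₀]
  have h1 := integrable_finsetSum (Finset.range n₀)
    fun n _ => integrableOn_indicator_le (b := b) (hf n) (hg n) ε
  have h2 := integrable_finsetSum (Finset.range n₀)
    fun n _ => integrableOn_indicator_le (b := b) (hf n) (continuous_const (y := (1 : ℝ))) ε
  have h3 : c * ⨍ k in brillouinZone b, ∑ n ∈ Finset.range n₀,
      {k | f n k ≤ ε}.indicator (fun _ => (1 : ℝ)) k =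
      ⨍ k in brillouinZone b, c * ∑ n ∈ Finset.range n₀,
        {k | f n k ≤ ε}.indicator (fun _ => (1 : ℝ)) k := by
    rw [setAverage_eq, setAverage_eq, integral_const_mul, smul_eq_mul, smul_eq_mul]
    ring
  rw [h3, ← average_sub h1 (h2.const_mul c)]
  congr 1
  ext k
  rw [Finset.mul_sum, ← Finset.sum_sub_distrib]
  refine Finset.sum_congr rfl fun n _ => ?_
  by_cases h : f n k ≤ ε
  · rw [indicator_of_mem (by exact h), indicator_of_mem (by exact h), indicator_of_mem (by exact h),
      mul_one]
  · rw [indicator_of_notMem (by exact h), indicator_of_notMem (by exact h),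
      indicator_of_notMem (by exact h), mul_zero, sub_zero]

/-- A level with a given number of electrons lies below any common bound of sufficiently many
bands. -/
theorem lt_of_integratedDOS_eq {f : ℕ → E d → ℝ} (hf : ∀ n, Continuous (f n)) (hu : IsUnbounded f)
    {N ε l : ℝ} (hε : integratedDOS b f ε = N) {M : ℕ} (hM : N < M)
    (hl : ∀ n < M, ∀ k ∈ brillouinZone b, f n k ≤ l) : ε < l := by
  by_contra! h
  obtain ⟨n₁, h₁⟩ := hu ε
  have h2 : (M : ℝ) ≤ integratedDOS b f ε := by
    rw [integratedDOS, tsum_average_indicator hf (fun _ => continuous_const) (n₀ := max n₁ M)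
      (fun n hn => h₁ n ((le_max_left _ _).trans hn))]
    have h3 : (M : ℝ) = ⨍ _k in brillouinZone b, (M : ℝ) := by
      exact (setAverage_const (ZSpan.measure_fundamentalDomain_ne_zero (recipBasis b))
        (volume_brillouinZone_lt_top b).ne _).symm
    rw [h3]
    refine average_le_average continuous_const.integrableOn_brillouinZone
      (integrable_finsetSum _ fun n _ => integrableOn_indicator_le (hf n) continuous_const ε) ?_
    intro k hk
    calc (M : ℝ) = ∑ n ∈ Finset.range M, {k | f n k ≤ ε}.indicator (fun _ => (1 : ℝ)) k := by
          rw [Finset.sum_congr rfl fun n hn => indicator_of_mem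
            (by exact (hl n (Finset.mem_range.mp hn) k hk).trans h) _]
          simp
      _ ≤ _ := Finset.sum_le_sum_of_subset_of_nonneg
          (Finset.range_subset_range.mpr (le_max_right _ _))
          fun n _ _ => indicator_nonneg (fun _ _ => zero_le_one) _
  linarith

/-! ### The interpolated Fermi level -/

/-- No regularity of the integrated density of states is needed. If `ε` were off by more than `h`, a
level strictly between `ε` and `εF` would be squeezed by monotonicity to the same value `N`, against
uniqueness of `εF`. -/
theorem abs_level_sub_le {e f : ℕ → E d → ℝ} (he : ∀ n, Continuous (e n))
    (hf : ∀ n, Continuous (f n)) (hue : IsUnbounded e) (huf : IsUnbounded f) {N εF ε δ h : ℝ}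
    (hδ : 0 < δ) (hh : 0 ≤ h) (hF : ∀ ε, integratedDOS b e ε = N ↔ ε = εF) (hε : integratedDOS b f ε = N)
    (htr : ∀ k ∈ brillouinZone b, ∀ n, IsTracked εF δ h (e n k) (f n k)) : |ε - εF| ≤ h := by
  have hN := (hF εF).mpr rfl
  rw [abs_le]
  constructor
  · by_contra! hlt
    -- A level that lies above every exact band whose approximation is at most `ε`, whether that
    -- band is `h`-close to its approximation or `δ` below `εF`.
    have h1 : max (ε + h) (εF - δ / 4) < εF := max_lt (by linarith) (by linarith)
    refine h1.ne ((hF _).mp (le_antisymm ?_ ?_))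
    · rw [← hN]
      exact integratedDOS_mono he he hue hue fun k _ n hn => hn.trans h1.le
    · rw [← hε]
      refine integratedDOS_mono hf he huf hue fun k hk n hn => ?_
      rcases htr k hk n with H | H | H
      · exact le_trans (by linarith [H.1]) (le_max_right _ _)
      · linarith [H.2]
      · exact le_trans (by linarith [(abs_le.mp H).1]) (le_max_left _ _)
  · by_contra! hlt
    have h1 : εF < min (ε - h) (εF + δ / 4) := lt_min (by linarith) (by linarith)
    refine h1.ne' ((hF _).mp (le_antisymm ?_ ?_))
    · rw [← hε]
      refine integratedDOS_mono he hf hue huf fun k hk n hn => ?_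
      rcases htr k hk n with H | H | H
      · linarith [H.2]
      · linarith [hn.trans (min_le_right _ _), H.1]
      · linarith [hn.trans (min_le_left _ _), (abs_le.mp H).2]
    · rw [← hN]
      exact integratedDOS_mono he he hue hue fun k _ n hn => hn.trans h1.le


theorem IsBandFamily.isUnbounded {e : ℕ → E d → ℝ} (he : IsBandFamily b e) {P : ℕ → BZOperator b}
    {p : ℕ} (hP : IsInterpolationOfOrder b P p) : IsUnbounded e := fun l => by
  obtain ⟨n₀, h⟩ := he.exists_lt_interp hP l
  exact ⟨n₀, fun n hn k => (h n hn k).1⟩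

theorem IsBandFamily.isUnbounded_interp {e : ℕ → E d → ℝ} (he : IsBandFamily b e)
    {P : ℕ → BZOperator b} {p : ℕ} (hP : IsInterpolationOfOrder b P p) (L : ℕ) :
    IsUnbounded fun n => (P L).toLin (e n) := fun l => by
  obtain ⟨n₀, h⟩ := he.exists_lt_interp hP l
  exact ⟨n₀, fun n hn k => (h n hn k).2 L⟩

theorem IsBandFamily.continuous_interp {e : ℕ → E d → ℝ} (he : IsBandFamily b e)
    (P : BZOperator b) (n : ℕ) : Continuous (P.toLin (e n)) :=
  P.continuous_map _ (he.cont n) (he.per n)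

/-- The interpolated Fermi levels are bounded above. -/
theorem IsBandFamily.exists_level_bound {e : ℕ → E d → ℝ} (he : IsBandFamily b e)
    {Q : ℕ → BZOperator b} {q : ℕ} (hQ : IsInterpolationOfOrder b Q q) (N : ℝ) :
    ∃ l : ℝ, ∀ L ε, integratedDOS b (fun n => (Q L).toLin (e n)) ε = N → ε < l := by
  obtain ⟨B, hB1, hB⟩ := hQ.exists_uniform_bound
  obtain ⟨M, hM⟩ := exists_nat_gt N
  choose c hc0 hc using fun n => (he.per n).exists_bound (he.cont n)
  refine ⟨∑ n ∈ Finset.range M, B * c n, fun L ε hε => lt_of_integratedDOS_eq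
    (fun n => he.continuous_interp (Q L) n) (he.isUnbounded_interp hQ L) hε hM fun n hn k _ => ?_⟩
  refine ((le_abs_self _).trans (hB L _ (he.cont n) (he.per n) _ (hc n) k)).trans ?_
  exact Finset.single_le_sum (f := fun n => B * c n)
    (fun n _ => mul_nonneg (by linarith) (hc0 n)) (Finset.mem_range.mpr hn)

/-! ### Pointwise comparison of the occupied bands -/

/-- All bands but `M₁` are too far from `εF` to be misplaced, so both occupation numbers are `M₁` or
`M₂`. If they differ, `e M₁ k` and `f M₁ k` lie on opposite sides of `εF` and `ε`, and the two
errors `h`, one for the band and one for the level, put `e M₁ k` within `2h` of `εF`. -/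
theorem IsLocalCount.compare {F : Type*} [NormedAddCommGroup F] {e f : ℕ → E d → ℝ} {εF ε h : ℝ}
    {G : ℕ → E d → F} {T : ℕ → ℕ → E d → F} {p m : ℕ} {k : E d}
    (H : IsLocalCount e εF G T p m k) (hhm : h ≤ 1 / ((m : ℝ) + 1) / 4)
    (hε : |ε - εF| ≤ h) (htr : ∀ n, IsTracked εF (1 / ((m : ℝ) + 1)) h (e n k) (f n k)) :
    ∃ M M' : ℕ, (∀ n, e n k ≤ εF ↔ n < M) ∧ (∀ n, f n k ≤ ε ↔ n < M') ∧ ‖G M k‖ ≤ m ∧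
      ‖G M' k‖ ≤ m ∧ (∀ L : ℕ, 1 ≤ L → m ≤ L → ‖G M' k - T L M' k‖ ≤ m / (L : ℝ) ^ (p + 1)) ∧
      (M = M' ∨ ∃ n, |e n k - εF| ≤ 2 * h ∧ (M = n ∧ M' = n + 1 ∨ M = n + 1 ∧ M' = n)) := by
  obtain ⟨M₁, M₂, h12, h21, hlo, hhi, hG⟩ := H
  have hδ : 0 < 1 / ((m : ℝ) + 1) := by positivity
  set δ := 1 / ((m : ℝ) + 1)
  have hε' := abs_le.mp hε
  have hlof : ∀ n < M₁, f n k ≤ ε := fun n hn => by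
    have h1 := hlo n hn
    rcases htr n with h2 | h2 | h2
    · linarith [h2.2]
    · linarith [h2.1]
    · linarith [(abs_le.mp h2).2]
  have hhif : ∀ n, M₂ ≤ n → ε < f n k := fun n hn => by
    have h1 := hhi n hn
    rcases htr n with h2 | h2 | h2
    · linarith [h2.1]
    · linarith [h2.2]
    · linarith [(abs_le.mp h2).1]
  have hloe : ∀ n < M₁, e n k ≤ εF := fun n hn => by linarith [hlo n hn]
  have hhie : ∀ n, M₂ ≤ n → εF < e n k := fun n hn => by linarith [hhi n hn]
  have key : ∀ (x : ℕ → ℝ) (l : ℝ), (∀ n < M₁, x n ≤ l) → (∀ n, M₂ ≤ n → l < x n) →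
      ∃ M, (∀ n, x n ≤ l ↔ n < M) ∧ (M = M₁ ∨ M = M₂) := by
    intro x l hx hx'
    by_cases hM : x M₁ ≤ l
    · refine ⟨M₂, fun n => ⟨fun hn => ?_, fun hn => ?_⟩, Or.inr rfl⟩
      · by_contra! h3
        exact not_le.mpr (hx' n h3) hn
      · rcases lt_or_ge n M₁ with h3 | h3
        · exact hx n h3
        · rwa [show n = M₁ by omega]
    · refine ⟨M₁, fun n => ⟨fun hn => ?_, fun hn => hx n hn⟩, Or.inl rfl⟩
      by_contra! h3
      rcases lt_or_ge n M₂ with h4 | h4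
      · rw [show n = M₁ by omega] at hn
        exact hM hn
      · exact not_le.mpr (hx' n h4) hn
  obtain ⟨M, hM, hM12⟩ := key (fun n => e n k) εF hloe hhie
  obtain ⟨M', hM', hM12'⟩ := key (fun n => f n k) ε hlof hhif
  refine ⟨M, M', hM, hM', (hG M hM12).1, (hG M' hM12').1, (hG M' hM12').2, ?_⟩
  by_cases hMM : M = M'
  · exact Or.inl hMM
  refine Or.inr ⟨M₁, ?_, by omega⟩
  rcases (by omega : M = M₁ ∧ M' = M₁ + 1 ∨ M = M₁ + 1 ∧ M' = M₁) with ⟨h1, h2⟩ | ⟨h1, h2⟩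
  · have h3 : εF < e M₁ k := not_le.mp fun h => by have := (hM M₁).mp h; omega
    have h4 : f M₁ k ≤ ε := (hM' M₁).mpr (by omega)
    rcases htr M₁ with h5 | h5 | h5
    · linarith [h5.1]
    · linarith [h5.2]
    · have := abs_le.mp h5
      rw [abs_le]
      constructor <;> linarith
  · have h3 : e M₁ k ≤ εF := (hM M₁).mpr (by omega)
    have h4 : ε < f M₁ k := not_le.mp fun h => by have := (hM' M₁).mp h; omega
    rcases htr M₁ with h5 | h5 | h5
    · linarith [h5.2]
    · linarith [h5.1]
    · have := abs_le.mp h5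
      rw [abs_le]
      constructor <;> linarith

end

section

variable {d : ℕ} {b : Module.Basis (Fin d) ℝ (E d)}

/-! ### Asymptotic comparison of Brillouin zone integrals -/

/-- The local error estimate of order `p + 1` for the approximations `T L M` of the partial sums
`G M`, near the points where there is a gap above the first `M` bands. -/
def HasGapEstimate {F : Type*} [NormedAddCommGroup F] (e : ℕ → E d → ℝ) (G : ℕ → E d → F)
    (T : ℕ → ℕ → E d → F) (p : ℕ) : Prop :=
  ∀ M k₀, (∀ j < M, e j k₀ < e M k₀) → ∃ U ∈ 𝓝 k₀, ∃ (C : ℝ) (L₀ : ℕ), 0 ≤ C ∧ ∀ k ∈ U,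
    ‖G M k‖ ≤ C ∧ ∀ L : ℕ, 1 ≤ L → L₀ ≤ L → ‖G M k - T L M k‖ ≤ C / (L : ℝ) ^ (p + 1)

theorem div_pow_le_div {a : ℝ} (ha : 0 ≤ a) {L : ℕ} (hL : 1 ≤ L) (q : ℕ) :
    a / (L : ℝ) ^ (q + 1) ≤ a / L := by
  have h1 : (1 : ℝ) ≤ L := by exact_mod_cast hL
  have h2 : (L : ℝ) ≤ (L : ℝ) ^ (q + 1) := le_self_pow₀ h1 (by omega)
  gcongr

/-- For large `L`, the Fermi level is approximated at order `q + 1`, and the occupied sums differ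
by `O(L^{-p-1})` except on a shell of width `O(L^{-q-1})`, where they differ by the contribution of
one band. -/
theorem IsBandFamily.exists_comparison {e : ℕ → E d → ℝ} (he : IsBandFamily b e) {N εF : ℝ}
    (hF : HasRegularFermiSurface e εF) (hN : ∀ ε, integratedDOS b e ε = N ↔ ε = εF)
    {Q : ℕ → BZOperator b} {q : ℕ} (hQ : IsInterpolationOfOrder b Q q)
    {F : Type*} [NormedAddCommGroup F] {G : ℕ → E d → F} {T : ℕ → ℕ → E d → F} {p : ℕ}
    (hG : HasGapEstimate e G T p) :
    ∃ m L₀ : ℕ, ∀ L : ℕ, 1 ≤ L → L₀ ≤ L → ∀ ε : ℝ,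
      integratedDOS b (fun n => (Q L).toLin (e n)) ε = N →
      volume (brillouinZone b ∩ {k | ∃ n, |e n k - εF| ≤ 2 * (m / (L : ℝ) ^ (q + 1))}) ≤
        ENNReal.ofReal (m * (2 * (m / (L : ℝ) ^ (q + 1)))) ∧
      ∀ k ∈ brillouinZone b, ∃ M M' : ℕ, (∀ n, e n k ≤ εF ↔ n < M) ∧
        (∀ n, (Q L).toLin (e n) k ≤ ε ↔ n < M') ∧ ‖G M k‖ ≤ m ∧ ‖G M' k‖ ≤ m ∧
        ‖G M' k - T L M' k‖ ≤ m / (L : ℝ) ^ (p + 1) ∧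
        (M = M' ∨ ∃ n, |e n k - εF| ≤ 2 * (m / (L : ℝ) ^ (q + 1)) ∧
          (M = n ∧ M' = n + 1 ∨ M = n + 1 ∧ M' = n)) := by
  obtain ⟨n₀, hn₀⟩ := he.isUnbounded hQ (εF + 1)
  obtain ⟨m₁, hm₁⟩ := he.exists_isTracked hF hQ
  obtain ⟨m₂, hm₂⟩ := he.exists_volume_shell hF hn₀
  obtain ⟨m₃, hm₃⟩ := he.exists_isLocalCount hF hn₀ hG
  set m := m₁ + m₂ + m₃ + 1 with hm
  -- For such `L` the accuracy `m / L^{q+1} ≤ m / L` is at most a quarter of the isolation distance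
  -- `1 / (m + 1)`.
  refine ⟨m, 4 * m * (m + 1), fun L hL hL' ε hε => ?_⟩
  have hmpos : (0 : ℝ) < m := by rw [hm]; positivity
  have hLpos : (0 : ℝ) < L := by exact_mod_cast hL
  have hmL : m ≤ L := le_trans (by nlinarith) hL'
  set h := (m : ℝ) / (L : ℝ) ^ (q + 1) with hh
  have hpos : 0 < h := by positivity
  have hsmall : h ≤ 1 / ((m : ℝ) + 1) / 4 := by
    refine (div_pow_le_div hmpos.le hL q).trans ?_
    rw [div_div, div_le_div_iff₀ hLpos (by positivity)]
    have : ((4 * m * (m + 1) : ℕ) : ℝ) ≤ L := by exact_mod_cast hL'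
    push_cast at this
    linarith
  have htr : ∀ k ∈ brillouinZone b, ∀ n,
      IsTracked εF (1 / ((m : ℝ) + 1)) h (e n k) ((Q L).toLin (e n) k) := fun k hk n => by
    refine (hm₁ k (subset_closure hk) n L hL (le_trans (by omega) hmL)).mono
      (one_div_nat_add_one_anti (by omega)) ?_
    rw [hh]
    have : (m₁ : ℝ) ≤ m := by exact_mod_cast (by omega : m₁ ≤ m)
    gcongr
  have hlev := abs_level_sub_le he.cont (he.continuous_interp (Q L)) (he.isUnbounded hQ)
    (he.isUnbounded_interp hQ L) (by positivity) hpos.le hN hε htr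
  constructor
  · have h1 : 2 * h < 1 / ((m₂ : ℝ) + 1) := by
      have h2 : 1 / ((m : ℝ) + 1) ≤ 1 / ((m₂ : ℝ) + 1) := one_div_nat_add_one_anti (by omega)
      have h3 : 0 < 1 / ((m : ℝ) + 1) := by positivity
      linarith
    refine (hm₂ (2 * h) (by positivity) h1).trans (ENNReal.ofReal_le_ofReal ?_)
    have : (m₂ : ℝ) ≤ m := by exact_mod_cast (by omega : m₂ ≤ m)
    gcongr
  · intro k hk
    obtain ⟨M, M', h1, h2, h3, h4, h5, h6⟩ :=
      ((hm₃ k (subset_closure hk)).mono (by omega : m₃ ≤ m)).compare hsmall hlev (htr k hk)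
    exact ⟨M, M', h1, h2, h3, h4, h5 L hL hmL, h6⟩

theorem measurableSet_shell {e : ℕ → E d → ℝ} (he : ∀ n, Continuous (e n)) (εF t : ℝ) :
    MeasurableSet {k | ∃ n, |e n k - εF| ≤ t} := by
  have : {k | ∃ n, |e n k - εF| ≤ t} = ⋃ n, {k | |e n k - εF| ≤ t} := by
    ext k
    simp
  rw [this]
  exact MeasurableSet.iUnion fun n =>
    (isClosed_le ((he n).sub continuous_const).abs continuous_const).measurableSet

/-- `S` is the sum of the first `M` terms `G M`, where `M` is the number of bands below `ε`. -/
def IsOccupiedSum {F : Type*} (b : Module.Basis (Fin d) ℝ (E d)) (e : ℕ → E d → ℝ) (ε : ℝ)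
    (G : ℕ → E d → F) (S : E d → F) : Prop :=
  ∀ k ∈ brillouinZone b, ∀ M, (∀ n, e n k ≤ ε ↔ n < M) → S k = G M k

/-- First order comparison of occupied sums. -/
theorem IsBandFamily.exists_average_le {e : ℕ → E d → ℝ} (he : IsBandFamily b e) {N εF : ℝ}
    (hF : HasRegularFermiSurface e εF) (hN : ∀ ε, integratedDOS b e ε = N ↔ ε = εF)
    {Q : ℕ → BZOperator b} {q : ℕ} (hQ : IsInterpolationOfOrder b Q q)
    {F : Type*} [NormedAddCommGroup F] [NormedSpace ℝ F] {G : ℕ → E d → F} {T : ℕ → ℕ → E d → F}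
    {p : ℕ} (hG : HasGapEstimate e G T p) :
    ∃ (C : ℝ) (L₀ : ℕ), 0 ≤ C ∧ ∀ L : ℕ, 1 ≤ L → L₀ ≤ L → ∀ ε : ℝ,
      integratedDOS b (fun n => (Q L).toLin (e n)) ε = N → ∀ S S' : E d → F,
      IsOccupiedSum b e εF G S → IsOccupiedSum b (fun n => (Q L).toLin (e n)) ε (T L) S' →
      ‖⨍ k in brillouinZone b, (S k - S' k)‖ ≤
        C * (1 / (L : ℝ) ^ (p + 1) + 1 / (L : ℝ) ^ (q + 1)) := by
  obtain ⟨m, L₀, hm⟩ := he.exists_comparison hF hN hQ hG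
  have hvpos := volume_real_brillouinZone_pos b
  set v := volume.real (brillouinZone b)
  refine ⟨m + 2 * m * (2 * m * m) / v, L₀, by positivity, fun L hL hL' ε hε S S' hS hS' => ?_⟩
  have hLpos : (0 : ℝ) < L := by exact_mod_cast hL
  obtain ⟨hvol, hpt⟩ := hm L hL hL' ε hε
  refine (norm_average_le (measurableSet_shell he.cont εF _) (a := m / (L : ℝ) ^ (p + 1))
    (κ := 2 * m) (by positivity) (by positivity) ?_ hvol).trans ?_
  · intro k hk
    obtain ⟨M, M', h1, h2, h3, h4, h5, h6⟩ := hpt k hk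
    rw [hS k hk M h1, hS' k hk M' h2]
    have h7 : ‖G M k - T L M' k‖ ≤ ‖G M k - G M' k‖ + ‖G M' k - T L M' k‖ :=
      norm_sub_le_norm_sub_add_norm_sub _ _ _
    have h8 : ‖G M k - G M' k‖ ≤ ({k | ∃ n, |e n k - εF| ≤ 2 * (m / (L : ℝ) ^ (q + 1))}.indicator
        (fun _ => (2 * m : ℝ)) k) := by
      rcases h6 with rfl | ⟨n, hn, -⟩
      · rw [sub_self, norm_zero]
        exact indicator_nonneg (fun _ _ => by positivity) _
      · rw [indicator_of_mem (by exact ⟨n, hn⟩)]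
        exact (norm_sub_le _ _).trans (by linarith)
    linarith
  · have h1 : (m : ℝ) / (L : ℝ) ^ (p + 1) + 2 * m * (m * (2 * (m / (L : ℝ) ^ (q + 1)))) / v =
        m * (1 / (L : ℝ) ^ (p + 1)) + 2 * m * (2 * m * m) / v * (1 / (L : ℝ) ^ (q + 1)) := by
      field_simp
    rw [h1, mul_add]
    gcongr
    · exact le_add_of_nonneg_right (by positivity)
    · exact le_add_of_nonneg_left (by positivity)

/-- Second order comparison of occupied sums, if the summands are small on the Fermi surface. -/
theorem IsBandFamily.exists_average_le_sq {e : ℕ → E d → ℝ} (he : IsBandFamily b e) {N εF : ℝ}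
    (hF : HasRegularFermiSurface e εF) (hN : ∀ ε, integratedDOS b e ε = N ↔ ε = εF)
    {Q : ℕ → BZOperator b} {q : ℕ} (hQ : IsInterpolationOfOrder b Q q)
    {F : Type*} [NormedAddCommGroup F] [NormedSpace ℝ F] {G : ℕ → E d → F} {T : ℕ → ℕ → E d → F}
    {p : ℕ} (hG : HasGapEstimate e G T p)
    (hstep : ∀ n k, ‖G (n + 1) k - G n k‖ ≤ |e n k - εF|) :
    ∃ (C : ℝ) (L₀ : ℕ), 0 ≤ C ∧ ∀ L : ℕ, 1 ≤ L → L₀ ≤ L → ∀ ε : ℝ,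
      integratedDOS b (fun n => (Q L).toLin (e n)) ε = N → ∀ S S' : E d → F,
      IsOccupiedSum b e εF G S → IsOccupiedSum b (fun n => (Q L).toLin (e n)) ε (T L) S' →
      ‖⨍ k in brillouinZone b, (S k - S' k)‖ ≤
        C * (1 / (L : ℝ) ^ (p + 1) + 1 / (L : ℝ) ^ (2 * q + 2)) := by
  obtain ⟨m, L₀, hm⟩ := he.exists_comparison hF hN hQ hG
  have hvpos := volume_real_brillouinZone_pos b
  set v := volume.real (brillouinZone b)
  refine ⟨m + 2 * m * (2 * m * m) / v, L₀, by positivity, fun L hL hL' ε hε S S' hS hS' => ?_⟩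
  have hLpos : (0 : ℝ) < L := by exact_mod_cast hL
  obtain ⟨hvol, hpt⟩ := hm L hL hL' ε hε
  refine (norm_average_le (measurableSet_shell he.cont εF _) (a := m / (L : ℝ) ^ (p + 1))
    (κ := 2 * (m / (L : ℝ) ^ (q + 1))) (by positivity) (by positivity) ?_ hvol).trans ?_
  · intro k hk
    obtain ⟨M, M', h1, h2, h3, h4, h5, h6⟩ := hpt k hk
    rw [hS k hk M h1, hS' k hk M' h2]
    have h7 : ‖G M k - T L M' k‖ ≤ ‖G M k - G M' k‖ + ‖G M' k - T L M' k‖ :=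
      norm_sub_le_norm_sub_add_norm_sub _ _ _
    have h8 : ‖G M k - G M' k‖ ≤ ({k | ∃ n, |e n k - εF| ≤ 2 * (m / (L : ℝ) ^ (q + 1))}.indicator
        (fun _ => 2 * (m / (L : ℝ) ^ (q + 1))) k) := by
      -- The misplaced band contributes at most its distance to the Fermi level, itself of the order
      -- of the width of the shell; multiplied by the volume of the shell this gives the square.
      rcases h6 with rfl | ⟨n, hn, ⟨rfl, rfl⟩ | ⟨rfl, rfl⟩⟩
      · rw [sub_self, norm_zero]
        exact indicator_nonneg (fun _ _ => by positivity) _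
      · rw [indicator_of_mem (by exact ⟨_, hn⟩), norm_sub_rev]
        exact (hstep _ k).trans hn
      · rw [indicator_of_mem (by exact ⟨_, hn⟩)]
        exact (hstep _ k).trans hn
    linarith
  · have h1 : (m : ℝ) / (L : ℝ) ^ (p + 1) +
        2 * (m / (L : ℝ) ^ (q + 1)) * (m * (2 * (m / (L : ℝ) ^ (q + 1)))) / v =
        m * (1 / (L : ℝ) ^ (p + 1)) + 2 * m * (2 * m * m) / v * (1 / (L : ℝ) ^ (2 * q + 2)) := by
      rw [show 2 * q + 2 = (q + 1) + (q + 1) by ring, pow_add _ (q + 1) (q + 1)]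
      field_simp
    rw [h1, mul_add]
    gcongr
    · exact le_add_of_nonneg_right (by positivity)
    · exact le_add_of_nonneg_left (by positivity)

/-- An estimate which holds for large `L`, with an error that is bounded for every `L`, holds for
all `L`. -/
theorem exists_forall_le_of_large {X : ℕ → Type*} {err : (L : ℕ) → X L → ℝ} {a : ℕ → ℝ}
    (ha : ∀ L, 1 ≤ L → 0 < a L)
    (hlarge : ∃ (C : ℝ) (L₀ : ℕ), 0 ≤ C ∧ ∀ L, 1 ≤ L → L₀ ≤ L → ∀ x, err L x ≤ C * a L)
    (hbdd : ∀ L, 1 ≤ L → ∃ B : ℝ, ∀ x, err L x ≤ B) :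
    ∃ C : ℝ, 0 ≤ C ∧ ∀ L, 1 ≤ L → ∀ x, err L x ≤ C * a L := by
  obtain ⟨C, L₀, hC, h⟩ := hlarge
  choose! B hB using hbdd
  have h0 : 0 ≤ ∑ L ∈ Finset.Icc 1 L₀, |B L| / a L := Finset.sum_nonneg fun L hL =>
    div_nonneg (abs_nonneg _) (ha L (Finset.mem_Icc.mp hL).1).le
  refine ⟨C + ∑ L ∈ Finset.Icc 1 L₀, |B L| / a L, by positivity, fun L hL x => ?_⟩
  rcases le_or_gt L₀ L with hL' | hL'
  · exact (h L hL hL' x).trans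
      (mul_le_mul_of_nonneg_right (le_add_of_nonneg_right h0) (ha L hL).le)
  · have h1 : |B L| / a L ≤ ∑ L ∈ Finset.Icc 1 L₀, |B L| / a L :=
      Finset.single_le_sum (f := fun L => |B L| / a L)
        (fun L hL => div_nonneg (abs_nonneg _) (ha L (Finset.mem_Icc.mp hL).1).le)
        (Finset.mem_Icc.mpr ⟨hL, hL'.le⟩)
    calc err L x ≤ |B L| := (hB L hL x).trans (le_abs_self _)
      _ = |B L| / a L * a L := (div_mul_cancel₀ _ (ha L hL).ne').symm
      _ ≤ _ := mul_le_mul_of_nonneg_right (by linarith) (ha L hL).le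

end

section

variable {d : ℕ} {b : Module.Basis (Fin d) ℝ (E d)}

/-! ### The energy estimate -/

theorem recipPeriodic_sum {e : ℕ → E d → ℝ} (he : ∀ n, RecipPeriodic b (e n)) (c : ℝ) (M : ℕ) :
    RecipPeriodic b fun k => ∑ n ∈ Finset.range M, (e n k - c) := fun K hK k => by
  simp only [he _ K hK k]

theorem BZOperator.toLin_sum_sub (P : BZOperator b) (e : ℕ → E d → ℝ) (c : ℝ) (M : ℕ) (k : E d) :
    P.toLin (fun k => ∑ n ∈ Finset.range M, (e n k - c)) k =
      ∑ n ∈ Finset.range M, (P.toLin (e n) k - c) := by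
  have h1 : (fun k => ∑ n ∈ Finset.range M, (e n k - c)) =
      ∑ n ∈ Finset.range M, fun k => e n k - c := by
    ext k
    simp
  rw [h1, map_sum, Finset.sum_apply]
  exact Finset.sum_congr rfl fun n _ => P.map_sub_const (e n) c k

/-- Below a gap only the sum of the bands is smooth, so the error is estimated for the interpolated
sum, which equals the sum of the interpolated bands. -/
theorem IsBandFamily.hasGapEstimate {e : ℕ → E d → ℝ} (he : IsBandFamily b e)
    (hsm : ∀ M k₀, (∀ j < M, e j k₀ < e M k₀) →
      ContDiffAt ℝ ⊤ (fun k => ∑ n ∈ Finset.range M, e n k) k₀)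
    {P : ℕ → BZOperator b} {p : ℕ} (hP : IsInterpolationOfOrder b P p) (c : ℝ) :
    HasGapEstimate e (fun M k => ∑ n ∈ Finset.range M, (e n k - c))
      (fun L M k => ∑ n ∈ Finset.range M, ((P L).toLin (e n) k - c)) p := by
  intro M k₀ h
  have h1 : ContDiffAt ℝ ⊤ (fun k => ∑ n ∈ Finset.range M, (e n k - c)) k₀ := by
    simp only [Finset.sum_sub_distrib]
    exact (hsm M k₀ h).sub contDiffAt_const
  obtain ⟨U, hU, C, L₀, hC, h2⟩ := BZOperator.exists_nhds_error hP
    (f := fun k => ∑ n ∈ Finset.range M, (e n k - c))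
    (continuous_finsetSum _ fun n _ => (he.cont n).sub continuous_const)
    (recipPeriodic_sum he.per c M) h1
  refine ⟨U, hU, C, L₀, hC, fun k hk => ⟨(h2 k hk).1, fun L hL hL' => ?_⟩⟩
  have h3 := (h2 k hk).2 L hL hL'
  rwa [BZOperator.toLin_sum_sub] at h3

theorem isOccupiedSum_sum_indicator {F : Type*} [AddCommGroup F] {f : ℕ → E d → ℝ}
    (g : ℕ → E d → F) {ε : ℝ} {n₀ : ℕ} (hn₀ : ∀ n, n₀ ≤ n → ∀ k, ε < f n k) :
    IsOccupiedSum b f ε (fun M k => ∑ n ∈ Finset.range M, g n k)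
      fun k => ∑ n ∈ Finset.range n₀, {k | f n k ≤ ε}.indicator (g n) k :=
  fun _ _ _ hM => sum_indicator_eq g (fun n hn => hn₀ n hn _) hM

theorem norm_average_sum_indicator_le {F : Type*} [NormedAddCommGroup F] [NormedSpace ℝ F]
    (A : ℕ → Set (E d)) {g : ℕ → E d → F} {c : ℕ → ℝ}
    (hg : ∀ n, ∀ k ∈ brillouinZone b, ‖g n k‖ ≤ c n) (s : Finset ℕ) :
    ‖⨍ k in brillouinZone b, ∑ n ∈ s, (A n).indicator (g n) k‖ ≤ ∑ n ∈ s, c n := by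
  have h := norm_average_le (b := b) (D := fun k => ∑ n ∈ s, (A n).indicator (g n) k)
    MeasurableSet.empty (a := ∑ n ∈ s, c n) le_rfl le_rfl ?_ (by simp)
  · simpa using h
  · intro k hk
    rw [indicator_empty]
    refine (norm_sum_le _ _).trans ?_
    rw [add_zero]
    exact Finset.sum_le_sum fun n _ => (norm_indicator_le_norm_self _ _).trans (hg n k hk)

theorem IsBandFamily.energy_estimate {e : ℕ → E d → ℝ} (he : IsBandFamily b e)
    (hsm : ∀ M k₀, (∀ j < M, e j k₀ < e M k₀) →
      ContDiffAt ℝ ⊤ (fun k => ∑ n ∈ Finset.range M, e n k) k₀) {N εF : ℝ}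
    (hF : HasRegularFermiSurface e εF) (hN : ∀ ε, integratedDOS b e ε = N ↔ ε = εF)
    {P Q : ℕ → BZOperator b} {p q : ℕ} (hP : IsInterpolationOfOrder b P p)
    (hQ : IsInterpolationOfOrder b Q q) :
    ∃ C : ℝ, 0 ≤ C ∧ ∀ L : ℕ, 1 ≤ L → ∀ ε : ℝ,
      integratedDOS b (fun n => (Q L).toLin (e n)) ε = N →
      |integratedEnergy b e e εF -
          integratedEnergy b (fun n => (P L).toLin (e n)) (fun n => (Q L).toLin (e n)) ε| ≤
        C * (1 / (L : ℝ) ^ (p + 1) + 1 / (L : ℝ) ^ (2 * q + 2)) := by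
  obtain ⟨l, hl⟩ := he.exists_level_bound hQ N
  -- All the possible Fermi levels are below `l`, so from `n₀` on the bands are empty, exact or
  -- interpolated, for every `L`.
  obtain ⟨n₀, hn₀⟩ := he.exists_lt_interp hQ (max l εF)
  have hn₁ : ∀ n, n₀ ≤ n → ∀ k, εF < e n k := fun n hn k =>
    (le_max_right _ _).trans_lt (hn₀ n hn k).1
  have hn₂ : ∀ L ε, integratedDOS b (fun n => (Q L).toLin (e n)) ε = N →
      ∀ n, n₀ ≤ n → ∀ k, ε < (Q L).toLin (e n) k := fun L ε hε n hn k =>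
    ((hl L ε hε).le.trans (le_max_left _ _)).trans_lt ((hn₀ n hn k).2 L)
  have hcP := fun L n => he.continuous_interp (P L) n
  have hcQ := fun L n => he.continuous_interp (Q L) n
  have h1 := integratedEnergy_sub (b := b) he.cont he.cont (c := εF) hn₁
  rw [(hN εF).mpr rfl] at h1
  have h2 : ∀ L ε, integratedDOS b (fun n => (Q L).toLin (e n)) ε = N →
      integratedEnergy b (fun n => (P L).toLin (e n)) (fun n => (Q L).toLin (e n)) ε - εF * N =
      ⨍ k in brillouinZone b, ∑ n ∈ Finset.range n₀,
        {k | (Q L).toLin (e n) k ≤ ε}.indicator (fun k => (P L).toLin (e n) k - εF) k := by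
    intro L ε hε
    have h3 := integratedEnergy_sub (b := b) (hcQ L) (hcP L) (c := εF) (hn₂ L ε hε)
    rwa [hε] at h3
  have key := exists_forall_le_of_large
    (X := fun L => {ε : ℝ // integratedDOS b (fun n => (Q L).toLin (e n)) ε = N})
    (err := fun L ε => |integratedEnergy b e e εF -
      integratedEnergy b (fun n => (P L).toLin (e n)) (fun n => (Q L).toLin (e n)) ε.1|)
    (a := fun L => 1 / (L : ℝ) ^ (p + 1) + 1 / (L : ℝ) ^ (2 * q + 2))
    (fun L hL => by
      have : (0 : ℝ) < L := by exact_mod_cast hL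
      positivity) ?_ ?_
  · obtain ⟨C, hC, h⟩ := key
    exact ⟨C, hC, fun L hL ε hε => h L hL ⟨ε, hε⟩⟩
  · obtain ⟨C, L₀, hC, h⟩ := he.exists_average_le_sq hF hN hQ (he.hasGapEstimate hsm hP εF)
      (fun n k => by rw [Finset.sum_range_succ, add_sub_cancel_left, Real.norm_eq_abs])
    refine ⟨C, L₀, hC, fun L hL hL' ε => ?_⟩
    have h3 := h L hL hL' ε.1 ε.2 _ _ (isOccupiedSum_sum_indicator _ hn₁)
      (isOccupiedSum_sum_indicator _ (hn₂ L ε.1 ε.2))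
    rw [average_sub, ← h1, ← h2 L ε.1 ε.2, sub_sub_sub_cancel_right, Real.norm_eq_abs] at h3
    · exact h3
    · exact integrable_finsetSum _ fun n _ => integrableOn_indicator_le (he.cont n)
        ((he.cont n).sub continuous_const) εF
    · exact integrable_finsetSum _ fun n _ => integrableOn_indicator_le (hcQ L n)
        ((hcP L n).sub continuous_const) ε.1
  -- For fixed `L` the integrand consists of `n₀` functions bounded on the Brillouin zone, cut by
  -- indicators; the bound does not depend on the level chosen.
  · intro L _
    have h4 : ∀ n, ∃ c, ∀ k ∈ brillouinZone b, ‖(P L).toLin (e n) k - εF‖ ≤ c := fun n => by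
      obtain ⟨c, hc⟩ := (brillouinZone_isCompact_closure b).exists_bound_of_continuousOn
        ((hcP L n).sub continuous_const).continuousOn
      exact ⟨c, fun k hk => hc k (subset_closure hk)⟩
    choose c hc using h4
    refine ⟨|integratedEnergy b e e εF - εF * N| + ∑ n ∈ Finset.range n₀, c n, fun ε => ?_⟩
    have h5 := norm_average_sum_indicator_le (fun n => {k | (Q L).toLin (e n) k ≤ ε.1}) hc
      (Finset.range n₀)
    rw [← h2 L ε.1 ε.2, Real.norm_eq_abs] at h5
    rw [← sub_sub_sub_cancel_right _ _ (εF * N)]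
    exact (abs_sub _ _).trans (by linarith)

end

section

variable {d : ℕ} {b : Module.Basis (Fin d) ℝ (E d)}

/-! ### The density estimate -/

theorem NodalRule.continuous_apply {F : Type*} [NormedAddCommGroup F] [NormedSpace ℝ F]
    (R : NodalRule b) (f : E d → F) : Continuous (R.apply f) :=
  continuous_finsetSum _ fun j _ => (R.weight_continuous j).smul continuous_const

theorem NodalRule.apply_sum {F : Type*} [NormedAddCommGroup F] [NormedSpace ℝ F]
    (R : NodalRule b) (f : ℕ → E d → F) (s : Finset ℕ) (k : E d) :
    R.apply (fun k => ∑ n ∈ s, f n k) k = ∑ n ∈ s, R.apply (f n) k := by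
  simp only [NodalRule.apply, Finset.smul_sum]
  exact Finset.sum_comm

theorem eventually_gap {e : ℕ → E d → ℝ} (he : ∀ n, Continuous (e n)) {M : ℕ} {k₀ : E d}
    (h : ∀ j < M, e j k₀ < e M k₀) : ∀ᶠ k in 𝓝 k₀, ∀ j < M, e j k < e M k := by
  have h1 : ∀ᶠ k in 𝓝 k₀, ∀ j ∈ Finset.range M, e j k < e M k :=
    (Finset.eventually_all _).mpr fun j hj => ContinuousAt.eventually_lt (he j).continuousAt
      (he M).continuousAt (h j (Finset.mem_range.mp hj))
  filter_upwards [h1] with k hk j hj using hk j (Finset.mem_range.mpr hj)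

theorem hasGapEstimate_nodal {e : ℕ → E d → ℝ} (he : ∀ n, Continuous (e n))
    {F : Type*} [NormedAddCommGroup F] [NormedSpace ℝ F] {β : ℕ → E d → F}
    (hsm : ∀ M k₀, (∀ j < M, e j k₀ < e M k₀) →
      ContDiffAt ℝ ⊤ (fun k => ∑ n ∈ Finset.range M, β n k) k₀)
    (hper : ∀ M k₀, (∀ j < M, e j k₀ < e M k₀) → ∀ K ∈ recipLattice b,
      ∑ n ∈ Finset.range M, β n (k₀ + K) = ∑ n ∈ Finset.range M, β n k₀)
    {P : ℕ → BZOperator b} {p : ℕ} (hP : IsInterpolationOfOrder b P p) {R : ℕ → NodalRule b}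
    (hR : ∀ L, 1 ≤ L → (R L).Represents (P L)) :
    HasGapEstimate e (fun M k => ∑ n ∈ Finset.range M, β n k)
      (fun L M k => ∑ n ∈ Finset.range M, (R L).apply (β n) k) p := by
  intro M k₀ h
  obtain ⟨U, hU, C, L₀, hC, h2⟩ := NodalRule.exists_nhds_error hP hR (hsm M k₀ h)
    ((eventually_gap he h).mono fun k hk => hper M k hk)
  refine ⟨U, hU, C, L₀, hC, fun k hk => ⟨(h2 k hk).1, fun L hL hL' => ?_⟩⟩
  have h3 := (h2 k hk).2 L hL hL'
  rwa [NodalRule.apply_sum] at h3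

/-- The terms depend on an eigenbasis that need not be measurable in `k`. But the sets where exactly
`M` bands are occupied are measurable and cover the space, and on each of them there is a gap above
the first `M` bands, so that the sum is continuous there. -/
theorem aestronglyMeasurable_occupied {e : ℕ → E d → ℝ} (he : ∀ n, Continuous (e n))
    (hmono : ∀ k, Monotone fun n => e n k) (hu : ∀ k, ∃ n, εF < e n k)
    {F : Type*} [NormedAddCommGroup F] {G : ℕ → E d → F} {S : E d → F}
    (hG : ∀ M k₀, (∀ j < M, e j k₀ < e M k₀) → ContinuousAt (G M) k₀)
    (hS : ∀ k M, (∀ n, e n k ≤ εF ↔ n < M) → S k = G M k) (μ : Measure (E d)) :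
    AEStronglyMeasurable S μ := by
  let A : ℕ → Set (E d) := fun M => (⋂ n ∈ Finset.range M, {k | e n k ≤ εF}) ∩ {k | εF < e M k}
  have hA : ∀ M, MeasurableSet (A M) := fun M =>
    (Finset.measurableSet_biInter _ fun n _ =>
      (isClosed_le (he n) continuous_const).measurableSet).inter
      (isOpen_lt continuous_const (he M)).measurableSet
  have hmem : ∀ M k, k ∈ A M ↔ ∀ n, e n k ≤ εF ↔ n < M := by
    intro M k
    simp only [A, mem_inter_iff, mem_iInter, Finset.mem_range]
    refine ⟨fun h n => ⟨fun hn => ?_, h.1 n⟩, fun h =>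
      ⟨fun n hn => (h n).mpr hn, not_le.mp fun h' => lt_irrefl M ((h M).mp h')⟩⟩
    by_contra! hle
    exact absurd (hn.trans_lt h.2) (not_lt.mpr (hmono k hle))
  have huniv : ⋃ M, A M = univ := by
    refine eq_univ_of_forall fun k => ?_
    obtain ⟨n, hn⟩ := hu k
    obtain ⟨M, hM⟩ := exists_threshold (hmono k) hn
    exact mem_iUnion.mpr ⟨M, (hmem M k).mpr hM⟩
  rw [← Measure.restrict_univ (μ := μ), ← huniv, aestronglyMeasurable_iUnion_iff]
  intro M
  have h1 : ContinuousOn (G M) (A M) := fun k hk => by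
    refine (hG M k fun j hj => ?_).continuousWithinAt
    exact (((hmem M k).mp hk j).mpr hj).trans_lt hk.2
  refine (h1.aestronglyMeasurable (hA M)).congr ?_
  filter_upwards [self_mem_ae_restrict (hA M)] with k hk
  exact (hS k M ((hmem M k).mp hk)).symm

theorem IsBandFamily.integrableOn_occupied {e : ℕ → E d → ℝ} (he : IsBandFamily b e) {εF : ℝ}
    (hF : HasRegularFermiSurface e εF) {n₀ : ℕ} (hn₀ : ∀ n, n₀ ≤ n → ∀ k, εF < e n k)
    {n₁ : ℕ} (hn₁ : ∀ n, n₁ ≤ n → ∀ k, εF + 1 < e n k)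
    {F : Type*} [NormedAddCommGroup F] [NormedSpace ℝ F] {β : ℕ → E d → F}
    (hsm : ∀ M k₀, (∀ j < M, e j k₀ < e M k₀) →
      ContDiffAt ℝ ⊤ (fun k => ∑ n ∈ Finset.range M, β n k) k₀)
    {T : ℕ → ℕ → E d → F} {p : ℕ}
    (hG : HasGapEstimate e (fun M k => ∑ n ∈ Finset.range M, β n k) T p) :
    IntegrableOn (fun k => ∑ n ∈ Finset.range n₀, {k | e n k ≤ εF}.indicator (β n) k)
      (brillouinZone b) := by
  have hS : ∀ k M, (∀ n, e n k ≤ εF ↔ n < M) →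
      ∑ n ∈ Finset.range n₀, {k | e n k ≤ εF}.indicator (β n) k = ∑ n ∈ Finset.range M, β n k :=
    fun k M hM => sum_indicator_eq β (fun n hn => hn₀ n hn k) hM
  obtain ⟨m, hm⟩ := he.exists_isLocalCount hF hn₁ hG
  refine IntegrableOn.of_bound (volume_brillouinZone_lt_top b)
    (aestronglyMeasurable_occupied he.cont he.mono (fun k => ⟨n₀, hn₀ n₀ le_rfl k⟩)
      (fun M k₀ h => (hsm M k₀ h).continuousAt) hS _) m ?_
  refine (ae_restrict_iff' (brillouinZone_measurableSet b)).mpr (Eventually.of_forall fun k hk => ?_)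
  -- Comparison of the bands with themselves, with `h = 0`: it yields the number of occupied bands
  -- at `k` and the bound on their sum.
  obtain ⟨M, -, h1, -, h2, -⟩ := (hm k (subset_closure hk)).compare (f := e) (ε := εF) (h := 0)
    (by positivity) (by simp) fun n => Or.inr (Or.inr (by simp))
  rw [hS k M h1]
  exact h2

theorem IsBandFamily.density_estimate {e : ℕ → E d → ℝ} (he : IsBandFamily b e) {N εF : ℝ}
    (hF : HasRegularFermiSurface e εF) (hN : ∀ ε, integratedDOS b e ε = N ↔ ε = εF)
    {F : Type*} [NormedAddCommGroup F] [NormedSpace ℝ F] {β : ℕ → E d → F}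
    (hsm : ∀ M k₀, (∀ j < M, e j k₀ < e M k₀) →
      ContDiffAt ℝ ⊤ (fun k => ∑ n ∈ Finset.range M, β n k) k₀)
    (hper : ∀ M k₀, (∀ j < M, e j k₀ < e M k₀) → ∀ K ∈ recipLattice b,
      ∑ n ∈ Finset.range M, β n (k₀ + K) = ∑ n ∈ Finset.range M, β n k₀)
    {P Q : ℕ → BZOperator b} {p q : ℕ} (hP : IsInterpolationOfOrder b P p)
    (hQ : IsInterpolationOfOrder b Q q) {R : ℕ → NodalRule b}
    (hR : ∀ L, 1 ≤ L → (R L).Represents (P L)) :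
    ∃ n₀ : ℕ, (∀ n, n₀ ≤ n → ∀ k, εF < e n k) ∧
      (∀ L ε, integratedDOS b (fun n => (Q L).toLin (e n)) ε = N →
        ∀ n, n₀ ≤ n → ∀ k, ε < (Q L).toLin (e n) k) ∧
      IntegrableOn (fun k => ∑ n ∈ Finset.range n₀, {k | e n k ≤ εF}.indicator (β n) k)
        (brillouinZone b) ∧
      ∃ C : ℝ, 0 ≤ C ∧ ∀ L : ℕ, 1 ≤ L → ∀ ε : ℝ,
        integratedDOS b (fun n => (Q L).toLin (e n)) ε = N →
        ‖(⨍ k in brillouinZone b, ∑ n ∈ Finset.range n₀, {k | e n k ≤ εF}.indicator (β n) k) -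
          ⨍ k in brillouinZone b, ∑ n ∈ Finset.range n₀,
            {k | (Q L).toLin (e n) k ≤ ε}.indicator ((R L).apply (β n)) k‖ ≤
          C * (1 / (L : ℝ) ^ (p + 1) + 1 / (L : ℝ) ^ (q + 1)) := by
  obtain ⟨l, hl⟩ := he.exists_level_bound hQ N
  obtain ⟨n₀, hn₀⟩ := he.exists_lt_interp hQ (max l (εF + 1))
  have hn₁ : ∀ n, n₀ ≤ n → ∀ k, εF + 1 < e n k := fun n hn k =>
    (le_max_right _ _).trans_lt (hn₀ n hn k).1
  have hn₁' : ∀ n, n₀ ≤ n → ∀ k, εF < e n k := fun n hn k => (lt_add_one _).trans (hn₁ n hn k)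
  have hn₂ : ∀ L ε, integratedDOS b (fun n => (Q L).toLin (e n)) ε = N →
      ∀ n, n₀ ≤ n → ∀ k, ε < (Q L).toLin (e n) k := fun L ε hε n hn k =>
    ((hl L ε hε).le.trans (le_max_left _ _)).trans_lt ((hn₀ n hn k).2 L)
  have hgap := hasGapEstimate_nodal he.cont hsm hper hP hR
  have hint := he.integrableOn_occupied hF hn₁' hn₁ hsm hgap
  refine ⟨n₀, hn₁', hn₂, hint, ?_⟩
  have key := exists_forall_le_of_large
    (X := fun L => {ε : ℝ // integratedDOS b (fun n => (Q L).toLin (e n)) ε = N})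
    (err := fun L ε =>
      ‖(⨍ k in brillouinZone b, ∑ n ∈ Finset.range n₀, {k | e n k ≤ εF}.indicator (β n) k) -
          ⨍ k in brillouinZone b, ∑ n ∈ Finset.range n₀,
            {k | (Q L).toLin (e n) k ≤ ε.1}.indicator ((R L).apply (β n)) k‖)
    (a := fun L => 1 / (L : ℝ) ^ (p + 1) + 1 / (L : ℝ) ^ (q + 1))
    (fun L hL => by
      have : (0 : ℝ) < L := by exact_mod_cast hL
      positivity) ?_ ?_
  · obtain ⟨C, hC, h⟩ := key
    exact ⟨C, hC, fun L hL ε hε => h L hL ⟨ε, hε⟩⟩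
  · obtain ⟨C, L₀, hC, h⟩ := he.exists_average_le hF hN hQ hgap
    refine ⟨C, L₀, hC, fun L hL hL' ε => ?_⟩
    have h3 := h L hL hL' ε.1 ε.2 _ _ (isOccupiedSum_sum_indicator _ hn₁')
      (isOccupiedSum_sum_indicator _ (hn₂ L ε.1 ε.2))
    rw [average_sub hint] at h3
    · exact h3
    · exact integrable_finsetSum _ fun n _ => integrableOn_indicator_le
        (he.continuous_interp (Q L) n) ((R L).continuous_apply _) ε.1
  · intro L _
    have h4 : ∀ n, ∃ c, ∀ k ∈ brillouinZone b, ‖(R L).apply (β n) k‖ ≤ c := fun n => by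
      obtain ⟨c, hc⟩ := (brillouinZone_isCompact_closure b).exists_bound_of_continuousOn
        ((R L).continuous_apply (β n)).continuousOn
      exact ⟨c, fun k hk => hc k (subset_closure hk)⟩
    choose c hc using h4
    refine ⟨_, fun ε => (norm_sub_le _ _).trans (add_le_add_right
      (norm_average_sum_indicator_le (fun n => {k | (Q L).toLin (e n) k ≤ ε.1}) hc
        (Finset.range n₀)) _)⟩

end

section

variable {d : ℕ} {b : Module.Basis (Fin d) ℝ (E d)}

/-! ### The Bloch bands -/

theorem isBandFamily_bandE (hd : 1 ≤ d) {s : ℝ} {A : Coef b →L[ℂ] Coef b} (hA : IsPotential s A) :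
    IsBandFamily b (bandE A) where
  mono := bandE_mono hd hA.symm
  cont := continuous_bandE hd hA.symm
  per n K hK k := bandE_add hd hA.symm hA.shift n k ⟨K, hK⟩
  compare := ⟨‖A‖, bandE_nonneg hd hA.symm, fun n k k' _ hθ => bandE_compare hd hA.symm n k k' hθ⟩
  unbounded := exists_bandE_gt hd hA.symm 0

theorem IsPotential.exists_sobScale_eigensystem {s : ℝ} (hs : 0 ≤ s) {A : Coef b →L[ℂ] Coef b}
    (hA : IsPotential s A) {k : E d} {e : ℕ → ℝ} {x : ℕ → Coef b} (hx : IsEigensystem A k e x) :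
    ∃ α : ℕ → Coef b, ∀ n, sobScale b (s + 2) (α n) = x n := by
  choose α hα using fun n => hA.exists_sobScale_eigen (hx.eigen n) hs
  exact ⟨α, hα⟩

theorem contDiffAt_sum_bandE (hd : 1 ≤ d) {s : ℝ} (hs : 0 ≤ s) {A : Coef b →L[ℂ] Coef b}
    (hA : IsPotential s A) (M : ℕ) (k₀ : E d) (hgap : ∀ j < M, bandE A j k₀ < bandE A M k₀) :
    ContDiffAt ℝ ⊤ (fun k => ∑ n ∈ Finset.range M, bandE A n k) k₀ := by
  -- Only the eigenvalue sum is needed, so the form `B` is taken to be zero.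
  obtain ⟨S, D, hS, -, h⟩ := exists_smooth_sums hd hs hA 0 (by simp) hgap
  refine hS.congr_of_eventuallyEq ?_
  filter_upwards [h] with k hk
  obtain ⟨x, hx⟩ := exists_bandE_eigensystem hd hA.symm k
  obtain ⟨α, hα⟩ := hA.exists_sobScale_eigensystem hs hx
  exact (hk x α hx hα).1.symm

/-- An isolated band has a gap on both sides, and it is the difference of two consecutive sums of
low bands. -/
theorem contDiffAt_bandE (hd : 1 ≤ d) {s : ℝ} (hs : 0 ≤ s) {A : Coef b →L[ℂ] Coef b}
    (hA : IsPotential s A) {n : ℕ} {k₀ : E d} (hn : ∀ m, m ≠ n → bandE A m k₀ ≠ bandE A n k₀) :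
    ContDiffAt ℝ ⊤ (bandE A n) k₀ := by
  have hlt : ∀ m m', m < m' → (m = n ∨ m' = n) → bandE A m k₀ < bandE A m' k₀ := by
    intro m m' h1 h2
    refine lt_of_le_of_ne (bandE_mono hd hA.symm k₀ h1.le) ?_
    rcases h2 with rfl | rfl
    · exact (hn m' h1.ne').symm
    · exact hn m h1.ne
  have h1 := contDiffAt_sum_bandE hd hs hA n k₀ fun j hj => hlt j n hj (Or.inr rfl)
  have h2 := contDiffAt_sum_bandE hd hs hA (n + 1) k₀ fun j hj =>
    (bandE_mono hd hA.symm k₀ (Nat.lt_succ_iff.mp hj)).trans_lt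
      (hlt n (n + 1) n.lt_succ_self (Or.inl rfl))
  refine (h2.sub h1).congr_of_eventuallyEq (Eventually.of_forall fun k => ?_)
  simp [Finset.sum_range_succ]

theorem shiftOp_neg_shiftOp (K : recipLattice b) (x : Coef b) : shiftOp K (shiftOp (-K) x) = x := by
  ext K'
  rw [shiftOp_apply, shiftOp_apply, add_neg_cancel_right]

theorem IsEigensystem.shift {A : Coef b →L[ℂ] Coef b}
    (hA : ∀ K₀ x, A (shiftOp K₀ x) = shiftOp K₀ (A x)) {k : E d} {e : ℕ → ℝ} {x : ℕ → Coef b}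
    (hx : IsEigensystem A k e x) (K : recipLattice b) :
    IsEigensystem A (k + K) e (fun n => shiftOp K (x n)) where
  orthonormal := hx.orthonormal.comp_linearIsometry (shiftOp K)
  complete := by
    rw [Submodule.eq_bot_iff]
    intro y hy
    have h1 : shiftOp (-K) y ∈ (Submodule.span ℂ (range x))ᗮ := by
      rw [Submodule.mem_orthogonal]
      intro z hz
      have h2 : shiftOp K z ∈ Submodule.span ℂ (range fun n => shiftOp K (x n)) := by
        have h3 := Submodule.mem_map_of_mem (f := (shiftOp K).toLinearMap) hz
        rw [Submodule.map_span, ← range_comp] at h3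
        exact h3
      have h3 := (Submodule.mem_orthogonal _ _).mp hy _ h2
      rwa [← shiftOp_neg_shiftOp K y, LinearIsometry.inner_map_map] at h3
    rw [hx.complete, Submodule.mem_bot] at h1
    rw [← shiftOp_neg_shiftOp K y, h1, map_zero]
  eigen n := by
    have := (hx.eigen n).shift hA K
    rwa [map_smul] at this
  mono := hx.mono

/-! ### Occupied densities -/

/-- The form `B` represents the map `(u, v) ↦ u v̄` in the coordinates of `H^{s+2}`. -/
def IsDensityForm (b : Module.Basis (Fin d) ℝ (E d)) (hd : d ≤ 3) (s : ℝ)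
    (B : Coef b →L[ℝ] Coef b →L[ℝ] Coef b) : Prop :=
  ∀ a a', sobScale b (s + 2) (B a a') = densityForm b hd (sobScale b s a) (sobScale b s a')

theorem IsDensityForm.smul {hd : d ≤ 3} {s : ℝ} (hs : 0 ≤ s)
    {B : Coef b →L[ℝ] Coef b →L[ℝ] Coef b} (hB : IsDensityForm b hd s B) (c c' : ℂ)
    (a a' : Coef b) : B (c • a) (c' • a') = (c * conj c') • B a a' := by
  refine sobScale_injective (b := b) (by linarith : 0 ≤ s + 2) ?_
  rw [hB, (sobScale b s).map_smul c, (sobScale b s).map_smul c', densityForm_smul,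
    (sobScale b (s + 2)).map_smul, hB]

theorem IsDensityForm.shift {hd : d ≤ 3} {s : ℝ} (hs : 0 ≤ s)
    {B : Coef b →L[ℝ] Coef b →L[ℝ] Coef b} (hB : IsDensityForm b hd s B) (K : recipLattice b)
    {a a' : Coef b} (h : sobScale b (s + 2) a' = shiftOp K (sobScale b (s + 2) a)) :
    B a' a' = B a a := by
  refine sobScale_injective (b := b) (by linarith : 0 ≤ s + 2) ?_
  rw [hB, hB]
  refine densityForm_shift hd K ?_
  rwa [add_comm, sobScale_add (by norm_num) hs, sobScale_add (by norm_num) hs] at h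

theorem contDiffAt_sum_density (hd : 1 ≤ d) {hd' : d ≤ 3} {s : ℝ} (hs : 0 ≤ s)
    {A : Coef b →L[ℂ] Coef b} (hA : IsPotential s A) {B : Coef b →L[ℝ] Coef b →L[ℝ] Coef b}
    (hB : IsDensityForm b hd' s B) {x α : ℕ → E d → Coef b}
    (hx : ∀ k, IsEigensystem A k (fun n => bandE A n k) fun n => x n k)
    (hα : ∀ n k, sobScale b (s + 2) (α n k) = x n k) (M : ℕ) (k₀ : E d)
    (hgap : ∀ j < M, bandE A j k₀ < bandE A M k₀) :
    ContDiffAt ℝ ⊤ (fun k => ∑ n ∈ Finset.range M, B (α n k) (α n k)) k₀ := by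
  obtain ⟨S, D, -, hD, h⟩ := exists_smooth_sums hd hs hA B (hB.smul hs) hgap
  refine hD.congr_of_eventuallyEq ?_
  filter_upwards [h] with k hk
  exact (hk (fun n => x n k) (fun n => α n k) (hx k) fun n => hα n k).2.symm

/-- The eigenbases at `k₀` and `k₀ + K` are unrelated. Translating the second one back gives another
eigensystem at `k₀`, with the same densities, and the sum below a gap is the same for every
eigensystem. -/
theorem sum_density_periodic (hd : 1 ≤ d) {hd' : d ≤ 3} {s : ℝ} (hs : 0 ≤ s)
    {A : Coef b →L[ℂ] Coef b} (hA : IsPotential s A) {B : Coef b →L[ℝ] Coef b →L[ℝ] Coef b}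
    (hB : IsDensityForm b hd' s B) {x α : ℕ → E d → Coef b}
    (hx : ∀ k, IsEigensystem A k (fun n => bandE A n k) fun n => x n k)
    (hα : ∀ n k, sobScale b (s + 2) (α n k) = x n k) (M : ℕ) (k₀ : E d)
    (hgap : ∀ j < M, bandE A j k₀ < bandE A M k₀) (K : recipLattice b) :
    ∑ n ∈ Finset.range M, B (α n (k₀ + K)) (α n (k₀ + K)) =
      ∑ n ∈ Finset.range M, B (α n k₀) (α n k₀) := by
  obtain ⟨S, D, -, -, h⟩ := exists_smooth_sums hd hs hA B (hB.smul hs) hgap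
  have h0 := h.self_of_nhds
  have hx' := (hx (k₀ + K)).shift hA.shift (-K)
  have e1 : k₀ + (K : E d) + ((-K : recipLattice b) : E d) = k₀ := by push_cast; abel
  have e2 : (fun n => bandE A n (k₀ + K)) = fun n => bandE A n k₀ :=
    funext fun n => bandE_add hd hA.symm hA.shift n k₀ K
  rw [e1, e2] at hx'
  obtain ⟨α', hα'⟩ := hA.exists_sobScale_eigensystem hs hx'
  rw [← (h0 _ _ (hx k₀) fun n => hα n k₀).2, (h0 _ _ hx' hα').2]
  refine Finset.sum_congr rfl fun n _ => (hB.shift hs (-K) ?_).symm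
  rw [hα', hα]

/-! ### Expression of the densities -/

theorem average_map {F F' : Type*} [NormedAddCommGroup F] [NormedSpace ℝ F] [CompleteSpace F]
    [NormedAddCommGroup F'] [NormedSpace ℝ F'] [CompleteSpace F'] (J : F →L[ℝ] F') {f : E d → F}
    (hf : IntegrableOn f (brillouinZone b)) :
    ⨍ k in brillouinZone b, J (f k) = J (⨍ k in brillouinZone b, f k) := by
  rw [setAverage_eq, setAverage_eq, map_smul, J.integral_comp_comm hf]

theorem map_sum_indicator {F F' : Type*} [NormedAddCommGroup F] [NormedSpace ℝ F]
    [NormedAddCommGroup F'] [NormedSpace ℝ F'] (J : F →L[ℝ] F') {β : ℕ → E d → F} {g : ℕ → E d → F'}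
    (h : ∀ n k, J (β n k) = g n k) (A : ℕ → Set (E d)) (s : Finset ℕ) (k : E d) :
    J (∑ n ∈ s, (A n).indicator (β n) k) = ∑ n ∈ s, (A n).indicator (g n) k := by
  rw [map_sum]
  refine Finset.sum_congr rfl fun n _ => ?_
  by_cases hk : k ∈ A n
  · rw [indicator_of_mem hk, indicator_of_mem hk, h]
  · rw [indicator_of_notMem hk, indicator_of_notMem hk, map_zero]

theorem NodalRule.map_apply {F F' : Type*} [NormedAddCommGroup F] [NormedSpace ℝ F]
    [NormedAddCommGroup F'] [NormedSpace ℝ F'] (J : F →L[ℝ] F') (R : NodalRule b) (f : E d → F)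
    (k : E d) : J (R.apply f k) = R.apply (fun k => J (f k)) k := by
  simp only [NodalRule.apply, map_sum, map_smul]

theorem density_eq {V : E d → ℝ} {u : ℕ → E d → L2per b} {ε : ℝ} {n₀ : ℕ}
    (hn₀ : ∀ n, n₀ ≤ n → ∀ k, ε < bandEnergy b V n k) {F : Type*} [NormedAddCommGroup F]
    [NormedSpace ℝ F] [CompleteSpace F] (J : F →L[ℝ] L1per b) {β : ℕ → E d → F}
    (hβ : ∀ n k, J (β n k) = absSq b (u n k))
    (hint : IntegrableOn (fun k => ∑ n ∈ Finset.range n₀,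
      {k | bandEnergy b V n k ≤ ε}.indicator (β n) k) (brillouinZone b)) :
    density b V u ε = J (⨍ k in brillouinZone b, ∑ n ∈ Finset.range n₀,
      {k | bandEnergy b V n k ≤ ε}.indicator (β n) k) := by
  rw [density, ← average_map J hint]
  congr 1
  ext1 k
  rw [map_sum_indicator J hβ, tsum_eq_sum]
  intro n hn
  have h : k ∉ {k | bandEnergy b V n k ≤ ε} := not_le.mpr (hn₀ n (by simpa using hn) k)
  exact indicator_of_notMem h _

theorem interpDensity_eq {V : E d → ℝ} {u : ℕ → E d → L2per b} {R : NodalRule b} {Q : BZOperator b}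
    {ε : ℝ} {n₀ : ℕ} (hc : ∀ n, Continuous (interpBand V Q n))
    (hn₀ : ∀ n, n₀ ≤ n → ∀ k, ε < interpBand V Q n k) {F : Type*} [NormedAddCommGroup F]
    [NormedSpace ℝ F] [CompleteSpace F] (J : F →L[ℝ] L1per b) {β : ℕ → E d → F}
    (hβ : ∀ n k, J (β n k) = absSq b (u n k)) :
    interpDensity V u R Q ε = J (⨍ k in brillouinZone b, ∑ n ∈ Finset.range n₀,
      {k | interpBand V Q n k ≤ ε}.indicator (R.apply (β n)) k) := by
  rw [interpDensity, tsum_average_indicator hc (fun n => R.continuous_apply _) hn₀,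
    ← average_map J (integrable_finsetSum _ fun n _ =>
      integrableOn_indicator_le (hc n) (R.continuous_apply _) ε)]
  congr 1
  ext1 k
  refine (map_sum_indicator J (fun n k => ?_) _ _ k).symm
  rw [R.map_apply]
  simp only [hβ]

theorem memLp_cellMeasure {V : E d → ℝ} (hV : MemLp V ∞ volume) :
    MemLp (fun r => (V r : ℂ)) ∞ (cellMeasure b) :=
  (hV.restrict (unitCell b)).ofReal

theorem hasRegularFermiSurface (hd : 1 ≤ d) {V : E d → ℝ} {s : ℝ} (hs : 0 ≤ s)
    (hV : MemLp (fun r => (V r : ℂ)) ∞ (cellMeasure b)) (hA : IsPotential s (potOp b hV)) {εF : ℝ}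
    (hA1 : NoBandCrossing b V εF) (hA2 : NoVanHove b V εF) :
    HasRegularFermiSurface (bandE (potOp b hV)) εF := by
  have hiso : ∀ n m k, n ≠ m → bandE (potOp b hV) n k = εF → bandE (potOp b hV) m k ≠ εF := by
    intro n m k hnm h1 h2
    rw [← bandEnergy_eq_bandE] at h1 h2
    exact (Set.ext_iff.mp (hA1 n m hnm) k).mp ⟨h1, h2⟩
  refine ⟨hiso, fun n k h => contDiffAt_bandE hd hs hA fun m hm h' => ?_, fun n k h h' => ?_⟩
  · exact hiso n m k hm.symm h (h'.trans h)
  · rw [← bandEnergy_eq_bandE] at h h'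
    refine hA2 n k h ?_
    rw [gradient, h', map_zero]

/-- The comparison is carried out in the Hilbert space of `H^{s+2}` coordinates, where `|u_n|²` is
represented by `B (α n) (α n)`. The bounded map `toDensity` commutes with averages and nodal rules
and does not increase the norm, so the estimate passes to the densities. -/
theorem exists_density_bound (hd : 1 ≤ d) (hd' : d ≤ 3) {V : E d → ℝ} {s : ℝ} (hs : 0 ≤ s)
    (hV : MemLp (fun r => (V r : ℂ)) ∞ (cellMeasure b)) (hA : IsPotential s (potOp b hV))
    {N εF : ℝ} (hN : IsFermiLevel b V N εF) (hF : HasRegularFermiSurface (bandE (potOp b hV)) εF)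
    {P Q : ℕ → BZOperator b} {p q : ℕ} (hP : IsInterpolationOfOrder b P p)
    (hQ : IsInterpolationOfOrder b Q q) {u : ℕ → E d → L2per b} (hu : IsEigenbasis b V u)
    {R : ℕ → NodalRule b} (hR : ∀ L, 1 ≤ L → (R L).Represents (P L)) :
    ∃ C : ℝ, 0 ≤ C ∧ ∀ L : ℕ, 1 ≤ L → ∀ εFL : ℝ,
      integratedDOS b (interpBand V (Q L)) εFL = N →
      sobolevENorm b (s + 2)
          (fun r => (((density b V u εF - interpDensity V u (R L) (Q L) εFL : L1per b) r : ℝ) : ℂ))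
        ≤ ENNReal.ofReal (C * (1 / (L : ℝ) ^ (p + 1) + 1 / (L : ℝ) ^ (q + 1))) := by
  have hE : bandEnergy b V = bandE (potOp b hV) := funext fun n => bandEnergy_eq_bandE hV n
  have he : IsBandFamily b (bandEnergy b V) := hE ▸ isBandFamily_bandE hd hA
  rw [← hE] at hF
  have hx := fun k => hu.isEigensystem hd hV k
  choose α hα using fun n k => hA.exists_sobScale_eigen ((hx k).eigen n) hs
  obtain ⟨B, hB⟩ := exists_densityForm (b := b) hd' hs
  have hBf : IsDensityForm b hd' s B := hB
  have hβ : ∀ n k, toDensity b hd' s (B (α n k) (α n k)) = absSq b (u n k) := fun n k =>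
    toDensity_eq_absSq hd' hs (hα n k).symm (hB _ _)
  obtain ⟨n₀, h1, h2, h3, C, hC, h4⟩ := he.density_estimate hF hN
    (β := fun n k => B (α n k) (α n k))
    (fun M k₀ h => contDiffAt_sum_density hd hs hA hBf hx hα M k₀ (by rwa [hE] at h))
    (fun M k₀ h K hK => sum_density_periodic hd hs hA hBf hx hα M k₀ (by rwa [hE] at h) ⟨K, hK⟩)
    hP hQ hR
  refine ⟨C, hC, fun L hL ε hε => ?_⟩
  rw [density_eq h1 (toDensity b hd' s) hβ h3,
    interpDensity_eq (he.continuous_interp (Q L)) (h2 L ε hε) (toDensity b hd' s) hβ, ← map_sub]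
  exact (sobolevENorm_toDensity_le hd' hs _).trans (ENNReal.ofReal_le_ofReal (h4 L hL ε hε))

end

end BlochBands

end

/-! ### The theorem -/

theorem mainTheorem1 (d : ℕ) (hd : 1 ≤ d) (hd' : d ≤ 3)
    (b : Module.Basis (Fin d) ℝ (EuclideanSpace ℝ (Fin d)))
    (V : EuclideanSpace ℝ (Fin d) → ℝ)
    (hVper : LatticePeriodic b V) (hVbdd : MemLp V ∞ volume)
    (s : ℝ) (hs : 0 ≤ s) (hVs : sobolevENorm b s (fun r => (V r : ℂ)) < ⊤)
    (N εF : ℝ) (hF : IsFermiLevel b V N εF)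
    (hA1 : NoBandCrossing b V εF) (hA2 : NoVanHove b V εF)
    (p q : ℕ) (P Q : ℕ → BZOperator b)
    (hP : IsInterpolationOfOrder b P p) (hQ : IsInterpolationOfOrder b Q q) :
    (∀ u : ℕ → EuclideanSpace ℝ (Fin d) → L2per b, IsEigenbasis b V u →
      ∀ R : ℕ → NodalRule b, (∀ L : ℕ, 1 ≤ L → (R L).Represents (P L)) →
      ∃ C : ℝ, 0 ≤ C ∧ ∀ L : ℕ, 1 ≤ L → ∀ εFL : ℝ,
        integratedDOS b (interpBand V (Q L)) εFL = N →
        sobolevENorm b (s + 2)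
            (fun r => (((density b V u εF - interpDensity V u (R L) (Q L) εFL : L1per b) r : ℝ) : ℂ))
          ≤ ENNReal.ofReal (C * (1 / (L : ℝ) ^ (p + 1) + 1 / (L : ℝ) ^ (q + 1)))) ∧
    (∃ C : ℝ, 0 ≤ C ∧ ∀ L : ℕ, 1 ≤ L → ∀ εFL : ℝ,
      integratedDOS b (interpBand V (Q L)) εFL = N →
      |integratedEnergy b (bandEnergy b V) (bandEnergy b V) εF -
          integratedEnergy b (interpBand V (P L)) (interpBand V (Q L)) εFL|
        ≤ C * (1 / (L : ℝ) ^ (p + 1) + 1 / (L : ℝ) ^ (2 * q + 2))) := by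
  have hV := memLp_cellMeasure (b := b) hVbdd
  have hA := isPotential_potOp hd' hV hVs
  have hFS := hasRegularFermiSurface hd hs hV hA hA1 hA2
  refine ⟨fun u hu R hR => exists_density_bound hd hd' hs hV hA hF hFS hP hQ hu hR, ?_⟩
  have hE : bandEnergy b V = bandE (potOp b hV) := funext fun n => bandEnergy_eq_bandE hV n
  have he : IsBandFamily b (bandEnergy b V) := hE ▸ isBandFamily_bandE hd hA
  have hsm := contDiffAt_sum_bandE hd hs hA
  rw [← hE] at hsm hFS
  exact he.energy_estimate hsm hFS hF hP hQ
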